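/- **Setting.** Let S be a finite-dimensional quantum system with Hamiltonian $H_S$ whose ground-state energy is $0$ and whose other energies are at least $E_{\rm gap}>0$. Let $H_S=\sum_n E_n\Pi_{E_n}$ be its spectral decomposition, $\mathcal C$ its ground subspace (the code subspace) and $\Pi_{\mathcal C}$ the projector on $\mathcal C$. Let E be an environment formed from finitely many (arbitrarily many) sites, each with an arbitrary Hilbert space, with Hamiltonian $H_E$, in an equilibrium state $\rho_E$ ($[\rho_E,H_E]=0$). Let the coupling be $\lambda H_I=\lambda\, S\otimes B$ with $S$ and $B$ bounded and Hermitian, and let $\rho_S(t)={\rm Tr}_E\big(e^{-itH_\lambda}(\rho_S\otimes\rho_E)e^{itH_\lambda}\big)$, where $H_\lambda=H_S+\lambda H_I+H_E$ and $\rho_S$ is a state supported in $\mathcal C$. For a frequency $\mu\in\Omega=\{E_n-E_m\}$ put $S_\mu=\sum_n\Pi_{E_n}S\,\Pi_{E_n+\mu}$, and let $\tilde B(s)=e^{iH_Es}Be^{-iH_Es}$, $$\Gamma_{\mu_1\mu_2}(t)=\int_0^t ds_1\int_0^{s_1}ds_2\; e^{i(-\mu_1s_1+\mu_2s_2)}\,{\rm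 Tr}\big(\tilde B(s_2-s_1)B\rho_E\big),$$ $$F_{LS}(t)=\sum_{\mu_1,\mu_2\in\Omega}\frac{\Gamma^*_{\mu_1\mu_2}(t)-\Gamma_{\mu_2\mu_1}(t)}{2i}\,S_{\mu_1}^\dagger S_{\mu_2},\qquad U_{LS}(t)=e^{-i\lambda^2\Pi_{\mathcal C}F_{LS}(t)\Pi_{\mathcal C}} .$$ **Locality of the environment.** Suppose $H_E=\sum_i h_i+H_E^U$ (finitely many Hermitian $h_i$), where (i) $\|h_i\|\le J_{\max}$ with $J_{\max}>0$, while $H_E^U$ may be unbounded; (ii) each $h_i$ acts non-trivially on at most $k\geq 1$ sites, and at most $r\geq 1$ of the $h_i$ act non-trivially on any given site; (iii) $R_B$ is the number of the $h_i$ that do not commute with $B$; (iv) the supports of $B$ and $H_E^U$ are disjoint, and $l\in\{1,2,\dots\}\cup\{\infty\}$ is the minimum number of interactions $h_i$ needed to connect the support of $B$ to the support of $H_E^U$ ($l=\infty$ if they cannot be connected, e.g. if $H_E^U=0$). **Theorem.** Suppose moreover that the error detection condition holds: $(\Pi_{\mathcal C}\otimes I_E)H_I(\Pi_{\mathcal C}\otimes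 I_E)=\Pi_{\mathcal C}\otimes O_E$ for some operator $O_E$ on the environment. Then for every $t\ge 0$, as $\lambda\to0$, uniformly in the state $\rho_S$ in $\mathcal C$, $$1-F^2\big(U_{LS}^\dagger(t)\rho_S(t)U_{LS}(t),\rho_S\big)\le \lambda^2\,\frac{16\,\|\Pi_{\mathcal C}H_I^2\Pi_{\mathcal C}\|}{E_{\rm gap}^2}+\lambda^2\,\frac{t^2\,\|\Pi_{\mathcal C}H_I^2\Pi_{\mathcal C}\|}{Q(E_{\rm gap})}+\mathcal O(\lambda^3),$$ where $F(\sigma_1,\sigma_2)={\rm Tr}\sqrt{\sqrt{\sigma_1}\,\sigma_2\sqrt{\sigma_1}}$ is the fidelity, $\|\cdot\|$ is the operator norm, and $$Q(E_{\rm gap})={\rm Exp}_l\Big(\frac{E_{\rm gap}}{16J_{\max}rk}\Big)\Big(2^{R_B/(rk)}+1\Big)^{-1},\qquad {\rm Exp}_l(x)=\sum_{j=0}^{l}\frac{x^j}{j!}\quad({\rm Exp}_\infty(x)=e^x).$$ -/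

import Mathlib

open scoped Matrix InnerProductSpace ComplexOrder

namespace ErrorSuppression

noncomputable section

/-! ### Hilbert spaces

The environment is made of finitely many sites.  The Hilbert space of the site `x` is
`ℓ²(ι x)`, of arbitrary (finite or infinite) dimension, and the environment Hilbert space, the
Hilbert tensor product of the site spaces, is realised as `ℓ²(Π x, ι x)`.
The system is finite dimensional, with Hilbert space `ℂ^σ`, and system operators are matrices.
The joint Hilbert space `ℂ^σ ⊗ E` is realised as the `ℓ²` direct sum of copies of `E`. -/

/-- The Hilbert space with an orthonormal basis indexed by `κ`. -/
abbrev Hilb (κ : Type*) : Type _ := lp (fun _ : κ => ℂ) 2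

/-- The environment Hilbert space of a family of sites. -/
abbrev Env {Λ : Type*} (ι : Λ → Type*) : Type _ := Hilb (∀ x, ι x)

/-- The joint Hilbert space of the system `ℂ^σ` and of a space `E`. -/
abbrev Joint (σ : Type*) (E : Type*) : Type _ := PiLp 2 (fun _ : σ => E)

open Classical in
/-- The basis vector `|x⟩`. -/
def ket {κ : Type*} (x : κ) : Hilb κ := lp.single 2 x (1 : ℂ)

/-- The trace `∑ₓ ⟨x| A |x⟩` of an operator (only used for trace class operators). -/
def trace {κ : Type*} (A : Hilb κ →L[ℂ] Hilb κ) : ℂ := ∑' x, ⟪ket x, A (ket x)⟫_ℂ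

/-- Density operators: positive operators with trace one. -/
def IsDensityOperator {κ : Type*} (ρ : Hilb κ →L[ℂ] Hilb κ) : Prop :=
  ρ.IsPositive ∧ HasSum (fun x => ⟪ket x, ρ (ket x)⟫_ℂ) 1

section joint

variable {σ : Type*} [Fintype σ] [DecidableEq σ]
  {E : Type*} [NormedAddCommGroup E] [InnerProductSpace ℂ E]

/-- `M ⊗ A`, that is `((M ⊗ A) Ψ)_a = ∑_b M_{ab} A Ψ_b`. -/
def tensor (M : Matrix σ σ ℂ) (A : E →L[ℂ] E) : Joint σ E →L[ℂ] Joint σ E :=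
  (PiLp.continuousLinearEquiv 2 ℂ (fun _ : σ => E)).symm.toContinuousLinearMap ∘L
    ContinuousLinearMap.pi
      (fun a => ∑ b, M a b • (A ∘L PiLp.proj 2 (fun _ : σ => E) b))

/-- The isometry `ψ ↦ |b⟩ ⊗ ψ`. -/
def incl (b : σ) : E →L[ℂ] Joint σ E :=
  (PiLp.continuousLinearEquiv 2 ℂ (fun _ : σ => E)).symm.toContinuousLinearMap ∘L
    ContinuousLinearMap.single ℂ (fun _ : σ => E) b

/-- The block `⟨a| T |b⟩`, an operator on `E`. -/
def block (T : Joint σ E →L[ℂ] Joint σ E) (a b : σ) : E →L[ℂ] E :=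
  PiLp.proj 2 (fun _ : σ => E) a ∘L T ∘L incl b

/-- The possibly unbounded operator `I ⊗ H`, acting on each component. -/
def oneTensor (σ : Type*) [Fintype σ] (H : E →ₗ.[ℂ] E) : Joint σ E →ₗ.[ℂ] Joint σ E where
  domain :=
    { carrier := {Ψ | ∀ a, Ψ a ∈ H.domain}
      add_mem' := fun hΨ hΦ a => H.domain.add_mem (hΨ a) (hΦ a)
      zero_mem' := fun _ => H.domain.zero_mem
      smul_mem' := fun c _ hΨ a => H.domain.smul_mem c (hΨ a) }
  toFun :=
    { toFun := fun Ψ => WithLp.toLp 2 (fun a => H ⟨(Ψ : Joint σ E) a, Ψ.2 a⟩)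
      map_add' := by
        intro Ψ Φ
        ext a
        exact H.map_add ⟨_, Ψ.2 a⟩ ⟨_, Φ.2 a⟩
      map_smul' := by
        intro c Ψ
        ext a
        exact H.map_smul c ⟨_, Ψ.2 a⟩ }

/-- The partial trace over the environment. -/
def partialTrace {κ : Type*} (T : Joint σ (Hilb κ) →L[ℂ] Joint σ (Hilb κ)) : Matrix σ σ ℂ :=
  Matrix.of fun a b => trace (block T a b)

end joint

/-! ### Unbounded Hamiltonians and their evolution -/

section dynamics

variable {E : Type*} [NormedAddCommGroup E] [InnerProductSpace ℂ E] [CompleteSpace E]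

/-- `U t = e^{-iHt}`: `U` is a strongly continuous one-parameter unitary group, and its
generator is exactly `-iH`.  By Stone's theorem such a `U` exists if and only if `H` is
self-adjoint, and it is then unique. -/
structure IsPropagator (H : E →ₗ.[ℂ] E) (U : ℝ → (E →L[ℂ] E)) : Prop where
  unitary : ∀ t, U t ∈ unitary (E →L[ℂ] E)
  zero : U 0 = 1
  add : ∀ s t, U (s + t) = U s * U t
  continuous : ∀ ψ, Continuous fun t => U t ψ
  generator : ∀ ψ φ : E, HasDerivAt (fun t => U t ψ) φ 0 ↔
    ∃ h : ψ ∈ H.domain, φ = -Complex.I • H ⟨ψ, h⟩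

/-- The bounded operator `T` commutes with the possibly unbounded operator `H`: `T H ⊆ H T`. -/
def CommutesWith (T : E →L[ℂ] E) (H : E →ₗ.[ℂ] E) : Prop :=
  ∀ ψ : H.domain, ∃ h : T ψ ∈ H.domain, H ⟨T ψ, h⟩ = T (H ψ)

/-- The Heisenberg picture operator `e^{iHt} B e^{-iHt}`, where `U t = e^{-iHt}`. -/
def heisenberg (U : ℝ → (E →L[ℂ] E)) (B : E →L[ℂ] E) (t : ℝ) : E →L[ℂ] E :=
  U (-t) * B * U t

end dynamics

/-! ### Locality in the environment -/

section locality

variable {Λ : Type*} {ι : Λ → Type*}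

/-- `T` is an operator of the single site `x`, i.e. of the form `a ⊗ I` with `a` acting on the
site `x` and the identity acting on all the other sites. -/
def IsSiteOperator (x : Λ) (T : Env ι →L[ℂ] Env ι) : Prop :=
  ∃ a : ι x → ι x → ℂ, ∀ s u : (∀ y, ι y),
    ((∀ y, y ≠ x → s y = u y) → ⟪ket s, T (ket u)⟫_ℂ = a (s x) (u x)) ∧
    ((¬ ∀ y, y ≠ x → s y = u y) → ⟪ket s, T (ket u)⟫_ℂ = 0)

/-- The set of sites on which a bounded operator acts non-trivially.  It acts trivially on `x`
(it has the form `I ⊗ A'`) iff it commutes with all operators of the site `x`. -/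
def supp (A : Env ι →L[ℂ] Env ι) : Set Λ :=
  {x | ¬ ∀ T : Env ι →L[ℂ] Env ι, IsSiteOperator x T → Commute T A}

/-- The set of sites on which a possibly unbounded operator acts non-trivially. -/
def suppUnbounded (H : Env ι →ₗ.[ℂ] Env ι) : Set Λ :=
  {x | ¬ ∀ T : Env ι →L[ℂ] Env ι, IsSiteOperator x T → CommutesWith T H}

/-- The sites that can be connected to the set `X` by at most `n` of the interactions `h i`. -/
def reach {I : Type*} (h : I → (Env ι →L[ℂ] Env ι)) (X : Set Λ) : ℕ → Set Λ
  | 0 => X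
  | n + 1 => reach h X n ∪ {x | ∃ i, x ∈ supp (h i) ∧ (supp (h i) ∩ reach h X n).Nonempty}

/-- The length of the shortest path between `X` and `Y` on the interaction graph: the minimum
number of interactions `h i` needed to connect `X` to `Y` (`⊤` if they cannot be connected). -/
def pathLength {I : Type*} (h : I → (Env ι →L[ℂ] Env ι)) (X Y : Set Λ) : ℕ∞ :=
  ⨅ n ∈ {n : ℕ | (reach h X n ∩ Y).Nonempty}, (n : ℕ∞)

/-- The number of interactions `h i` that do not commute with `B`. -/
def numNoncommuting {I : Type*} (h : I → (Env ι →L[ℂ] Env ι)) (B : Env ι →L[ℂ] Env ι) : ℕ :=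
  {i | ¬ Commute (h i) B}.ncard

end locality

/-- `Exp_l(x) = ∑_{j ≤ l} x^j / j!`; in particular `Exp_⊤ = exp`. -/
def truncExp (l : ℕ∞) (x : ℝ) : ℝ :=
  ∑' j : ℕ, if (j : ℕ∞) ≤ l then x ^ j / (j.factorial : ℝ) else 0

/-- The suppression factor
`Q(E_gap) = Exp_l(E_gap / (16 J_max r k)) * (2^{R_B / (r k)} + 1)⁻¹`. -/
def suppressionFactor (l : ℕ∞) (Jmax : ℝ) (r k R : ℕ) (Egap : ℝ) : ℝ :=
  truncExp l (Egap / (16 * Jmax * r * k)) * ((2 : ℝ) ^ ((R : ℝ) / ((r : ℝ) * k)) + 1)⁻¹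

/-! ### The system: spectral data, Lamb shift, fidelity -/

section system

variable {σ : Type*} [Fintype σ] [DecidableEq σ]

/-- The spectral projector of a Hermitian matrix `H` on the energy `e` (zero if `e` is not an
eigenvalue). -/
def spectralProj (H : Matrix σ σ ℂ) (e : ℝ) : Matrix σ σ ℂ :=
  cfc (fun x : ℝ => if x = e then (1 : ℝ) else 0) H

/-- The set of energies. -/
def energies (H : Matrix σ σ ℂ) : Finset ℝ := (Matrix.finite_real_spectrum (A := H)).toFinset

/-- The set `Ω` of the differences of two energies. -/
def frequencies (H : Matrix σ σ ℂ) : Finset ℝ :=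
  Finset.image₂ (fun e e' => e - e') (energies H) (energies H)

/-- The component `S_μ = ∑_n Π_{E_n} S Π_{E_n + μ}` of `S` in frequency `μ`. -/
def freqComponent (H S : Matrix σ σ ℂ) (μ : ℝ) : Matrix σ σ ℂ :=
  ∑ e ∈ energies H, spectralProj H e * S * spectralProj H (e + μ)

variable {κ : Type*}

/-- `Γ_{μ₁μ₂}(t) = ∫₀ᵗ ds₁ ∫₀^{s₁} ds₂ e^{i(-μ₁s₁+μ₂s₂)} Tr(B̃(s₂-s₁) B ρ_E)`. -/
def lambGamma (UE : ℝ → (Hilb κ →L[ℂ] Hilb κ)) (B ρE : Hilb κ →L[ℂ] Hilb κ)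
    (μ₁ μ₂ t : ℝ) : ℂ :=
  ∫ s₁ in (0 : ℝ)..t, ∫ s₂ in (0 : ℝ)..s₁,
    Complex.exp (Complex.I * (-μ₁ * s₁ + μ₂ * s₂)) *
      trace (heisenberg UE B (s₂ - s₁) * B * ρE)

/-- The Lamb shift operator `F_LS(t) = ∑ (Γ*_{μ₁μ₂} - Γ_{μ₂μ₁})/(2i) S†_{μ₁} S_{μ₂}`. -/
def lambShift (HS S : Matrix σ σ ℂ) (UE : ℝ → (Hilb κ →L[ℂ] Hilb κ))
    (B ρE : Hilb κ →L[ℂ] Hilb κ) (t : ℝ) : Matrix σ σ ℂ :=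
  ∑ μ₁ ∈ frequencies HS, ∑ μ₂ ∈ frequencies HS,
    ((star (lambGamma UE B ρE μ₁ μ₂ t) - lambGamma UE B ρE μ₂ μ₁ t) / (2 * Complex.I)) •
      ((freqComponent HS S μ₁)ᴴ * freqComponent HS S μ₂)

/-- The projector on the code subspace, the zero energy subspace of `H_S`. -/
def codeProj (HS : Matrix σ σ ℂ) : Matrix σ σ ℂ := spectralProj HS 0

/-- The unitary `U_LS(t) = exp(-i λ² Π_C F_LS(t) Π_C)`. -/
def lambUnitary (HS S : Matrix σ σ ℂ) (UE : ℝ → (Hilb κ →L[ℂ] Hilb κ))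
    (B ρE : Hilb κ →L[ℂ] Hilb κ) (lam t : ℝ) : Matrix σ σ ℂ :=
  NormedSpace.exp ((-Complex.I * (lam : ℂ) ^ 2) •
    (codeProj HS * lambShift HS S UE B ρE t * codeProj HS))

/-- The total Hamiltonian `H_S ⊗ I + λ S ⊗ B + I ⊗ H_E`. -/
def totalHamiltonian (HS S : Matrix σ σ ℂ) (HE : Hilb κ →ₗ.[ℂ] Hilb κ)
    (B : Hilb κ →L[ℂ] Hilb κ) (lam : ℝ) :
    Joint σ (Hilb κ) →ₗ.[ℂ] Joint σ (Hilb κ) :=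
  (tensor HS (1 : Hilb κ →L[ℂ] Hilb κ) + (lam : ℂ) • tensor S B).toLinearMap +ᵥ oneTensor σ HE

/-- The reduced state `Tr_E (U (ρ_S ⊗ ρ_E) U†)`. -/
def reducedState (U : Joint σ (Hilb κ) →L[ℂ] Joint σ (Hilb κ)) (ρS : Matrix σ σ ℂ)
    (ρE : Hilb κ →L[ℂ] Hilb κ) : Matrix σ σ ℂ :=
  partialTrace (U * tensor ρS ρE * ContinuousLinearMap.adjoint U)

/-- The Uhlmann fidelity `Tr √(√ρ₁ ρ₂ √ρ₁)`. -/
def fidelity (ρ₁ ρ₂ : Matrix σ σ ℂ) : ℝ :=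
  (cfc Real.sqrt (cfc Real.sqrt ρ₁ * ρ₂ * cfc Real.sqrt ρ₁)).trace.re

/-- Density matrices of the system whose range is in the code subspace. -/
def IsCodeState (HS ρ : Matrix σ σ ℂ) : Prop :=
  ρ.PosSemidef ∧ ρ.trace = 1 ∧ codeProj HS * ρ * codeProj HS = ρ

end system

end

end ErrorSuppression

open ErrorSuppression

/-! First-order perturbation theory suffices; no master equation is derived. Let `v` be a code
vector, so `HS v = 0`, and let `b j` be an eigenbasis of `HS` with energies `E_j`. In the
interaction picture the Dyson expansion reads `v ⊗ φ - iλ ∑ j, b j ⊗ ⟪b j, S v⟫ ∫₀ᵗ e^{i E_j s}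
B̃(s) φ ds + O(λ²)` (`IsPropagator.norm_dyson_le`, `filtered_pureTensor`). The terms with `E_j = 0`
are the code component of `S v`. By error detection it is `c v` with `c` independent of `v`, so
these terms change only the environment vector. The terms with `E_j ≥ Egap` are mutually orthogonal.
If the filtered integrals satisfy `‖∫ …‖² ≤ K ‖B‖² ‖φ‖²`, the total squared norm of these terms is
at most `λ² K ‖Π_C H_I² Π_C‖` per unit vector (`norm_evolution_sub_le`, `norm_coupling_le`).

The constant `K = 16/Egap² + t²/Q` comes from repeated integration by parts against `e^{ies}`
(`norm_sq_filtered_le`). Each step gains `1/e` and replaces `B̃` by a commutator with `HE`. As long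
as fewer than `l` commutators have been taken, the result is supported away from `HU`, so only the
bounded `h i` enter. The `j`-th commutator involves at most `R + j r k` of them, each costing `2
Jmax`. The number of steps is then optimised in `exists_order`.

To pass from vectors to fidelity (`one_sub_fidelity_sq_le`), purify `ρS ⊗ ρE`. If the evolved
purification is within `δ` of `L` acting on the system times some environment vector, then `1 - F² ≤
δ²`. The tool is the easy half of Uhlmann's theorem, `norm_trace_le_fidelity`. Of the Lamb unitary
only two facts matter: it is unitary, and it is within `O(λ²)` of the identity. Hence `δ = |λ| √(N
K) + O(λ²)` with `N = ‖Π_C H_I² Π_C‖`, and the correction affects `δ²` only at order `λ³`.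

Since `HE` may be unbounded, derivatives and commutators are taken as sesquilinear forms on the
dense domain, and estimates are then extended by continuity. -/

open scoped Matrix InnerProductSpace ComplexOrder

namespace ErrorSuppression

noncomputable section

/-! ### Unitary groups with unbounded generators, and the first-order Dyson expansion -/

section propagators

variable {E : Type*} [NormedAddCommGroup E] [InnerProductSpace ℂ E]

theorem norm_le_of_dense {D : Set E} (hD : Dense D) {z : E} {C : ℝ} (hC : 0 ≤ C)
    (h : ∀ φ ∈ D, ‖⟪φ, z⟫_ℂ‖ ≤ C * ‖φ‖) : ‖z‖ ≤ C := by
  have key : ∀ φ : E, ‖⟪φ, z⟫_ℂ‖ ≤ C * ‖φ‖ := by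
    have hc : IsClosed {φ : E | ‖⟪φ, z⟫_ℂ‖ ≤ C * ‖φ‖} :=
      isClosed_le (by fun_prop) (by fun_prop)
    intro φ
    have : closure D ⊆ {φ : E | ‖⟪φ, z⟫_ℂ‖ ≤ C * ‖φ‖} := hc.closure_subset_iff.2 h
    exact this (hD φ)
  rcases eq_or_ne z 0 with rfl | hz
  · simpa using hC
  · have h1 := key z
    have h2 : ‖⟪z, z⟫_ℂ‖ = ‖z‖ * ‖z‖ := by
      rw [inner_self_eq_norm_sq_to_K, norm_pow]
      simp [sq]
    rw [h2] at h1
    exact le_of_mul_le_mul_right h1 (norm_pos_iff.2 hz)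

variable [CompleteSpace E] {H : E →ₗ.[ℂ] E} {U : ℝ → (E →L[ℂ] E)}

namespace IsPropagator

theorem norm_apply (hU : IsPropagator H U) (t : ℝ) (ψ : E) : ‖U t ψ‖ = ‖ψ‖ :=
  ContinuousLinearMap.norm_map_of_mem_unitary (hU.unitary t) ψ

theorem inner_apply (hU : IsPropagator H U) (t : ℝ) (φ ψ : E) :
    ⟪U t φ, U t ψ⟫_ℂ = ⟪φ, ψ⟫_ℂ :=
  ContinuousLinearMap.inner_map_map_of_mem_unitary (hU.unitary t) φ ψ

theorem add_apply (hU : IsPropagator H U) (s t : ℝ) (ψ : E) : U (s + t) ψ = U s (U t ψ) := by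
  rw [hU.add]; rfl

theorem apply_neg_apply (hU : IsPropagator H U) (t : ℝ) (ψ : E) : U t (U (-t) ψ) = ψ := by
  rw [← hU.add_apply, add_neg_cancel, hU.zero]; rfl

theorem neg_apply_apply (hU : IsPropagator H U) (t : ℝ) (ψ : E) : U (-t) (U t ψ) = ψ := by
  rw [← hU.add_apply, neg_add_cancel, hU.zero]; rfl

theorem inner_neg_apply (hU : IsPropagator H U) (t : ℝ) (φ ψ : E) :
    ⟪φ, U (-t) ψ⟫_ℂ = ⟪U t φ, ψ⟫_ℂ := by
  rw [← hU.inner_apply t φ, hU.apply_neg_apply]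

/-- `(t, ψ) ↦ U t ψ` is jointly continuous. -/
theorem continuous_apply (hU : IsPropagator H U) {X : Type*} [TopologicalSpace X] {τ : X → ℝ}
    {f : X → E} (hτ : Continuous τ) (hf : Continuous f) : Continuous fun x => U (τ x) (f x) := by
  rw [continuous_iff_continuousAt]
  intro x₀
  have h1 : Filter.Tendsto (fun x => U (τ x) (f x₀)) (nhds x₀) (nhds (U (τ x₀) (f x₀))) :=
    ((hU.continuous (f x₀)).comp hτ).tendsto x₀
  have h2 : Filter.Tendsto (fun x => U (τ x) (f x - f x₀)) (nhds x₀) (nhds 0) := by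
    rw [tendsto_zero_iff_norm_tendsto_zero]
    simp only [hU.norm_apply]
    have := (hf.tendsto x₀).sub_const (f x₀)
    rw [sub_self] at this
    simpa using this.norm
  have h3 := h1.add h2
  simp only [map_sub, add_sub_cancel, add_zero] at h3
  exact h3

/-- `U t` commutes with every `U s`, so the orbit of `U t ψ` is differentiable at `0`, and the
`generator` equivalence places `U t ψ` in the domain. -/
theorem apply_mem_domain (hU : IsPropagator H U) (t : ℝ) {ψ : E} (hψ : ψ ∈ H.domain) :
    ∃ h : U t ψ ∈ H.domain, H ⟨U t ψ, h⟩ = U t (H ⟨ψ, hψ⟩) := by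
  have h1 : HasDerivAt (fun s => U s ψ) (-Complex.I • H ⟨ψ, hψ⟩) 0 :=
    (hU.generator _ _).2 ⟨hψ, rfl⟩
  have h2 : HasDerivAt (fun s => U s (U t ψ)) (U t (-Complex.I • H ⟨ψ, hψ⟩)) 0 := by
    have := ((U t).restrictScalars ℝ).hasFDerivAt.comp_hasDerivAt (0 : ℝ) h1
    refine this.congr_of_eventuallyEq (Filter.Eventually.of_forall fun s => ?_)
    change U s (U t ψ) = U t (U s ψ)
    rw [← hU.add_apply, ← hU.add_apply, add_comm]
  obtain ⟨h, he⟩ := (hU.generator _ _).1 h2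
  refine ⟨h, ?_⟩
  rw [map_smul] at he
  exact (smul_right_injective E (neg_ne_zero.2 Complex.I_ne_zero) he).symm

theorem hasDerivAt_apply (hU : IsPropagator H U) {ψ : E} (hψ : ψ ∈ H.domain) (t : ℝ) :
    HasDerivAt (fun s => U s ψ) (-Complex.I • U t (H ⟨ψ, hψ⟩)) t := by
  have h1 : HasDerivAt (fun s => U s ψ) (-Complex.I • H ⟨ψ, hψ⟩) (t - t) := by
    rw [sub_self]; exact (hU.generator _ _).2 ⟨hψ, rfl⟩
  have h2 := h1.comp_sub_const t t
  have := ((U t).restrictScalars ℝ).hasFDerivAt.comp_hasDerivAt t h2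
  rw [← map_smul]
  refine this.congr_of_eventuallyEq (Filter.Eventually.of_forall fun s => ?_)
  change U s ψ = U t (U (s - t) ψ)
  rw [← hU.add_apply, add_sub_cancel]

/-- Differentiate the constant function `s ↦ ⟪U s φ, U s ψ⟫` at `0`. -/
theorem symmetric (hU : IsPropagator H U) (φ ψ : H.domain) :
    ⟪H φ, (ψ : E)⟫_ℂ = ⟪(φ : E), H ψ⟫_ℂ := by
  have h1 := (hU.hasDerivAt_apply φ.2 0).inner ℂ (hU.hasDerivAt_apply ψ.2 0)
  simp only [hU.inner_apply, hU.zero] at h1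
  have h2 := h1.unique (hasDerivAt_const (0 : ℝ) ⟪(φ : E), (ψ : E)⟫_ℂ)
  simp only [one_apply_eq_self, inner_smul_right, inner_smul_left, map_neg,
    Complex.conj_I, neg_neg] at h2
  have h3 : Complex.I * (⟪H φ, (ψ : E)⟫_ℂ - ⟪(φ : E), H ψ⟫_ℂ) = 0 := by
    rw [← h2]; ring
  exact sub_eq_zero.1 ((mul_eq_zero.1 h3).resolve_left Complex.I_ne_zero)

/-- Applying `U t` only shifts the endpoints of the integral, so the result is differentiable in `t`
by the fundamental theorem of calculus. Dividing by `ε` and letting `ε → 0` then gives density of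
the domain. -/
theorem integral_mem_domain (hU : IsPropagator H U) (ψ : E) (ε : ℝ) :
    ∫ s in (0 : ℝ)..ε, U s ψ ∈ H.domain := by
  have hc := hU.continuous ψ
  have hF : ∀ t, HasDerivAt (fun u => ∫ s in (0 : ℝ)..u, U s ψ) (U t ψ) t := fun t =>
    intervalIntegral.integral_hasDerivAt_right (hc.intervalIntegrable _ _)
      hc.stronglyMeasurable.stronglyMeasurableAtFilter hc.continuousAt
  have h1 : HasDerivAt (fun t => (∫ s in (0 : ℝ)..(t + ε), U s ψ) - ∫ s in (0 : ℝ)..t, U s ψ)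
      (U (0 + ε) ψ - U 0 ψ) 0 := ((hF (0 + ε)).comp_add_const 0 ε).sub (hF 0)
  have h2 : (fun t => U t (∫ s in (0 : ℝ)..ε, U s ψ)) =
      fun t => (∫ s in (0 : ℝ)..(t + ε), U s ψ) - ∫ s in (0 : ℝ)..t, U s ψ := by
    funext t
    rw [← (U t).intervalIntegral_comp_comm (hc.intervalIntegrable _ _)]
    simp only [← hU.add_apply]
    rw [intervalIntegral.integral_comp_add_left (fun s => U s ψ) t, add_zero,
      intervalIntegral.integral_interval_sub_left (hc.intervalIntegrable _ _)
        (hc.intervalIntegrable _ _)]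
  rw [← h2] at h1
  exact ((hU.generator _ _).1 h1).1

theorem dense_domain (hU : IsPropagator H U) : Dense (H.domain : Set E) := by
  intro ψ
  have hc := hU.continuous ψ
  have hF : HasDerivAt (fun u => ∫ s in (0 : ℝ)..u, U s ψ) (U 0 ψ) 0 :=
    intervalIntegral.integral_hasDerivAt_right (hc.intervalIntegrable _ _)
      hc.stronglyMeasurable.stronglyMeasurableAtFilter hc.continuousAt
  have h1 := hF.tendsto_slope
  rw [hU.zero] at h1
  refine mem_closure_of_tendsto h1 (Filter.Eventually.of_forall fun u => ?_)
  simp only [slope, intervalIntegral.integral_same, vsub_eq_sub, sub_zero]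
  change ((u⁻¹ : ℝ) • ∫ s in (0 : ℝ)..u, U s ψ) ∈ H.domain
  rw [← Complex.coe_smul]
  exact H.domain.smul_mem _ (hU.integral_mem_domain ψ u)

/-- A solution of the Schrödinger equation is given by the propagator. -/
theorem eq_apply_of_hasDerivAt (hU : IsPropagator H U) {y : ℝ → E} (hy : ∀ s, y s ∈ H.domain)
    (hd : ∀ s, HasDerivAt y (-Complex.I • H ⟨y s, hy s⟩) s) (t : ℝ) : y t = U t (y 0) := by
  have key : ∀ φ ∈ (H.domain : Set E), ⟪φ, U (-t) (y t) - y 0⟫_ℂ = 0 := by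
    intro φ hφ
    -- By symmetry of `H` this pairing is constant. Testing against the dense domain replaces a norm
    -- derivative of `U (-s) (y s)`.
    have hder : ∀ s, HasDerivAt (fun s => ⟪U s φ, y s⟫_ℂ) 0 s := by
      intro s
      refine ((hU.hasDerivAt_apply hφ s).inner ℂ (hd s)).congr_deriv ?_
      obtain ⟨h2, h3⟩ := hU.apply_mem_domain s hφ
      have h4 := hU.symmetric ⟨_, h2⟩ ⟨_, hy s⟩
      rw [h3] at h4
      simp only [inner_smul_right, inner_smul_left, h4, map_neg, Complex.conj_I]
      ring
    have h1 := is_const_of_deriv_eq_zero (fun s => (hder s).differentiableAt)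
      (fun s => (hder s).deriv) t 0
    rw [inner_sub_right, hU.inner_neg_apply, h1, hU.zero]
    simp
  have h0 : U (-t) (y t) - y 0 = 0 := by
    have := norm_le_of_dense hU.dense_domain (z := U (-t) (y t) - y 0) (C := 0) le_rfl
      (fun φ hφ => by rw [key φ hφ]; simp)
    simpa using this
  rw [← hU.apply_neg_apply t (y t), sub_eq_zero.1 h0]

section perturbation

variable {H' : E →ₗ.[ℂ] E} {U' : ℝ → (E →L[ℂ] E)} {V : E →L[ℂ] E} {lam : ℝ}

/-- Derivative of `⟨e^{-itH} φ, e^{-itH'} ψ⟩` for `H' = H + λ V`. -/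
theorem hasDerivAt_inner_perturbed (hU : IsPropagator H U) (hU' : IsPropagator H' U')
    (hdom : H'.domain = H.domain)
    (hadd : ∀ (ψ : E) (h : ψ ∈ H.domain) (h' : ψ ∈ H'.domain),
      H' ⟨ψ, h'⟩ = H ⟨ψ, h⟩ + (lam : ℂ) • V ψ)
    {φ ψ : E} (hφ : φ ∈ H.domain) (hψ : ψ ∈ H.domain) (s : ℝ) :
    HasDerivAt (fun s => ⟪U s φ, U' s ψ⟫_ℂ)
      (-(Complex.I * lam * ⟪U s φ, V (U' s ψ)⟫_ℂ)) s := by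
  have hψ' : ψ ∈ H'.domain := hdom ▸ hψ
  refine ((hU.hasDerivAt_apply hφ s).inner ℂ (hU'.hasDerivAt_apply hψ' s)).congr_deriv ?_
  obtain ⟨h2, h3⟩ := hU.apply_mem_domain s hφ
  obtain ⟨h4, h5⟩ := hU'.apply_mem_domain s hψ'
  have h6 : U' s ψ ∈ H.domain := hdom ▸ h4
  have h7 := hU.symmetric ⟨_, h2⟩ ⟨_, h6⟩
  rw [h3] at h7
  rw [hadd _ h6] at h5
  rw [← h5]
  simp only [inner_smul_right, inner_smul_left, inner_add_right, h7, map_neg, Complex.conj_I]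
  ring

/-- In `⟪U s φ, U' s ψ⟫` the unbounded parts cancel, so its derivative is bounded by `|λ| ‖V‖ ‖φ‖
‖ψ‖`. This crude estimate feeds the remainder of the Dyson expansion. -/
theorem norm_sub_le_of_perturbed (hU : IsPropagator H U) (hU' : IsPropagator H' U')
    (hdom : H'.domain = H.domain)
    (hadd : ∀ (ψ : E) (h : ψ ∈ H.domain) (h' : ψ ∈ H'.domain),
      H' ⟨ψ, h'⟩ = H ⟨ψ, h⟩ + (lam : ℂ) • V ψ)
    {t : ℝ} (ht : 0 ≤ t) {ψ : E} (hψ : ψ ∈ H.domain) :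
    ‖U' t ψ - U t ψ‖ ≤ |lam| * ‖V‖ * ‖ψ‖ * t := by
  have h0 : ‖U' t ψ - U t ψ‖ = ‖U (-t) (U' t ψ) - ψ‖ := by
    rw [← hU.norm_apply (-t), map_sub, hU.neg_apply_apply]
  rw [h0]
  refine norm_le_of_dense hU.dense_domain (by positivity) fun φ hφ => ?_
  have h1 : ∀ s ∈ Set.Icc 0 t, HasDerivWithinAt (fun s => ⟪U s φ, U' s ψ⟫_ℂ)
      (-(Complex.I * lam * ⟪U s φ, V (U' s ψ)⟫_ℂ)) (Set.Icc 0 t) s := fun s _ =>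
    (hU.hasDerivAt_inner_perturbed hU' hdom hadd hφ hψ s).hasDerivWithinAt
  have h2 := norm_image_sub_le_of_norm_deriv_le_segment' h1 (C := |lam| * ‖V‖ * ‖ψ‖ * ‖φ‖) ?_ t
    (Set.right_mem_Icc.2 ht)
  · rw [inner_sub_right, hU.inner_neg_apply]
    simp only [hU.zero, hU'.zero, one_apply_eq_self, sub_zero] at h2
    linarith
  · intro s _
    rw [norm_neg, norm_mul, norm_mul, Complex.norm_I, one_mul, Complex.norm_real, Real.norm_eq_abs]
    have h3 : ‖⟪U s φ, V (U' s ψ)⟫_ℂ‖ ≤ ‖φ‖ * (‖V‖ * ‖ψ‖) := by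
      refine (norm_inner_le_norm _ _).trans ?_
      rw [hU.norm_apply]
      gcongr
      exact (V.le_opNorm _).trans (by rw [hU'.norm_apply])
    calc |lam| * ‖⟪U s φ, V (U' s ψ)⟫_ℂ‖ ≤ |lam| * (‖φ‖ * (‖V‖ * ‖ψ‖)) := by gcongr
      _ = _ := by ring

/-- Dyson expansion to first order in the interaction picture, with a bound on the remainder. -/
theorem norm_dyson_remainder_le (hU : IsPropagator H U) (hU' : IsPropagator H' U')
    (hdom : H'.domain = H.domain)
    (hadd : ∀ (ψ : E) (h : ψ ∈ H.domain) (h' : ψ ∈ H'.domain),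
      H' ⟨ψ, h'⟩ = H ⟨ψ, h⟩ + (lam : ℂ) • V ψ)
    {t : ℝ} (ht : 0 ≤ t) {ψ : E} (hψ : ψ ∈ H.domain) :
    ‖U (-t) (U' t ψ) - ψ + (Complex.I * lam) • ∫ s in (0 : ℝ)..t, U (-s) (V (U s ψ))‖ ≤
      lam ^ 2 * t ^ 2 * ‖V‖ ^ 2 * ‖ψ‖ := by
  have hc : Continuous fun s => U (-s) (V (U s ψ)) :=
    hU.continuous_apply continuous_neg (V.continuous.comp (hU.continuous ψ))
  refine norm_le_of_dense hU.dense_domain (by positivity) fun φ hφ => ?_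
  have hF : ∀ s, HasDerivAt (fun u => ∫ s in (0 : ℝ)..u, U (-s) (V (U s ψ)))
      (U (-s) (V (U s ψ))) s := fun s =>
    intervalIntegral.integral_hasDerivAt_right (hc.intervalIntegrable _ _)
      hc.stronglyMeasurable.stronglyMeasurableAtFilter hc.continuousAt
  -- Adding the first-order term leaves `V` applied to `U' s ψ - U s ψ`, which is already `O(λ)`;
  -- the derivative is therefore `O(λ²)`.
  have h1 : ∀ s ∈ Set.Icc 0 t, HasDerivWithinAt
      (fun s => ⟪U s φ, U' s ψ⟫_ℂ +
        (Complex.I * lam) * ⟪φ, ∫ r in (0 : ℝ)..s, U (-r) (V (U r ψ))⟫_ℂ)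
      (-(Complex.I * lam * ⟪U s φ, V (U' s ψ - U s ψ)⟫_ℂ)) (Set.Icc 0 t) s := by
    intro s _
    have h2 := (((hasDerivAt_const s φ).inner ℂ (hF s)).const_mul (Complex.I * lam))
    have h3 := (hU.hasDerivAt_inner_perturbed hU' hdom hadd hφ hψ s).add h2
    refine (h3.congr_deriv ?_).hasDerivWithinAt
    rw [map_sub, inner_sub_right, inner_zero_left, hU.inner_neg_apply]
    ring
  have h2 := norm_image_sub_le_of_norm_deriv_le_segment' h1
    (C := lam ^ 2 * t * ‖V‖ ^ 2 * ‖ψ‖ * ‖φ‖) ?_ t (Set.right_mem_Icc.2 ht)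
  · rw [inner_add_right, inner_sub_right, hU.inner_neg_apply, inner_smul_right]
    simp only [hU.zero, hU'.zero, one_apply_eq_self, sub_zero,
      intervalIntegral.integral_same, inner_zero_right, mul_zero, add_zero] at h2
    rw [sub_add_eq_add_sub]
    linarith
  · intro s hs
    rw [norm_neg, norm_mul, norm_mul, Complex.norm_I, one_mul, Complex.norm_real, Real.norm_eq_abs]
    have h4 := hU.norm_sub_le_of_perturbed hU' hdom hadd hs.1 hψ
    have h3 : ‖⟪U s φ, V (U' s ψ - U s ψ)⟫_ℂ‖ ≤ ‖φ‖ * (‖V‖ * (|lam| * ‖V‖ * ‖ψ‖ * t)) := by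
      refine (norm_inner_le_norm _ _).trans ?_
      rw [hU.norm_apply]
      gcongr
      refine (V.le_opNorm _).trans ?_
      gcongr
      refine h4.trans ?_
      gcongr
      exact hs.2.le
    calc |lam| * ‖⟪U s φ, V (U' s ψ - U s ψ)⟫_ℂ‖
        ≤ |lam| * (‖φ‖ * (‖V‖ * (|lam| * ‖V‖ * ‖ψ‖ * t))) := by gcongr
      _ = |lam| ^ 2 * t * ‖V‖ ^ 2 * ‖ψ‖ * ‖φ‖ := by ring
      _ = _ := by rw [sq_abs]

end perturbation

end IsPropagator

end propagators

/-! ### Matrix units on sets of sites; disjoint supports imply commutation -/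

section matrixUnits

variable {κ : Type*}

theorem inner_ket_left (x : κ) (ψ : Hilb κ) : ⟪ket x, ψ⟫_ℂ = ψ x := by
  classical
  unfold ket
  have := lp.inner_single_left (𝕜 := ℂ) (G := fun _ : κ => ℂ) x (1 : ℂ) ψ
  simp only [RCLike.inner_apply, map_one, mul_one] at this
  convert this

theorem ket_apply (x y : κ) [Decidable (y = x)] : (ket x : Hilb κ) y = if y = x then 1 else 0 := by
  classical
  unfold ket
  rw [lp.single_apply]
  by_cases h : y = x
  · subst h; simp
  · simp [h]

theorem hasSum_ket (ψ : Hilb κ) : HasSum (fun x => ψ x • ket x) ψ := by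
  classical
  have := lp.hasSum_single (E := fun _ : κ => ℂ) (p := 2) (by simp) ψ
  convert this using 2 with x
  ext y
  rw [lp.coeFn_smul, Pi.smul_apply, ket_apply, lp.single_apply]
  by_cases h : y = x
  · subst h; simp
  · simp [h]

theorem ext_ket {A A' : Hilb κ →L[ℂ] Hilb κ} (h : ∀ s u, (A (ket u)) s = (A' (ket u)) s) :
    A = A' := by
  ext1 ψ
  have h1 := (hasSum_ket ψ).mapL A
  have h2 := (hasSum_ket ψ).mapL A'
  refine h1.unique ?_
  convert h2 using 2 with x
  rw [map_smul, map_smul]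
  congr 1
  ext s
  exact h s x

theorem summable_sq (ψ : Hilb κ) : Summable fun x => ‖ψ x‖ ^ 2 := by
  have := (lp.memℓp ψ).summable (by norm_num)
  simpa using this

theorem norm_sq_eq_tsum (ψ : Hilb κ) : ‖ψ‖ ^ 2 = ∑' x, ‖ψ x‖ ^ 2 := by
  have := lp.norm_rpow_eq_tsum (p := 2) (by norm_num) ψ
  simpa using this

/-- The operator `ψ ↦ (s ↦ ψ (f s))` for `s ∈ P` and `0` otherwise. -/
def moveOp (P : Set κ) (f : κ → κ) (hf : Set.InjOn f P) : Hilb κ →L[ℂ] Hilb κ :=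
  have key : ∀ ψ : Hilb κ, Summable (P.indicator fun s => ‖ψ (f s)‖ ^ 2) ∧
      ∑' s, P.indicator (fun s => ‖ψ (f s)‖ ^ 2) s ≤ ∑' s, ‖ψ s‖ ^ 2 := fun ψ => by
    have hi : Function.Injective (fun s : P => f s) := hf.injective
    refine ⟨summable_subtype_iff_indicator.1 ((summable_sq ψ).comp_injective hi), ?_⟩
    rw [← tsum_subtype P fun s => ‖ψ (f s)‖ ^ 2]
    exact tsum_comp_le_tsum_of_inj (summable_sq ψ) (fun _ => by positivity) hi
  have hind : ∀ (ψ : Hilb κ) s, ‖P.indicator (fun s => ψ (f s)) s‖ ^ 2 =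
      P.indicator (fun s => ‖ψ (f s)‖ ^ 2) s := fun ψ s => by
    by_cases h : s ∈ P <;> simp [h]
  LinearMap.mkContinuous
    { toFun := fun ψ => ⟨P.indicator fun s => ψ (f s), by
        refine memℓp_gen ?_
        simp only [ENNReal.toReal_ofNat, Real.rpow_ofNat]
        refine (key ψ).1.congr fun s => (hind ψ s).symm⟩
      map_add' := fun ψ φ => lp.ext (Set.indicator_add P (fun s => ψ (f s)) (fun s => φ (f s)))
      map_smul' := fun c ψ => lp.ext (Set.indicator_const_smul P c (fun s => ψ (f s))) } 1 (fun ψ => by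
      rw [one_mul]
      refine (pow_le_pow_iff_left₀ (norm_nonneg _) (norm_nonneg _) two_ne_zero).1 ?_
      rw [norm_sq_eq_tsum, norm_sq_eq_tsum]
      exact le_trans (le_of_eq (tsum_congr fun s => hind ψ s)) (key ψ).2)

variable {Λ : Type*} {ι : Λ → Type*}

open Classical in
/-- The matrix unit `|w⟩⟨w'|` on the sites of `X`, tensored with the identity on other sites. -/
def unitOp (X : Finset Λ) (w w' : ∀ x, ι x) : Env ι →L[ℂ] Env ι :=
  moveOp {s | ∀ x ∈ X, s x = w x} (fun s => X.piecewise w' s) (by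
    intro s hs u hu hsu
    funext x
    by_cases hx : x ∈ X
    · rw [hs x hx, hu x hx]
    · simpa [hx] using congrFun hsu x)

open Classical in
theorem unitOp_apply (X : Finset Λ) (w w' : ∀ x, ι x) (ψ : Env ι) (s : ∀ x, ι x) :
    unitOp X w w' ψ s = if ∀ x ∈ X, s x = w x then ψ (X.piecewise w' s) else 0 := by
  exact Set.indicator_apply {s : ∀ x, ι x | ∀ x ∈ X, s x = w x} (fun s => ψ (X.piecewise w' s)) s

theorem unitOp_empty (w w' : ∀ x, ι x) : unitOp (∅ : Finset Λ) w w' = 1 := by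
  classical
  ext ψ s
  rw [unitOp_apply]
  simp

open Classical in
theorem unitOp_insert {x : Λ} {X : Finset Λ} (hx : x ∉ X) (w w' : ∀ x, ι x) :
    unitOp (insert x X) w w' = unitOp {x} w w' * unitOp X w w' := by
  classical
  ext ψ s
  rw [mul_apply_eq_comp, unitOp_apply, unitOp_apply, unitOp_apply]
  by_cases h : s x = w x
  · have h1 : (∀ y ∈ X, Finset.piecewise {x} w' s y = w y) ↔ ∀ y ∈ X, s y = w y := by
      refine forall₂_congr fun y hy => ?_
      rw [Finset.piecewise_eq_of_notMem]
      rintro hy'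
      rw [Finset.mem_singleton.1 hy'] at hy
      exact hx hy
    have h2 : (insert x X).piecewise w' s = X.piecewise w' (Finset.piecewise {x} w' s) := by
      funext y
      by_cases hy : y ∈ X
      · simp [hy]
      · by_cases hyx : y = x
        · subst hyx; simp [hy]
        · simp [hy, hyx]
    simp only [Finset.mem_insert, forall_eq_or_imp, h, true_and, Finset.mem_singleton, forall_eq,
      if_true]
    rw [if_congr h1 rfl rfl]
    congr 1
    convert congrArg (fun z => ψ z) h2
  · simp [h]

theorem isSiteOperator_unitOp (x : Λ) (w w' : ∀ x, ι x) :
    IsSiteOperator x (unitOp {x} w w') := by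
  classical
  refine ⟨fun p q => if p = w x ∧ q = w' x then 1 else 0, fun s u => ⟨fun h => ?_, fun h => ?_⟩⟩
  · rw [inner_ket_left, unitOp_apply, ket_apply]
    have h1 : Finset.piecewise {x} w' s = u ↔ u x = w' x := by
      constructor
      · rintro rfl; simp
      · intro hu
        funext y
        by_cases hy : y = x
        · subst hy; simp [hu]
        · simp [hy, h y hy]
    simp only [Finset.mem_singleton, forall_eq, h1, ite_and]
  · rw [inner_ket_left, unitOp_apply, ket_apply]
    rw [if_neg (c := _ = u), ite_self]
    rintro rfl
    exact h fun y hy => by simp [hy]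

/-- `supp` tests only operators of one site. Matrix units on `X` are products of single-site ones,
which turns triviality at each site into joint triviality on `X`. -/
theorem commute_unitOp {A : Env ι →L[ℂ] Env ι} {X : Finset Λ} (hX : ∀ x ∈ X, x ∉ supp A)
    (w w' : ∀ x, ι x) : Commute (unitOp X w w') A := by
  classical
  induction X using Finset.induction_on with
  | empty => rw [unitOp_empty]; exact Commute.one_left A
  | insert x X hx ih =>
    rw [unitOp_insert hx]
    have h1 := hX x (Finset.mem_insert_self _ _)
    simp only [supp, Set.mem_ofPred_eq, not_not] at h1
    exact (h1 _ (isSiteOperator_unitOp x w w')).mul_left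
      (ih fun y hy => hX y (Finset.mem_insert_of_mem hy))

theorem CommutesWith.mul {E : Type*} [NormedAddCommGroup E] [InnerProductSpace ℂ E]
    {T T' : E →L[ℂ] E} {H : E →ₗ.[ℂ] E} (hT : CommutesWith T H) (hT' : CommutesWith T' H) :
    CommutesWith (T * T') H := by
  intro ψ
  obtain ⟨h1, e1⟩ := hT' ψ
  obtain ⟨h2, e2⟩ := hT ⟨_, h1⟩
  exact ⟨h2, e2.trans (congrArg T e1)⟩

theorem commutesWith_unitOp {H : Env ι →ₗ.[ℂ] Env ι} {X : Finset Λ}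
    (hX : ∀ x ∈ X, x ∉ suppUnbounded H) (w w' : ∀ x, ι x) : CommutesWith (unitOp X w w') H := by
  classical
  induction X using Finset.induction_on with
  | empty => rw [unitOp_empty]; exact fun ψ => ⟨ψ.2, rfl⟩
  | insert x X hx ih =>
    rw [unitOp_insert hx]
    have h1 := hX x (Finset.mem_insert_self _ _)
    simp only [suppUnbounded, Set.mem_ofPred_eq, not_not] at h1
    exact (h1 _ (isSiteOperator_unitOp x w w')).mul
      (ih fun y hy => hX y (Finset.mem_insert_of_mem hy))

/-- An operator supported in `X` has the form `A' ⊗ I`. -/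
theorem unitOp_mul_mul_unitOp [Fintype Λ] {A : Env ι →L[ℂ] Env ι} {X : Finset Λ}
    (hX : ∀ x ∉ X, x ∉ supp A) (w w' : ∀ x, ι x) :
    ∃ c : ℂ, unitOp X w w * A * unitOp X w' w' = c • unitOp X w w' := by
  classical
  -- Commuting with all matrix units off `X` forces the entry `⟨s|A|u⟩` to vanish unless `s = u` off
  -- `X`, and to be independent of their common values there.
  have hcomm : ∀ z z' : ∀ x, ι x, Commute (unitOp Xᶜ z z') A := fun z z' =>
    commute_unitOp (fun x hx => hX x (Finset.mem_compl.1 hx)) z z'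
  have hT : ∀ (z z' s u : ∀ x, ι x), (A (unitOp Xᶜ z z' (ket u))) s =
      (unitOp Xᶜ z z' (A (ket u))) s := fun z z' s u => by
    have := hcomm z z'
    rw [← mul_apply_eq_comp, ← mul_apply_eq_comp, this.eq]
  have hket : ∀ (Y : Finset Λ) (z z' u : ∀ x, ι x), (∀ x ∈ Y, u x = z' x) →
      unitOp Y z z' (ket u) = ket (Y.piecewise z u) := by
    intro Y z z' u hu
    ext s
    rw [unitOp_apply, ket_apply, ket_apply]
    by_cases hs : ∀ x ∈ Y, s x = z x
    · rw [if_pos hs]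
      congr 1
      rw [eq_iff_iff]
      constructor
      · rintro rfl
        funext x
        by_cases hx : x ∈ Y
        · simp [hx, hs x hx]
        · simp [hx]
      · rintro rfl
        funext x
        by_cases hx : x ∈ Y
        · simp [hx, hu x hx]
        · simp [hx]
    · rw [if_neg hs, if_neg]
      rintro rfl
      exact hs fun x hx => by simp [hx]
  have hket0 : ∀ (Y : Finset Λ) (z z' u : ∀ x, ι x), (¬ ∀ x ∈ Y, u x = z' x) →
      unitOp Y z z' (ket u) = 0 := by
    intro Y z z' u hu
    ext s
    rw [unitOp_apply, ket_apply]
    rw [if_neg (c := _ = u), ite_self]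
    · rfl
    · rintro rfl
      exact hu fun x hx => by simp [hx]
  -- The scalar is the entry of `A` between `w` and `w'` on `X`, with both configurations set to `w`
  -- elsewhere.
  refine ⟨(A (ket (X.piecewise w' w))) w, ext_ket fun s u => ?_⟩
  rw [mul_apply_eq_comp, mul_apply_eq_comp, smul_apply,
    lp.coeFn_smul, Pi.smul_apply]
  by_cases hu : ∀ x ∈ X, u x = w' x
  · rw [hket X w' w' u hu, hket X w w' u hu, unitOp_apply, ket_apply]
    have hu' : X.piecewise w' u = u := by
      funext x
      by_cases hx : x ∈ X
      · simp [hx, hu x hx]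
      · simp [hx]
    rw [hu']
    by_cases hs : ∀ x ∈ X, s x = w x
    · have hs' : X.piecewise w s = s := by
        funext x
        by_cases hx : x ∈ X
        · simp [hx, hs x hx]
        · simp [hx]
      rw [if_pos hs, hs']
      by_cases hsu : ∀ x ∈ Xᶜ, u x = s x
      -- This matrix unit moves the common configuration off `X` from that of `s` to that of `w`.
      · have h1 := hT w s w u
        rw [hket Xᶜ w s u hsu, unitOp_apply, if_pos (fun _ _ => rfl)] at h1
        have e1 : Xᶜ.piecewise w u = X.piecewise w' w := by
          funext x
          by_cases hx : x ∈ X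
          · simp [hx, hu x hx]
          · simp [hx]
        have e2 : Xᶜ.piecewise s w = s := by
          funext x
          by_cases hx : x ∈ X
          · simp [hx, hs x hx]
          · simp [hx]
        have e3 : s = X.piecewise w u := by
          funext x
          by_cases hx : x ∈ X
          · simp [hx, hs x hx]
          · simp [hx, hsu x (Finset.mem_compl.2 hx)]
        rw [e1, e2] at h1
        rw [if_pos e3, h1, smul_eq_mul, mul_one]
      · have h1 := hT u u s u
        rw [hket Xᶜ u u u (fun _ _ => rfl), unitOp_apply, if_neg] at h1
        · have e : Xᶜ.piecewise u u = u := by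
            funext x
            by_cases hx : x ∈ X <;> simp [hx]
          rw [e] at h1
          rw [h1, if_neg, smul_zero]
          rintro rfl
          exact hsu fun x hx => by simp [Finset.mem_compl.1 hx]
        · exact fun h => hsu fun x hx => (h x hx).symm
    · rw [if_neg hs, if_neg, smul_zero]
      rintro rfl
      exact hs fun x hx => by simp [hx]
  · rw [hket0 X w' w' u hu, hket0 X w w' u hu]
    simp

/-- `∑_w |w⟩⟨w| = 1`, weakly. -/
theorem hasSum_inner_unitOp [Nonempty (∀ x, ι x)] (X : Finset Λ) :
    ∃ rep : (∀ x : X, ι x) → ∀ x, ι x, ∀ φ ψ : Env ι,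
      HasSum (fun c => ⟪φ, unitOp X (rep c) (rep c) ψ⟫_ℂ) ⟪φ, ψ⟫_ℂ := by
  classical
  -- Base configuration filling the sites outside `X`; a matrix unit on `X` does not see it.
  let z : ∀ x, ι x := Classical.arbitrary _
  refine ⟨fun c x => if h : x ∈ X then c ⟨x, h⟩ else z x, fun φ ψ => ?_⟩
  have h1 := lp.hasSum_inner (𝕜 := ℂ) φ ψ
  have h2 := h1.tsum_fiberwise (fun (s : ∀ x, ι x) (x : X) => s x)
  refine (congrArg (fun f => HasSum f ⟪φ, ψ⟫_ℂ) (funext fun c => ?_)).mpr h2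
  rw [← (lp.hasSum_inner (𝕜 := ℂ) φ _).tsum_eq, tsum_subtype _ fun s => ⟪φ s, ψ s⟫_ℂ]
  refine tsum_congr fun s => ?_
  rw [unitOp_apply, Set.indicator_apply]
  have h3 : (∀ x ∈ X, s x = if h : x ∈ X then c ⟨x, h⟩ else z x) ↔
      s ∈ (fun (s : ∀ x, ι x) (x : X) => s x) ⁻¹' {c} := by
    rw [Set.mem_preimage, Set.mem_singleton_iff, funext_iff, Subtype.forall]
    refine forall₂_congr fun x hx => ?_
    rw [dif_pos hx]
  by_cases h4 : s ∈ (fun (s : ∀ x, ι x) (x : X) => s x) ⁻¹' {c}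
  · rw [if_pos (h3.2 h4), if_pos h4]
    refine congrArg (fun u => ⟪φ s, ψ u⟫_ℂ) ?_
    funext x
    by_cases hx : x ∈ X
    · have := h3.2 h4 x hx
      simp [hx, this]
    · simp [hx]
  · rw [if_neg (fun h => h4 (h3.1 h)), if_neg h4, inner_zero_right]

/-- `T H = H T` in the sense of sesquilinear forms on the domain of `H`. -/
def FormCommutes {E : Type*} [NormedAddCommGroup E] [InnerProductSpace ℂ E]
    (T : E →L[ℂ] E) (H : E →ₗ.[ℂ] E) : Prop :=
  ∀ φ ψ : H.domain, ⟪H φ, T ψ⟫_ℂ = ⟪(φ : E), T (H ψ)⟫_ℂ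

/-- Operators with disjoint supports commute. -/
theorem formCommutes_of_disjoint [Fintype Λ] {A : Env ι →L[ℂ] Env ι} {H : Env ι →ₗ.[ℂ] Env ι}
    (hH : ∀ φ ψ : H.domain, ⟪H φ, (ψ : Env ι)⟫_ℂ = ⟪(φ : Env ι), H ψ⟫_ℂ)
    (hd : Disjoint (supp A) (suppUnbounded H)) : FormCommutes A H := by
  classical
  intro φ ψ
  rcases isEmpty_or_nonempty (∀ x, ι x) with he | hne
  · have h0 : ∀ χ : Env ι, χ = 0 := fun χ => lp.ext (funext fun x => he.elim x)
    rw [h0 (A (ψ : Env ι)), h0 (A (H ψ)), inner_zero_right, inner_zero_right]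
  · let X : Finset Λ := (Set.toFinite (supp A)).toFinset
    have hX : ∀ x ∈ X, x ∉ suppUnbounded H := fun x hx =>
      Set.disjoint_left.1 hd ((Set.Finite.mem_toFinset _).1 hx)
    have hX' : ∀ x ∉ X, x ∉ supp A := fun x hx h => hx ((Set.Finite.mem_toFinset _).2 h)
    obtain ⟨rep, hrep⟩ := hasSum_inner_unitOp (ι := ι) X
    -- Each compressed piece of `A` is a multiple of a matrix unit on `X`, which preserves the
    -- domain of `H` and commutes with it there. Summing weakly over `w` and `w'` recovers `A`, also
    -- when the site spaces are infinite dimensional.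
    have key : ∀ w w', ⟪H φ, (unitOp X w w * A * unitOp X w' w' : Env ι →L[ℂ] Env ι) ψ⟫_ℂ =
        ⟪(φ : Env ι), (unitOp X w w * A * unitOp X w' w' : Env ι →L[ℂ] Env ι) (H ψ)⟫_ℂ := by
      intro w w'
      obtain ⟨c, hc⟩ := unitOp_mul_mul_unitOp hX' w w'
      obtain ⟨h1, h2⟩ := commutesWith_unitOp hX w w' ψ
      rw [hc, smul_apply, smul_apply, inner_smul_right, inner_smul_right, ← h2]
      exact congrArg (c * ·) (hH φ ⟨_, h1⟩)
    refine (hrep (H φ) (A ψ)).unique ?_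
    refine (congrArg (fun f => HasSum f _) (funext fun c => ?_)).mpr (hrep φ (A (H ψ)))
    have h1 := hrep (ContinuousLinearMap.adjoint (unitOp X (rep c) (rep c) * A) (H φ)) ψ
    have h2 := hrep (ContinuousLinearMap.adjoint (unitOp X (rep c) (rep c) * A) φ) (H ψ)
    simp only [ContinuousLinearMap.adjoint_inner_left] at h1 h2
    refine h1.unique ?_
    exact (congrArg (fun f => HasSum f _) (funext fun c' => key _ _)).mpr h2

/-- View `T` as an everywhere defined unbounded operator and apply `formCommutes_of_disjoint`;
self-adjointness of `T` supplies the symmetry of its form. -/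
theorem commute_of_disjoint [Fintype Λ] {A T : Env ι →L[ℂ] Env ι} (hT : IsSelfAdjoint T)
    (hd : Disjoint (supp A) (supp T)) : Commute T A := by
  let H : Env ι →ₗ.[ℂ] Env ι := (T : Env ι →ₗ[ℂ] Env ι).toPMap ⊤
  have hsymm : ∀ φ ψ : Env ι, ⟪T φ, ψ⟫_ℂ = ⟪φ, T ψ⟫_ℂ := fun φ ψ => by
    rw [← ContinuousLinearMap.adjoint_inner_left, hT.adjoint_eq]
  have hsupp : suppUnbounded H ⊆ supp T := by
    intro x hx hx'
    refine hx fun S hS ψ => ⟨trivial, ?_⟩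
    exact (congrArg (fun A => A (ψ : Env ι)) (hx' S hS).eq).symm
  have h1 : FormCommutes A H :=
    formCommutes_of_disjoint (fun φ ψ => hsymm φ ψ) (hd.mono_right hsupp)
  refine ContinuousLinearMap.ext fun ψ => ext_inner_left ℂ fun φ => ?_
  have := h1 ⟨φ, trivial⟩ ⟨ψ, trivial⟩
  exact (hsymm φ (A ψ)).symm.trans this

end matrixUnits

/-! ### Growth of norm and support of nested commutators -/

section commutators

variable {Λ : Type*} {ι : Λ → Type*} {I : Type*}

theorem disjoint_reach_of_lt_pathLength (h : I → (Env ι →L[ℂ] Env ι)) {X Y : Set Λ} {n : ℕ}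
    (hn : (n : ℕ∞) < pathLength h X Y) : Disjoint (reach h X n) Y := by
  rw [Set.disjoint_iff_inter_eq_empty, ← Set.not_nonempty_iff_eq_empty]
  intro hne
  exact absurd (iInf₂_le n hne) (not_le.2 hn)

variable [Fintype I]

/-- The commutator `[∑ i, h i, A]`. -/
def localCommutator (h : I → (Env ι →L[ℂ] Env ι)) (A : Env ι →L[ℂ] Env ι) : Env ι →L[ℂ] Env ι :=
  ∑ i, (h i * A - A * h i)

theorem localCommutator_sum {α : Type*} (h : I → (Env ι →L[ℂ] Env ι)) (s : Finset α)
    (A : α → (Env ι →L[ℂ] Env ι)) :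
    localCommutator h (∑ a ∈ s, A a) = ∑ a ∈ s, localCommutator h (A a) := by
  simp only [localCommutator, Finset.mul_sum, Finset.sum_mul]
  rw [Finset.sum_comm]
  simp only [Finset.sum_sub_distrib]

theorem iterate_localCommutator_sum {α : Type*} (h : I → (Env ι →L[ℂ] Env ι)) (s : Finset α)
    (A : α → (Env ι →L[ℂ] Env ι)) (n : ℕ) :
    (localCommutator h)^[n] (∑ a ∈ s, A a) = ∑ a ∈ s, (localCommutator h)^[n] (A a) := by
  induction n generalizing A with
  | zero => rfl
  | succ n ih => simp only [Function.iterate_succ_apply, localCommutator_sum, ih]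

/-- Growth of nested commutators with a sum of local interactions. -/
theorem norm_iterate_localCommutator_le {h : I → (Env ι →L[ℂ] Env ι)}
    {J : ℝ} (hJ0 : 0 ≤ J) (hJ : ∀ i, ‖h i‖ ≤ J) {q : ℕ}
    (hq : ∀ i, {j | ¬ Commute (h j) (h i)}.ncard ≤ q) (n : ℕ) :
    ∀ (M : ℕ) (A : Env ι →L[ℂ] Env ι), {i | ¬ Commute (h i) A}.ncard ≤ M →
      ‖(localCommutator h)^[n] A‖ ≤
        ‖A‖ * ∏ j ∈ Finset.range n, (((M : ℝ) + j * q) * (2 * J)) := by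
  classical
  induction n with
  | zero => intro M A _; simp
  | succ n ih =>
    intro M A hM
    let s : Finset I := Finset.univ.filter fun i => ¬ Commute (h i) A
    have hs : s.card ≤ M := by
      rw [← Set.ncard_coe_finset]
      simpa [s] using hM
    have hA : localCommutator h A = ∑ i ∈ s, (h i * A - A * h i) := by
      refine (Finset.sum_subset (Finset.subset_univ _) fun i _ hi => ?_).symm
      have : Commute (h i) A := by simpa [s] using hi
      rw [this.eq, sub_self]
    rw [Function.iterate_succ_apply, hA, iterate_localCommutator_sum]
    have hterm : ∀ i ∈ s, ‖(localCommutator h)^[n] (h i * A - A * h i)‖ ≤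
        (2 * J * ‖A‖) * ∏ j ∈ Finset.range n, ((((M + q : ℕ) : ℝ) + j * q) * (2 * J)) := by
      intro i _
      refine (ih (M + q) _ ?_).trans ?_
      -- An interaction commuting with both `A` and `h i` commutes with their commutator, so each
      -- step adds at most `q` non-commuting interactions.
      · have hsub : {j | ¬ Commute (h j) (h i * A - A * h i)} ⊆
            {j | ¬ Commute (h j) A} ∪ {j | ¬ Commute (h j) (h i)} := by
          intro j hj
          by_contra hc
          simp only [Set.mem_union, Set.mem_ofPred_eq, not_or, not_not] at hc
          exact hj ((hc.2.mul_right hc.1).sub_right (hc.1.mul_right hc.2))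
        exact (Set.ncard_le_ncard hsub (Set.toFinite _)).trans
          ((Set.ncard_union_le _ _).trans (add_le_add hM (hq i)))
      · refine mul_le_mul_of_nonneg_right ?_ (Finset.prod_nonneg fun j _ => by positivity)
        calc ‖h i * A - A * h i‖ ≤ ‖h i‖ * ‖A‖ + ‖A‖ * ‖h i‖ :=
              (norm_sub_le _ _).trans (add_le_add (norm_mul_le _ _) (norm_mul_le _ _))
          _ ≤ J * ‖A‖ + ‖A‖ * J := by gcongr <;> exact hJ i
          _ = _ := by ring
    refine (norm_sum_le_of_le s hterm).trans ?_
    -- The number of summands supplies the factor `j = 0`; the induction hypothesis at `M + q`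
    -- supplies the factors shifted by one.
    rw [Finset.sum_const, nsmul_eq_mul, Finset.prod_range_succ']
    have hprod : ∀ j : ℕ, (((M + q : ℕ) : ℝ) + j * q) * (2 * J) =
        ((M : ℝ) + ((j + 1 : ℕ) : ℝ) * q) * (2 * J) := fun j => by push_cast; ring
    simp only [hprod]
    have hP : 0 ≤ ∏ j ∈ Finset.range n, ((M : ℝ) + ((j + 1 : ℕ) : ℝ) * q) * (2 * J) :=
      Finset.prod_nonneg fun j _ => by positivity
    calc (s.card : ℝ) * (2 * J * ‖A‖ * ∏ j ∈ Finset.range n,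
          ((M : ℝ) + ((j + 1 : ℕ) : ℝ) * q) * (2 * J))
        ≤ (M : ℝ) * (2 * J * ‖A‖ * ∏ j ∈ Finset.range n,
          ((M : ℝ) + ((j + 1 : ℕ) : ℝ) * q) * (2 * J)) := by gcongr
      _ = _ := by push_cast; ring

variable [Fintype Λ]

/-- An interaction whose support misses that of `A` drops out. Every other one meets `reach h X n`,
and its whole support is then absorbed into `reach h X (n + 1)`. -/
theorem supp_localCommutator_subset {h : I → (Env ι →L[ℂ] Env ι)} (hh : ∀ i, IsSelfAdjoint (h i))
    {A : Env ι →L[ℂ] Env ι} {X : Set Λ} {n : ℕ} (hA : supp A ⊆ reach h X n) :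
    supp (localCommutator h A) ⊆ reach h X (n + 1) := by
  intro x hx
  by_contra hxr
  simp only [reach, Set.mem_union, Set.mem_ofPred_eq, not_or, not_exists, not_and] at hxr
  refine hx fun T hT => ?_
  have hTA : Commute T A := by
    by_contra hc
    exact hxr.1 (hA fun h => hc (h T hT))
  refine Commute.sum_right _ _ _ fun i _ => ?_
  by_cases hxi : x ∈ supp (h i)
  · have hne := Set.not_nonempty_iff_eq_empty.1 (hxr.2 i hxi)
    have hd : Disjoint (supp A) (supp (h i)) :=
      (Set.disjoint_iff_inter_eq_empty.2 hne).symm.mono_left hA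
    rw [(commute_of_disjoint (hh i) hd).eq, sub_self]
    exact Commute.zero_right T
  · simp only [supp, Set.mem_ofPred_eq, not_not] at hxi
    have := hxi T hT
    exact (this.mul_right hTA).sub_right (hTA.mul_right this)

theorem supp_iterate_localCommutator_subset {h : I → (Env ι →L[ℂ] Env ι)}
    (hh : ∀ i, IsSelfAdjoint (h i)) (B : Env ι →L[ℂ] Env ι) (n : ℕ) :
    supp ((localCommutator h)^[n] B) ⊆ reach h (supp B) n := by
  induction n with
  | zero => exact subset_rfl
  | succ n ih =>
    rw [Function.iterate_succ_apply']
    exact supp_localCommutator_subset hh ih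

/-- A non-commuting `h j` must share one of the at most `k` sites of `h i`, and each site carries at
most `r` interactions. -/
theorem ncard_not_commute_le {h : I → (Env ι →L[ℂ] Env ι)} (hh : ∀ i, IsSelfAdjoint (h i))
    {k r : ℕ} (hk : ∀ i, (supp (h i)).ncard ≤ k) (hr : ∀ x : Λ, {i | x ∈ supp (h i)}.ncard ≤ r)
    (i : I) : {j | ¬ Commute (h j) (h i)}.ncard ≤ r * k := by
  classical
  have hsub : {j | ¬ Commute (h j) (h i)} ⊆
      ⋃ x ∈ (Set.toFinite (supp (h i))).toFinset, {j | x ∈ supp (h j)} := by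
    intro j hj
    have hnd : ¬ Disjoint (supp (h i)) (supp (h j)) := fun hd =>
      hj (commute_of_disjoint (hh j) hd)
    obtain ⟨x, hx, hx'⟩ := Set.not_disjoint_iff.1 hnd
    simp only [Set.mem_iUnion]
    exact ⟨x, (Set.Finite.mem_toFinset _).2 hx, hx'⟩
  refine (Set.ncard_le_ncard hsub (Set.toFinite _)).trans ?_
  refine (Finset.set_ncard_biUnion_le _ _).trans ?_
  refine (Finset.sum_le_card_nsmul _ _ r fun x _ => hr x).trans ?_
  rw [smul_eq_mul, mul_comm, ← Set.ncard_eq_toFinset_card]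
  exact Nat.mul_le_mul_left r (hk i)

end commutators

/-! ### Numerical estimates and the optimal number of integrations by parts -/

section numerics

theorem summable_truncExp (l : ℕ∞) {x : ℝ} (hx : 0 ≤ x) :
    Summable fun j : ℕ => if (j : ℕ∞) ≤ l then x ^ j / (j.factorial : ℝ) else 0 := by
  refine Summable.of_nonneg_of_le (fun j => ?_) (fun j => ?_) (Real.summable_pow_div_factorial x)
  · split_ifs <;> positivity
  · split_ifs
    · exact le_rfl
    · positivity

theorem truncExp_le_exp (l : ℕ∞) {x : ℝ} (hx : 0 ≤ x) : truncExp l x ≤ Real.exp x := by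
  rw [Real.exp_eq_exp_ℝ, NormedSpace.exp_eq_tsum_div]
  refine (summable_truncExp l hx).tsum_le_tsum (fun j => ?_) (Real.summable_pow_div_factorial x)
  split_ifs
  · exact le_rfl
  · positivity

theorem truncExp_nat (n : ℕ) (x : ℝ) :
    truncExp n x = ∑ j ∈ Finset.range (n + 1), x ^ j / (j.factorial : ℝ) := by
  unfold truncExp
  rw [tsum_eq_sum (s := Finset.range (n + 1))]
  · refine Finset.sum_congr rfl fun j hj => if_pos ?_
    exact_mod_cast Nat.lt_succ_iff.1 (Finset.mem_range.1 hj)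
  · intro j hj
    refine if_neg ?_
    rw [Finset.mem_range] at hj
    exact_mod_cast fun h => hj (Nat.lt_succ_iff.2 h)

theorem one_le_truncExp (l : ℕ∞) {x : ℝ} (hx : 0 ≤ x) : 1 ≤ truncExp l x := by
  have := (summable_truncExp l hx).sum_le_tsum {0} (fun j _ => by split_ifs <;> positivity)
  simpa [truncExp] using this

/-- Consecutive terms of the exponential series have ratio `x / j ≥ 1` while `j ≤ x`. Hence the last
term of a sum truncated before `x` dominates. -/
theorem pow_div_factorial_mono {x : ℝ} {n : ℕ} (hx : (n : ℝ) ≤ x) :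
    ∀ j ≤ n, x ^ j / (j.factorial : ℝ) ≤ x ^ n / (n.factorial : ℝ) := by
  induction n with
  | zero => intro j hj; rw [Nat.le_zero.1 hj]
  | succ n ih =>
    intro j hj
    rcases Nat.of_le_succ hj with h | h
    · refine (ih ((Nat.cast_le.2 n.le_succ).trans hx) j h).trans ?_
      have hx0 : 0 ≤ x := (Nat.cast_nonneg _).trans hx
      rw [Nat.factorial_succ, pow_succ, Nat.cast_mul, mul_comm ((n + 1 : ℕ) : ℝ),
        mul_div_mul_comm]
      exact le_mul_of_one_le_right (by positivity)
        ((one_le_div (by positivity)).2 hx)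
    · rw [h]

theorem truncExp_nat_le {x : ℝ} {n : ℕ} (hx : (n : ℝ) ≤ x) :
    truncExp n x ≤ (n + 1) * (x ^ n / (n.factorial : ℝ)) := by
  rw [truncExp_nat]
  refine (Finset.sum_le_card_nsmul _ _ _ fun j hj =>
    pow_div_factorial_mono hx j (Nat.lt_succ_iff.1 (Finset.mem_range.1 hj))).trans ?_
  rw [Finset.card_range, nsmul_eq_mul]
  push_cast
  exact le_rfl

/-- `a (a + 1) ⋯ (a + n - 1) ≤ 2 ^ (a + n) n!`. -/
theorem prod_add_le {a : ℝ} (ha : 0 ≤ a) (n : ℕ) :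
    ∏ j ∈ Finset.range n, (a + j) ≤ (2 : ℝ) ^ a * 2 ^ n * n.factorial := by
  -- The recursion below lowers `a` by one, so the induction runs over an integer bound for `a`; for
  -- `a ≤ 1` the product is at most `n!`.
  obtain ⟨N, hN⟩ := exists_nat_ge a
  induction N generalizing a n with
  | zero =>
    have : a = 0 := le_antisymm (by simpa using hN) ha
    subst this
    rcases n with _ | n
    · simp
    · rw [Finset.prod_range_succ']; simp
  | succ N ih =>
    rcases le_or_gt a 1 with h1 | h1
    · have h2 : ∏ j ∈ Finset.range n, (a + j) ≤ n.factorial := by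
        rw [← Finset.prod_range_add_one_eq_factorial]
        push_cast
        exact Finset.prod_le_prod (fun j _ => by positivity) fun j _ => by linarith
      have h3 : (1 : ℝ) ≤ 2 ^ a := Real.one_le_rpow (by norm_num) ha
      have h4 : (1 : ℝ) ≤ 2 ^ n := one_le_pow₀ (by norm_num)
      refine h2.trans (le_mul_of_one_le_left (by positivity) ?_)
      nlinarith
    · have hb : 0 ≤ a - 1 := by linarith
      have hbN : a - 1 ≤ N := by push_cast at hN; linarith
      have h2a : (2 : ℝ) ^ a = 2 * 2 ^ (a - 1) := by
        rw [Real.rpow_sub_one (by norm_num)]; ring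
      induction n with
      | zero => simpa using Real.one_le_rpow (by norm_num : (1 : ℝ) ≤ 2) ha
      | succ n ihn =>
        have h1 := ih hb (n + 1) hbN
        -- Pascal's rule, from `a + n = (n + 1) + (a - 1)`. Each of the two summands is at most half
        -- of the target.
        have h2 : ∏ j ∈ Finset.range (n + 1), (a + j) =
            (n + 1) * ∏ j ∈ Finset.range n, (a + j) +
              ∏ j ∈ Finset.range (n + 1), ((a - 1) + j) := by
          rw [Finset.prod_range_succ, Finset.prod_range_succ']
          have : ∀ j : ℕ, (a - 1) + ((j + 1 : ℕ) : ℝ) = a + j := fun j => by push_cast; ring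
          simp only [this]
          push_cast
          ring
        rw [h2]
        rw [h2a] at ihn ⊢
        rw [Nat.factorial_succ] at h1 ⊢
        push_cast at h1 ⊢
        rw [pow_succ] at h1 ⊢
        have h3 : ((n : ℝ) + 1) * ∏ j ∈ Finset.range n, (a + j) ≤
            (n + 1) * (2 * 2 ^ (a - 1) * 2 ^ n * n.factorial) :=
          mul_le_mul_of_nonneg_left ihn (by positivity)
        linarith

theorem two_mul_succ_le_four_pow {n : ℕ} (hn : 1 ≤ n) : 2 * (n + 1 : ℝ) ≤ 4 ^ n := by
  induction n, hn using Nat.le_induction with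
  | base => norm_num
  | succ n hn ih =>
    rw [pow_succ]
    push_cast
    have : (1 : ℝ) ≤ n := by exact_mod_cast hn
    linarith

/-- Weighted inequality `(p + q)² ≤ (17/9) p² + (17/8) q²`. The weight `17/9` is chosen so that
`(17/9) · 4 · (16/11)² < 16`, which leaves `17/8` for the term in `t`. -/
theorem sq_add_le_of_bounds {s b y E t : ℝ} (hs0 : 0 ≤ s) (hs : s ≤ 16 / 11)
    (hb : 17 / 8 * b ^ 2 ≤ y) (hE : 0 < E) :
    (2 / E * s + t * b) ^ 2 ≤ 16 / E ^ 2 + t ^ 2 * y := by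
  have h1 : (2 / E * s + t * b) ^ 2 ≤ 17 / 9 * (2 / E * s) ^ 2 + 17 / 8 * (t * b) ^ 2 := by
    nlinarith [sq_nonneg (8 * (2 / E * s) - 9 * (t * b))]
  have h2 : s ^ 2 ≤ 256 / 121 := by nlinarith
  have h3 : 17 / 9 * (2 / E * s) ^ 2 ≤ 16 / E ^ 2 := by
    have : 17 / 9 * (2 / E * s) ^ 2 = (68 / 9 * s ^ 2) / E ^ 2 := by ring
    rw [this]
    gcongr
    nlinarith
  have h4 : 17 / 8 * (t * b) ^ 2 ≤ t ^ 2 * y := by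
    have := mul_le_mul_of_nonneg_left hb (sq_nonneg t)
    linarith
  linarith

/-- The optimal order of the integration by parts. -/
theorem exists_order (l : ℕ∞) {a x : ℝ} (ha : 0 ≤ a) (hx : 0 < x) :
    ∃ m : ℕ, (m : ℕ∞) ≤ l ∧ ∀ E t : ℝ, 0 < E →
      (2 / E * (∑ n ∈ Finset.range m, ∏ j ∈ Finset.range n, (a + j) / (8 * x)) +
        t * ∏ j ∈ Finset.range m, (a + j) / (8 * x)) ^ 2 ≤
      16 / E ^ 2 + t ^ 2 * (((2 : ℝ) ^ a + 1) / truncExp l x) := by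
  have hT1 := one_le_truncExp l hx.le
  have hT0 : 0 < truncExp l x := by linarith
  have h2a : (1 : ℝ) ≤ 2 ^ a := Real.one_le_rpow (by norm_num) ha
  rcases le_or_gt (truncExp l x) ((2 : ℝ) ^ a + 1) with hcase | hcase
  -- Here the suppression factor is at most `1`, and the trivial bound without integration by parts
  -- is enough.
  · refine ⟨0, by simp, fun E t hE => ?_⟩
    have h1 : 1 ≤ ((2 : ℝ) ^ a + 1) / truncExp l x := (one_le_div hT0).2 hcase
    have h2 : t ^ 2 * 1 ≤ t ^ 2 * (((2 : ℝ) ^ a + 1) / truncExp l x) :=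
      mul_le_mul_of_nonneg_left h1 (sq_nonneg t)
    have h3 : 0 ≤ 16 / E ^ 2 := by positivity
    simp only [Finset.range_zero, Finset.sum_empty, Finset.prod_empty, mul_zero, zero_add]
    linarith
  -- Now `2^a < e^x`, so `a < x / log 2 < 3x/2`. For `j ≤ x` each factor is then at most `(3/2 +
  -- 1)/8 = 5/16`, and the geometric series sums to `16/11`.
  · have hax : a ≤ 3 / 2 * x := by
      have h1 : (2 : ℝ) ^ a ≤ Real.exp x := by
        have := truncExp_le_exp l hx.le
        linarith
      rw [Real.rpow_def_of_pos (by norm_num), Real.exp_le_exp] at h1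
      have h2 := Real.log_two_gt_d9
      nlinarith
    have hratio : ∀ j : ℕ, (j : ℝ) ≤ x → (a + j) / (8 * x) ≤ 5 / 16 := fun j hj => by
      rw [div_le_iff₀ (by positivity)]
      linarith
    have hpow : ∀ m : ℕ, (∀ j < m, (j : ℝ) ≤ x) → ∀ n ≤ m,
        ∏ j ∈ Finset.range n, (a + j) / (8 * x) ≤ (5 / 16 : ℝ) ^ n := by
      intro m hm n hn
      calc ∏ j ∈ Finset.range n, (a + j) / (8 * x) ≤ ∏ _j ∈ Finset.range n, (5 / 16 : ℝ) :=
            Finset.prod_le_prod (fun j _ => by positivity) fun j hj =>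
              hratio j (hm j ((Finset.mem_range.1 hj).trans_le hn))
        _ = _ := by rw [Finset.prod_const, Finset.card_range]
    have hsum0 : ∀ m : ℕ, 0 ≤ ∑ n ∈ Finset.range m, ∏ j ∈ Finset.range n, (a + j) / (8 * x) :=
      fun m => Finset.sum_nonneg fun n _ => Finset.prod_nonneg fun j _ => by positivity
    have hsum : ∀ m : ℕ, (∀ j < m, (j : ℝ) ≤ x) →
        ∑ n ∈ Finset.range m, ∏ j ∈ Finset.range n, (a + j) / (8 * x) ≤ 16 / 11 := by
      intro m hm
      calc _ ≤ ∑ n ∈ Finset.range m, (5 / 16 : ℝ) ^ n :=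
            Finset.sum_le_sum fun n hn => hpow m hm n (Finset.mem_range.1 hn).le
        _ ≤ ∑' n : ℕ, (5 / 16 : ℝ) ^ n :=
            (summable_geometric_of_lt_one (by norm_num) (by norm_num)).sum_le_tsum _
              fun n _ => by positivity
        _ = 16 / 11 := by
            rw [tsum_geometric_of_lt_one (by norm_num) (by norm_num)]; norm_num
    have finish : ∀ m : ℕ, (m : ℕ∞) ≤ l → (∀ j < m, (j : ℝ) ≤ x) →
        17 / 8 * (∏ j ∈ Finset.range m, (a + j) / (8 * x)) ^ 2 ≤
          ((2 : ℝ) ^ a + 1) / truncExp l x → _ := fun m hml hm hb =>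
      (⟨m, hml, fun E t hE => sq_add_le_of_bounds (hsum0 m) (hsum m hm) hb hE⟩ :
        ∃ m : ℕ, (m : ℕ∞) ≤ l ∧ ∀ E t : ℝ, 0 < E →
      (2 / E * (∑ n ∈ Finset.range m, ∏ j ∈ Finset.range n, (a + j) / (8 * x)) +
        t * ∏ j ∈ Finset.range m, (a + j) / (8 * x)) ^ 2 ≤
      16 / E ^ 2 + t ^ 2 * (((2 : ℝ) ^ a + 1) / truncExp l x))
    -- The order is `m = min ⌈x⌉ l`: continue while the factors remain under control, unless the
    -- nested commutators could reach `HU` first.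
    rcases le_or_gt (⌈x⌉₊ : ℕ∞) l with hl | hl
    · have hm : ∀ j < ⌈x⌉₊, (j : ℝ) ≤ x := fun j hj => (Nat.lt_ceil.1 hj).le
      refine finish _ hl hm ?_
      rw [le_div_iff₀ hT0]
      have h1 := hpow _ hm _ le_rfl
      have h0 : 0 ≤ ∏ j ∈ Finset.range ⌈x⌉₊, (a + j) / (8 * x) :=
        Finset.prod_nonneg fun j _ => by positivity
      have hx1 : 1 ≤ ⌈x⌉₊ := Nat.one_le_iff_ne_zero.2 (Nat.ceil_pos.2 hx).ne'
      have h2 : truncExp l x ≤ (2.7182818286 : ℝ) ^ ⌈x⌉₊ := by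
        refine (truncExp_le_exp l hx.le).trans ((Real.exp_le_exp.2 (Nat.le_ceil x)).trans ?_)
        rw [← mul_one ((⌈x⌉₊ : ℕ) : ℝ), Real.exp_nat_mul]
        exact pow_le_pow_left₀ (Real.exp_pos _).le Real.exp_one_lt_d9.le _
      -- Because `(5/16)² e < 1`, the worst exponent is `⌈x⌉ = 1`.
      have h3 : (∏ j ∈ Finset.range ⌈x⌉₊, (a + j) / (8 * x)) ^ 2 * truncExp l x ≤ 27 / 100 := by
        calc _ ≤ ((5 / 16 : ℝ) ^ ⌈x⌉₊) ^ 2 * (2.7182818286 : ℝ) ^ ⌈x⌉₊ := by gcongr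
          _ = ((5 / 16 : ℝ) ^ 2 * 2.7182818286) ^ ⌈x⌉₊ := by
              rw [mul_pow, ← pow_mul, ← pow_mul, mul_comm 2]
          _ ≤ ((5 / 16 : ℝ) ^ 2 * 2.7182818286) ^ 1 :=
              pow_le_pow_of_le_one (by norm_num) (by norm_num) hx1
          _ ≤ _ := by norm_num
      nlinarith
    · obtain ⟨n, rfl⟩ := ENat.ne_top_iff_exists.1 hl.ne_top
      have hn : n < ⌈x⌉₊ := by exact_mod_cast hl
      have hnx : (n : ℝ) ≤ x := (Nat.lt_ceil.1 hn).le
      -- The value `l = 0` would give `Exp_l(x) = 1`, which falls in the first case.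
      have hn1 : 1 ≤ n := by
        rcases n with _ | n
        · have h1 := truncExp_nat 0 x
          simp at h1
          simp only [CharP.cast_eq_zero] at hcase
          linarith
        · omega
      refine finish n le_rfl (fun j hj => le_trans (by exact_mod_cast hj.le) hnx) ?_
      rw [le_div_iff₀ hT0]
      set T := truncExp n x
      set b := ∏ j ∈ Finset.range n, (a + j) / (8 * x) with hb
      have hb0 : 0 ≤ b := Finset.prod_nonneg fun j _ => by positivity
      have h1 : b ≤ (2 : ℝ) ^ a * 2 ^ n * n.factorial / (8 * x) ^ n := by
        rw [hb, Finset.prod_div_distrib, Finset.prod_const, Finset.card_range]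
        gcongr
        exact prod_add_le ha n
      -- The factorials and powers of `x` cancel, and `8^n = 2^n 4^n` leaves `(n + 1)/4^n ≤ 1/2`.
      have h2 : b * T ≤ 2 ^ a / 2 := by
        calc b * T ≤ ((2 : ℝ) ^ a * 2 ^ n * n.factorial / (8 * x) ^ n) *
              ((n + 1) * (x ^ n / (n.factorial : ℝ))) := by
              gcongr
              exact truncExp_nat_le hnx
          _ = 2 ^ a * ((n + 1) / 4 ^ n) := by
              have : (8 : ℝ) ^ n = 2 ^ n * 4 ^ n := by rw [← mul_pow]; norm_num
              rw [mul_pow, this]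
              field_simp
          _ ≤ 2 ^ a * (1 / 2) := by
              refine mul_le_mul_of_nonneg_left ?_ (by positivity)
              rw [div_le_iff₀ (by positivity)]
              linarith [two_mul_succ_le_four_pow hn1]
          _ = _ := by ring
      -- Square the previous bound and trade one factor `2^a` for `T`, using `2^a < T`.
      have h3 : (b ^ 2 * T) * T ≤ (2 ^ a / 4) * T := by
        have h4 : (b * T) ^ 2 ≤ (2 ^ a / 2) ^ 2 := pow_le_pow_left₀ (by positivity) h2 2
        nlinarith
      have h4 := le_of_mul_le_mul_right h3 hT0
      linarith

end numerics

/-! ### Oscillating integrals of Heisenberg operators -/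

section filtered

variable {E : Type*} [NormedAddCommGroup E] [InnerProductSpace ℂ E] [CompleteSpace E]
  {H : E →ₗ.[ℂ] E} {U : ℝ → (E →L[ℂ] E)}

theorem norm_exp_I_mul (e s : ℝ) : ‖Complex.exp (Complex.I * e * s)‖ = 1 := by
  have : Complex.I * e * s = ((e * s : ℝ) : ℂ) * Complex.I := by push_cast; ring
  rw [this, Complex.norm_exp_ofReal_mul_I]

theorem continuous_exp_I_mul (e : ℝ) : Continuous fun s : ℝ => Complex.exp (Complex.I * e * s) := by
  fun_prop

namespace IsPropagator

/-- The commutator of `A` with the unbounded `H` is used only as a form on the domain, represented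
there by the bounded `A'`. No claim is made that `A` preserves the domain. -/
theorem hasDerivAt_inner_conj (hU : IsPropagator H U) {A A' : E →L[ℂ] E}
    (hA : ∀ φ ψ : H.domain, ⟪H φ, A ψ⟫_ℂ - ⟪(φ : E), A (H ψ)⟫_ℂ = ⟪(φ : E), A' ψ⟫_ℂ)
    {φ ψ : E} (hφ : φ ∈ H.domain) (hψ : ψ ∈ H.domain) (s : ℝ) :
    HasDerivAt (fun s => ⟪U s φ, A (U s ψ)⟫_ℂ) (Complex.I * ⟪U s φ, A' (U s ψ)⟫_ℂ) s := by
  have h1 := (A.restrictScalars ℝ).hasFDerivAt.comp_hasDerivAt s (hU.hasDerivAt_apply hψ s)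
  refine ((hU.hasDerivAt_apply hφ s).inner ℂ h1).congr_deriv ?_
  obtain ⟨h2, e2⟩ := hU.apply_mem_domain s hφ
  obtain ⟨h3, e3⟩ := hU.apply_mem_domain s hψ
  have h4 := hA ⟨_, h2⟩ ⟨_, h3⟩
  rw [e2, e3] at h4
  rw [← h4]
  change ⟪U s φ, A (-Complex.I • U s (H ⟨ψ, hψ⟩))⟫_ℂ +
    ⟪-Complex.I • U s (H ⟨φ, hφ⟩), A (U s ψ)⟫_ℂ = _
  simp only [map_smul, inner_smul_right, inner_smul_left, map_neg, Complex.conj_I]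
  ring

/-- Repeated integration by parts against an oscillating factor. -/
theorem norm_integral_exp_mul_inner_le (hU : IsPropagator H U) {e t : ℝ} (he : 0 < e) (ht : 0 ≤ t)
    {φ ψ : E} (hφ : φ ∈ H.domain) (hψ : ψ ∈ H.domain) (m : ℕ) :
    ∀ A : ℕ → (E →L[ℂ] E), (∀ n < m, ∀ φ ψ : H.domain,
      ⟪H φ, A n ψ⟫_ℂ - ⟪(φ : E), A n (H ψ)⟫_ℂ = ⟪(φ : E), A (n + 1) ψ⟫_ℂ) →
    ‖∫ s in (0 : ℝ)..t, Complex.exp (Complex.I * e * s) * ⟪U s φ, A 0 (U s ψ)⟫_ℂ‖ ≤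
      ((∑ n ∈ Finset.range m, 2 * ‖A n‖ / e ^ (n + 1)) + t * ‖A m‖ / e ^ m) * (‖φ‖ * ‖ψ‖) := by
  have hg : ∀ (A : E →L[ℂ] E) (s : ℝ), ‖⟪U s φ, A (U s ψ)⟫_ℂ‖ ≤ ‖A‖ * (‖φ‖ * ‖ψ‖) := fun A s => by
    refine (norm_inner_le_norm _ _).trans ?_
    have := A.le_opNorm (U s ψ)
    rw [hU.norm_apply] at this ⊢
    calc ‖φ‖ * ‖A (U s ψ)‖ ≤ ‖φ‖ * (‖A‖ * ‖ψ‖) := by gcongr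
      _ = _ := by ring
  have hcont : ∀ A : E →L[ℂ] E, Continuous fun s : ℝ =>
      Complex.exp (Complex.I * e * s) * ⟪U s φ, A (U s ψ)⟫_ℂ := fun A =>
    (continuous_exp_I_mul e).mul ((hU.continuous φ).inner (A.continuous.comp (hU.continuous ψ)))
  induction m with
  | zero =>
    intro A _
    have := intervalIntegral.norm_integral_le_of_norm_le_const (a := (0 : ℝ)) (b := t)
      (f := fun s : ℝ => Complex.exp (Complex.I * e * s) * ⟪U s φ, A 0 (U s ψ)⟫_ℂ)
      (C := ‖A 0‖ * (‖φ‖ * ‖ψ‖)) (fun s _ => by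
        rw [norm_mul, norm_exp_I_mul, one_mul]; exact hg _ _)
    rw [sub_zero, abs_of_nonneg ht] at this
    simp only [Finset.range_zero, Finset.sum_empty, zero_add, pow_zero, div_one]
    linarith
  | succ m ih =>
    intro A hA
    have h1 := ih (fun n => A (n + 1)) (fun n hn => hA (n + 1) (by omega))
    have hder : ∀ s : ℝ, HasDerivAt
        (fun s : ℝ => Complex.exp (Complex.I * e * s) * ⟪U s φ, A 0 (U s ψ)⟫_ℂ)
        (Complex.I * e * (Complex.exp (Complex.I * e * s) * ⟪U s φ, A 0 (U s ψ)⟫_ℂ) +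
          Complex.I * (Complex.exp (Complex.I * e * s) * ⟪U s φ, A 1 (U s ψ)⟫_ℂ)) s := by
      intro s
      have h2 : HasDerivAt (fun s : ℝ => Complex.exp (Complex.I * e * s))
          (Complex.exp (Complex.I * e * s) * (Complex.I * e)) s := by
        have h3 : HasDerivAt (fun s : ℝ => Complex.I * e * (s : ℂ)) (Complex.I * e) s := by
          simpa using (Complex.ofRealCLM.hasDerivAt (x := s)).const_mul (Complex.I * (e : ℂ))
        exact h3.cexp
      refine (h2.mul (hU.hasDerivAt_inner_conj (hA 0 (by omega)) hφ hψ s)).congr_deriv ?_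
      ring
    have h2 := intervalIntegral.integral_eq_sub_of_hasDerivAt (a := 0) (b := t)
      (fun s _ => hder s) (((hcont (A 0)).const_mul _).add
        ((hcont (A 1)).const_mul _) |>.intervalIntegrable _ _)
    rw [intervalIntegral.integral_add ((hcont (A 0)).const_mul _ |>.intervalIntegrable _ _)
      ((hcont (A 1)).const_mul _ |>.intervalIntegrable _ _),
      intervalIntegral.integral_const_mul, intervalIntegral.integral_const_mul] at h2
    set J := ∫ s in (0 : ℝ)..t, Complex.exp (Complex.I * e * s) * ⟪U s φ, A 0 (U s ψ)⟫_ℂ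
    set J' := ∫ s in (0 : ℝ)..t, Complex.exp (Complex.I * e * s) * ⟪U s φ, A 1 (U s ψ)⟫_ℂ
    -- One integration by parts: the two boundary values give `2 ‖A 0‖`, and `J'` carries the next
    -- commutator, already bounded by the induction hypothesis for the shifted sequence.
    have h3 : ‖Complex.I * e * J‖ ≤ 2 * ‖A 0‖ * (‖φ‖ * ‖ψ‖) + ‖J'‖ := by
      rw [eq_sub_of_add_eq h2]
      refine (norm_sub_le _ _).trans (add_le_add ((norm_sub_le _ _).trans ?_) ?_)
      · rw [norm_mul, norm_mul, norm_exp_I_mul, norm_exp_I_mul, one_mul, one_mul]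
        linarith [hg (A 0) t, hg (A 0) 0]
      · rw [norm_mul, Complex.norm_I, one_mul]
    rw [norm_mul, norm_mul, Complex.norm_I, one_mul, Complex.norm_real, Real.norm_eq_abs,
      abs_of_pos he] at h3
    have h4 : ‖J‖ ≤ (2 * ‖A 0‖ * (‖φ‖ * ‖ψ‖) + ‖J'‖) / e := by
      rw [le_div_iff₀ he]; linarith
    refine h4.trans ((div_le_div_of_nonneg_right (add_le_add_right h1 _) he.le).trans (le_of_eq ?_))
    rw [Finset.sum_range_succ', add_mul, add_mul, add_mul, Finset.sum_mul, Finset.sum_mul, add_div,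
      add_div, Finset.sum_div]
    have : ∀ n : ℕ, 2 * ‖A (n + 1)‖ / e ^ (n + 1) * (‖φ‖ * ‖ψ‖) / e =
        2 * ‖A (n + 1)‖ / e ^ (n + 1 + 1) * (‖φ‖ * ‖ψ‖) := fun n => by
      field_simp
      ring
    simp only [this]
    field_simp
    ring

end IsPropagator

/-- `∫₀ᵗ e^{ies} B̃(s) φ ds`. -/
def filtered (U : ℝ → (E →L[ℂ] E)) (B : E →L[ℂ] E) (e t : ℝ) (φ : E) : E :=
  ∫ s in (0 : ℝ)..t, Complex.exp (Complex.I * e * s) • heisenberg U B s φ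

theorem IsPropagator.continuous_heisenberg (hU : IsPropagator H U) (B : E →L[ℂ] E) (φ : E) :
    Continuous fun s => heisenberg U B s φ :=
  hU.continuous_apply continuous_neg (B.continuous.comp (hU.continuous φ))

theorem IsPropagator.continuous_filtered_integrand (hU : IsPropagator H U) (B : E →L[ℂ] E) (e : ℝ)
    (φ : E) : Continuous fun s : ℝ => Complex.exp (Complex.I * e * s) • heisenberg U B s φ :=
  (continuous_exp_I_mul e).smul (hU.continuous_heisenberg B φ)

theorem IsPropagator.norm_filtered_le (hU : IsPropagator H U) (B : E →L[ℂ] E) (e : ℝ) {t : ℝ}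
    (ht : 0 ≤ t) (φ : E) : ‖filtered U B e t φ‖ ≤ t * ‖B‖ * ‖φ‖ := by
  have := intervalIntegral.norm_integral_le_of_norm_le_const (a := (0 : ℝ)) (b := t)
    (f := fun s : ℝ => Complex.exp (Complex.I * e * s) • heisenberg U B s φ)
    (C := ‖B‖ * ‖φ‖) (fun s _ => by
      rw [norm_smul, norm_exp_I_mul, one_mul]
      change ‖U (-s) (B (U s φ))‖ ≤ _
      rw [hU.norm_apply]
      exact (B.le_opNorm _).trans (by rw [hU.norm_apply]))
  rw [sub_zero, abs_of_nonneg ht] at this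
  unfold filtered
  linarith

theorem IsPropagator.filtered_sub (hU : IsPropagator H U) (B : E →L[ℂ] E) (e t : ℝ) (φ ψ : E) :
    filtered U B e t (φ - ψ) = filtered U B e t φ - filtered U B e t ψ := by
  unfold filtered
  rw [← intervalIntegral.integral_sub
    ((hU.continuous_filtered_integrand B e φ).intervalIntegrable _ _)
    ((hU.continuous_filtered_integrand B e ψ).intervalIntegrable _ _)]
  simp only [map_sub, smul_sub]

theorem IsPropagator.continuous_filtered (hU : IsPropagator H U) (B : E →L[ℂ] E) (e : ℝ) {t : ℝ}
    (ht : 0 ≤ t) : Continuous (filtered U B e t) := by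
  refine (LipschitzWith.of_dist_le_mul (K := ⟨t * ‖B‖, by positivity⟩) fun φ ψ => ?_).continuous
  rw [dist_eq_norm, dist_eq_norm, ← hU.filtered_sub]
  exact hU.norm_filtered_le B e ht _

theorem IsPropagator.inner_filtered (hU : IsPropagator H U) (B : E →L[ℂ] E) (e t : ℝ) (φ ψ : E) :
    ⟪φ, filtered U B e t ψ⟫_ℂ =
      ∫ s in (0 : ℝ)..t, Complex.exp (Complex.I * e * s) * ⟪U s φ, B (U s ψ)⟫_ℂ := by
  unfold filtered
  have := (innerSL ℂ φ).intervalIntegral_comp_comm (μ := MeasureTheory.volume)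
    ((hU.continuous_filtered_integrand B e ψ).intervalIntegrable 0 t)
  simp only [innerSL_apply_apply] at this
  rw [← this]
  refine intervalIntegral.integral_congr fun s _ => ?_
  change ⟪φ, Complex.exp (Complex.I * e * s) • (U (-s) (B (U s ψ)))⟫_ℂ = _
  rw [inner_smul_right, hU.inner_neg_apply]

/-- Upgrades the weak estimate to a norm estimate: by density in the test vector `φ`, then by
continuity of the filtered operator in `ψ`. -/
theorem IsPropagator.norm_filtered_le_of_commutators (hU : IsPropagator H U) {e t : ℝ} (he : 0 < e)
    (ht : 0 ≤ t) {m : ℕ} {A : ℕ → (E →L[ℂ] E)} (hA : ∀ n < m, ∀ φ ψ : H.domain,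
      ⟪H φ, A n ψ⟫_ℂ - ⟪(φ : E), A n (H ψ)⟫_ℂ = ⟪(φ : E), A (n + 1) ψ⟫_ℂ) (ψ : E) :
    ‖filtered U (A 0) e t ψ‖ ≤
      ((∑ n ∈ Finset.range m, 2 * ‖A n‖ / e ^ (n + 1)) + t * ‖A m‖ / e ^ m) * ‖ψ‖ := by
  set K := (∑ n ∈ Finset.range m, 2 * ‖A n‖ / e ^ (n + 1)) + t * ‖A m‖ / e ^ m
  have hK : 0 ≤ K := by positivity
  have hc : IsClosed {ψ : E | ‖filtered U (A 0) e t ψ‖ ≤ K * ‖ψ‖} :=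
    isClosed_le (hU.continuous_filtered _ e ht).norm (by fun_prop)
  have hsub : (H.domain : Set E) ⊆ {ψ : E | ‖filtered U (A 0) e t ψ‖ ≤ K * ‖ψ‖} := by
    intro ψ hψ
    refine norm_le_of_dense hU.dense_domain (by positivity) fun φ hφ => ?_
    rw [hU.inner_filtered]
    have := hU.norm_integral_exp_mul_inner_le he ht hφ hψ m A hA
    linarith
  exact hc.closure_subset_iff.2 hsub (hU.dense_domain ψ)

end filtered

/-! ### The locality estimate -/

section environment

variable {Λ : Type*} [Fintype Λ] {ι : Λ → Type*} {I : Type*} [Fintype I]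

/-- The locality estimate for the filtered coupling operator. -/
theorem norm_sq_filtered_le {Egap : ℝ} (hEgap : 0 < Egap) {h : I → (Env ι →L[ℂ] Env ι)}
    (hh : ∀ i, IsSelfAdjoint (h i)) {HU HE : Env ι →ₗ.[ℂ] Env ι}
    (hHE : HE = (∑ i, h i).toLinearMap +ᵥ HU) {B : Env ι →L[ℂ] Env ι}
    {Jmax : ℝ} (hJpos : 0 < Jmax) (hJ : ∀ i, ‖h i‖ ≤ Jmax)
    {k r : ℕ} (hkpos : 0 < k) (hrpos : 0 < r)
    (hk : ∀ i, (supp (h i)).ncard ≤ k) (hr : ∀ x : Λ, {i | x ∈ supp (h i)}.ncard ≤ r)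
    {UE : ℝ → (Env ι →L[ℂ] Env ι)} (hUE : IsPropagator HE UE)
    {e : ℝ} (he : Egap ≤ e) {t : ℝ} (ht : 0 ≤ t) (φ : Env ι) :
    ‖filtered UE B e t φ‖ ^ 2 ≤ (16 / Egap ^ 2 + t ^ 2 / suppressionFactor
      (pathLength h (supp B) (suppUnbounded HU)) Jmax r k (numNoncommuting h B) Egap) *
        (‖B‖ * ‖φ‖) ^ 2 := by
  subst hHE
  set l := pathLength h (supp B) (suppUnbounded HU) with hl
  set R := numNoncommuting h B with hR
  have hk0 : (0 : ℝ) < k := by exact_mod_cast hkpos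
  have hr0 : (0 : ℝ) < r := by exact_mod_cast hrpos
  obtain ⟨m, hml, hm⟩ := exists_order l (a := (R : ℝ) / (r * k)) (x := Egap / (16 * Jmax * r * k))
    (by positivity) (by positivity)
  set a : ℝ := (R : ℝ) / (r * k) with ha
  set x : ℝ := Egap / (16 * Jmax * r * k) with hx
  have hloc : ∀ φ ψ : Env ι, ⟪(∑ i, h i) φ, ψ⟫_ℂ = ⟪φ, (∑ i, h i) ψ⟫_ℂ := fun φ ψ => by
    rw [← ContinuousLinearMap.adjoint_inner_left (∑ i, h i),
      (isSelfAdjoint_sum Finset.univ fun i _ => hh i).adjoint_eq]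
  have hsymm : ∀ φ ψ : HU.domain, ⟪HU φ, (ψ : Env ι)⟫_ℂ = ⟪(φ : Env ι), HU ψ⟫_ℂ := by
    intro φ ψ
    have h1 : ⟪(∑ i, h i) (φ : Env ι) + HU φ, (ψ : Env ι)⟫_ℂ =
      ⟪(φ : Env ι), (∑ i, h i) (ψ : Env ι) + HU ψ⟫_ℂ := hUE.symmetric φ ψ
    rw [inner_add_left, inner_add_right, hloc] at h1
    exact add_left_cancel h1
  have hstep : ∀ n < m, ∀ φ ψ : HU.domain,
      ⟪(∑ i, h i) (φ : Env ι) + HU φ, (localCommutator h)^[n] B ψ⟫_ℂ -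
        ⟪(φ : Env ι), (localCommutator h)^[n] B ((∑ i, h i) (ψ : Env ι) + HU ψ)⟫_ℂ =
      ⟪(φ : Env ι), (localCommutator h)^[n + 1] B ψ⟫_ℂ := by
    intro n hn φ ψ
    -- Only commutators of order `n < m ≤ l` are commuted further, and these are supported away from
    -- `HU`. The commutator of order `m` itself need only be bounded, so `m = l` is allowed.
    have hnl : (n : ℕ∞) < l := lt_of_lt_of_le (by exact_mod_cast hn) hml
    have hd : Disjoint (supp ((localCommutator h)^[n] B)) (suppUnbounded HU) :=
      (disjoint_reach_of_lt_pathLength h hnl).mono_left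
        (supp_iterate_localCommutator_subset hh B n)
    have h1 := formCommutes_of_disjoint hsymm hd φ ψ
    have h2 : (localCommutator h)^[n + 1] B =
        (∑ i, h i) * (localCommutator h)^[n] B - (localCommutator h)^[n] B * (∑ i, h i) := by
      rw [Function.iterate_succ_apply', localCommutator, Finset.sum_sub_distrib, Finset.sum_mul,
        Finset.mul_sum]
    rw [inner_add_left, map_add, inner_add_right, h1, hloc, h2, sub_apply,
      mul_apply_eq_comp, mul_apply_eq_comp, inner_sub_right]
    ring
  have hmain := hUE.norm_filtered_le_of_commutators (hEgap.trans_le he) ht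
    (A := fun n => (localCommutator h)^[n] B) hstep φ
  have hgrow : ∀ n, ‖(localCommutator h)^[n] B‖ / e ^ n ≤
      ‖B‖ * ∏ j ∈ Finset.range n, (a + j) / (8 * x) := by
    intro n
    have h1 := norm_iterate_localCommutator_le (h := h) hJpos.le hJ
      (ncard_not_commute_le hh hk hr) n R B le_rfl
    -- The growth factor `2 Jmax (R + j r k) / Egap` equals `(a + j)/(8x)`, since `8x = Egap / (2
    -- Jmax r k)`.
    have h2 : ∏ j ∈ Finset.range n, (a + j) / (8 * x) =
        (∏ j ∈ Finset.range n, (((R : ℝ) + j * ((r * k : ℕ) : ℝ)) * (2 * Jmax))) / Egap ^ n := by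
      rw [← Finset.card_range n, ← Finset.prod_const, Finset.card_range n,
        ← Finset.prod_div_distrib]
      refine Finset.prod_congr rfl fun j _ => ?_
      rw [ha, hx]
      push_cast
      field_simp
      ring
    rw [h2, ← mul_div_assoc]
    gcongr
  have hbound : ‖filtered UE B e t φ‖ ≤ ‖B‖ * ‖φ‖ *
      (2 / Egap * (∑ n ∈ Finset.range m, ∏ j ∈ Finset.range n, (a + j) / (8 * x)) +
        t * ∏ j ∈ Finset.range m, (a + j) / (8 * x)) := by
    refine hmain.trans ?_
    rw [mul_right_comm, mul_comm _ ‖φ‖, mul_comm _ ‖φ‖]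
    refine mul_le_mul_of_nonneg_left ?_ (norm_nonneg φ)
    rw [mul_add, Finset.mul_sum, Finset.mul_sum]
    refine add_le_add (Finset.sum_le_sum fun n _ => ?_) ?_
    · have he0 : 0 < e := hEgap.trans_le he
      calc 2 * ‖(localCommutator h)^[n] B‖ / e ^ (n + 1)
          = 2 / e * (‖(localCommutator h)^[n] B‖ / e ^ n) := by rw [pow_succ]; field_simp
        _ ≤ 2 / Egap * (‖B‖ * ∏ j ∈ Finset.range n, (a + j) / (8 * x)) := by
            gcongr
            exact hgrow n
        _ = _ := by ring
    · rw [mul_div_assoc]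
      calc t * (‖(localCommutator h)^[m] B‖ / e ^ m)
          ≤ t * (‖B‖ * ∏ j ∈ Finset.range m, (a + j) / (8 * x)) :=
            mul_le_mul_of_nonneg_left (hgrow m) ht
        _ = _ := by ring
  have hQ : t ^ 2 / suppressionFactor l Jmax r k R Egap =
      t ^ 2 * (((2 : ℝ) ^ a + 1) / truncExp l x) := by
    rw [suppressionFactor, ← div_div, div_inv_eq_mul]
    ring
  rw [hQ]
  calc ‖filtered UE B e t φ‖ ^ 2 ≤ (‖B‖ * ‖φ‖ *
      (2 / Egap * (∑ n ∈ Finset.range m, ∏ j ∈ Finset.range n, (a + j) / (8 * x)) +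
        t * ∏ j ∈ Finset.range m, (a + j) / (8 * x))) ^ 2 := by gcongr
    _ = (2 / Egap * (∑ n ∈ Finset.range m, ∏ j ∈ Finset.range n, (a + j) / (8 * x)) +
        t * ∏ j ∈ Finset.range m, (a + j) / (8 * x)) ^ 2 * (‖B‖ * ‖φ‖) ^ 2 := by ring
    _ ≤ _ := mul_le_mul_of_nonneg_right (hm Egap t hEgap) (by positivity)

end environment

/-! ### Intertwining the free joint evolution with that of the environment -/

section intertwining

variable {E F : Type*} [NormedAddCommGroup E] [InnerProductSpace ℂ E] [CompleteSpace E]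
  [NormedAddCommGroup F] [InnerProductSpace ℂ F] [CompleteSpace F]
  {H : F →ₗ.[ℂ] F} {U : ℝ → (F →L[ℂ] F)} {HE : E →ₗ.[ℂ] E} {UE : ℝ → (E →L[ℂ] E)}

/-- For `φ` in the domain both sides solve the Schrödinger equation of `H` with the same initial
value; density extends this to all `φ`. It is applied to `T φ = v ⊗ φ` with `v` an energy
eigenvector. -/
theorem IsPropagator.apply_intertwine (hU : IsPropagator H U) (hUE : IsPropagator HE UE)
    (T : E →L[ℂ] F) {e : ℝ} (hT : ∀ φ : HE.domain, ∃ h : T φ ∈ H.domain,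
      H ⟨T φ, h⟩ = (e : ℂ) • T φ + T (HE φ)) (t : ℝ) (φ : E) :
    U t (T φ) = Complex.exp (-Complex.I * e * t) • T (UE t φ) := by
  have hc : IsClosed {φ : E | U t (T φ) = Complex.exp (-Complex.I * e * t) • T (UE t φ)} :=
    isClosed_eq (by fun_prop) (by fun_prop)
  refine hc.closure_subset_iff.2 (fun φ hφ => Set.mem_ofPred_eq ▸ ?_) (hUE.dense_domain φ)
  have hmem : ∀ s : ℝ, Complex.exp (-Complex.I * e * s) • T (UE s φ) ∈ H.domain := fun s =>
    H.domain.smul_mem _ (hT ⟨_, (hUE.apply_mem_domain s hφ).1⟩).1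
  have hval : ∀ s : ℝ, H ⟨_, hmem s⟩ = Complex.exp (-Complex.I * e * s) •
      ((e : ℂ) • T (UE s φ) + T (UE s (HE ⟨φ, hφ⟩))) := by
    intro s
    obtain ⟨h1, h2⟩ := hUE.apply_mem_domain s hφ
    obtain ⟨h3, h4⟩ := hT ⟨_, h1⟩
    rw [h2] at h4
    rw [← h4]
    exact H.map_smul _ ⟨_, h3⟩
  have hder : ∀ s : ℝ, HasDerivAt (fun s : ℝ => Complex.exp (-Complex.I * e * s) • T (UE s φ))
      (-Complex.I • H ⟨_, hmem s⟩) s := by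
    intro s
    have h1 : HasDerivAt (fun s : ℝ => Complex.exp (-Complex.I * e * s))
        (Complex.exp (-Complex.I * e * s) * (-Complex.I * e)) s := by
      have h3 : HasDerivAt (fun s : ℝ => -Complex.I * e * (s : ℂ)) (-Complex.I * e) s := by
        simpa using (Complex.ofRealCLM.hasDerivAt (x := s)).const_mul (-Complex.I * (e : ℂ))
      exact h3.cexp
    have h2 : HasDerivAt (fun s => T (UE s φ)) (T (-Complex.I • UE s (HE ⟨φ, hφ⟩))) s :=
      (T.restrictScalars ℝ).hasFDerivAt.comp_hasDerivAt s (hUE.hasDerivAt_apply hφ s)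
    refine (h1.smul h2).congr_deriv ?_
    rw [hval s, map_smul]
    module
  have := hU.eq_apply_of_hasDerivAt hmem hder t
  simpa [hUE.zero] using this.symm

theorem IsPropagator.filtered_eq_sum (hUE : IsPropagator HE UE) {α : Type*} [Fintype α]
    (T : α → E →L[ℂ] F) (c : α → ℂ) (e : α → ℝ) {V : F →L[ℂ] F} {B : E →L[ℂ] E} {ψ : F} {φ : E}
    (h : ∀ s, U (-s) (V (U s ψ)) =
      ∑ j, T j (c j • Complex.exp (Complex.I * e j * s) • heisenberg UE B s φ)) (t : ℝ) :
    filtered U V 0 t ψ = ∑ j, T j (c j • filtered UE B (e j) t φ) := by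
  have hint : ∀ j, Continuous fun s : ℝ =>
      c j • Complex.exp (Complex.I * e j * s) • heisenberg UE B s φ := fun j =>
    (hUE.continuous_filtered_integrand B (e j) φ).const_smul (c j)
  unfold filtered
  have h1 : ∀ j, T j (c j • ∫ s in (0 : ℝ)..t, Complex.exp (Complex.I * e j * s) •
      heisenberg UE B s φ) = ∫ s in (0 : ℝ)..t,
        T j (c j • Complex.exp (Complex.I * e j * s) • heisenberg UE B s φ) := by
    intro j
    rw [← intervalIntegral.integral_smul]
    exact ((T j).intervalIntegral_comp_comm ((hint j).intervalIntegrable 0 t)).symm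
  simp only [h1]
  have hT : ∀ j, Continuous fun s : ℝ =>
      T j (c j • Complex.exp (Complex.I * e j * s) • heisenberg UE B s φ) := fun j =>
    (T j).continuous.comp (hint j)
  rw [← intervalIntegral.integral_finsetSum fun j _ => (hT j).intervalIntegrable 0 t]
  refine intervalIntegral.integral_congr fun s _ => ?_
  simp only [Complex.ofReal_zero, mul_zero, zero_mul, Complex.exp_zero, one_smul]
  exact h s

end intertwining

/-! ### Product vectors and the spectral decomposition of the system -/

section joint

variable {σ : Type*} {E : Type*} [NormedAddCommGroup E] [InnerProductSpace ℂ E]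

/-- `φ ↦ v ⊗ φ`. -/
def pureTensor (v : EuclideanSpace ℂ σ) : E →L[ℂ] Joint σ E :=
  (PiLp.continuousLinearEquiv 2 ℂ (fun _ : σ => E)).symm.toContinuousLinearMap ∘L
    ContinuousLinearMap.pi (fun a => v a • ContinuousLinearMap.id ℂ E)

theorem pureTensor_apply (v : EuclideanSpace ℂ σ) (φ : E) (a : σ) :
    pureTensor v φ a = v a • φ := rfl

theorem pureTensor_add (v w : EuclideanSpace ℂ σ) (φ : E) :
    pureTensor (v + w) φ = pureTensor v φ + pureTensor w φ := by
  ext a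
  exact add_smul _ _ _

theorem pureTensor_sub (v w : EuclideanSpace ℂ σ) (φ : E) :
    pureTensor (v - w) φ = pureTensor v φ - pureTensor w φ := by
  ext a
  exact sub_smul _ _ _

theorem pureTensor_smul (c : ℂ) (v : EuclideanSpace ℂ σ) (φ : E) :
    pureTensor (c • v) φ = c • pureTensor v φ := by
  ext a
  exact mul_smul _ _ _

theorem pureTensor_sum {α : Type*} (s : Finset α) (v : α → EuclideanSpace ℂ σ) (φ : E) :
    pureTensor (∑ i ∈ s, v i) φ = ∑ i ∈ s, pureTensor (v i) φ := by
  classical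
  induction s using Finset.induction_on with
  | empty => ext a; exact zero_smul _ _
  | insert i s hi ih => rw [Finset.sum_insert hi, Finset.sum_insert hi, pureTensor_add, ih]

variable [Fintype σ]

theorem inner_pureTensor (v w : EuclideanSpace ℂ σ) (φ ψ : E) :
    ⟪pureTensor v φ, pureTensor w ψ⟫_ℂ = ⟪v, w⟫_ℂ * ⟪φ, ψ⟫_ℂ := by
  rw [PiLp.inner_apply, PiLp.inner_apply, Finset.sum_mul]
  refine Finset.sum_congr rfl fun a _ => ?_
  rw [pureTensor_apply, pureTensor_apply, inner_smul_left, inner_smul_right, RCLike.inner_apply]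
  ring

theorem norm_pureTensor (v : EuclideanSpace ℂ σ) (φ : E) : ‖pureTensor v φ‖ = ‖v‖ * ‖φ‖ := by
  have h1 : ‖pureTensor v φ‖ ^ 2 = (‖v‖ * ‖φ‖) ^ 2 := by
    have h := inner_pureTensor v v φ φ
    rw [inner_self_eq_norm_sq_to_K, inner_self_eq_norm_sq_to_K, inner_self_eq_norm_sq_to_K] at h
    rw [mul_pow]
    exact_mod_cast h
  exact (pow_left_inj₀ (norm_nonneg _) (by positivity) two_ne_zero).1 h1

theorem tensor_apply (M : Matrix σ σ ℂ) (A : E →L[ℂ] E) (Ψ : Joint σ E) (a : σ) :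
    tensor M A Ψ a = ∑ b, M a b • A (Ψ b) := by
  change (∑ b, M a b • (A ∘L PiLp.proj 2 (fun _ : σ => E) b)) Ψ = _
  rw [sum_apply]
  rfl

theorem norm_sq_sum_pureTensor {b : OrthonormalBasis σ ℂ (EuclideanSpace ℂ σ)} (w : σ → E) :
    ‖∑ j, pureTensor (b j) (w j)‖ ^ 2 = ∑ j, ‖w j‖ ^ 2 := by
  have h : ⟪∑ j, pureTensor (b j) (w j), ∑ j, pureTensor (b j) (w j)⟫_ℂ =
      ∑ j, ⟪w j, w j⟫_ℂ := by
    classical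
    rw [sum_inner]
    refine Finset.sum_congr rfl fun i _ => ?_
    rw [inner_sum]
    simp only [inner_pureTensor, b.inner_eq_ite, ite_mul, one_mul, zero_mul]
    simp
  simp only [inner_self_eq_norm_sq_to_K] at h
  exact_mod_cast h

variable {κ : Type*} {HS S : Matrix σ σ ℂ} {HE : Hilb κ →ₗ.[ℂ] Hilb κ} {B : Hilb κ →L[ℂ] Hilb κ}

theorem totalHamiltonian_apply (lam : ℝ) (ψ : Joint σ (Hilb κ))
    (h : ψ ∈ (totalHamiltonian HS S HE B lam).domain) (h' : ψ ∈ (oneTensor σ HE).domain) :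
    totalHamiltonian HS S HE B lam ⟨ψ, h⟩ =
      (tensor HS (1 : Hilb κ →L[ℂ] Hilb κ) ψ + (lam : ℂ) • tensor S B ψ) +
        oneTensor σ HE ⟨ψ, h'⟩ := rfl

theorem totalHamiltonian_add (lam : ℝ) (ψ : Joint σ (Hilb κ))
    (h : ψ ∈ (totalHamiltonian HS S HE B 0).domain)
    (h' : ψ ∈ (totalHamiltonian HS S HE B lam).domain) :
    totalHamiltonian HS S HE B lam ⟨ψ, h'⟩ =
      totalHamiltonian HS S HE B 0 ⟨ψ, h⟩ + (lam : ℂ) • tensor S B ψ := by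
  rw [totalHamiltonian_apply lam ψ h' h, totalHamiltonian_apply 0 ψ h h, Complex.ofReal_zero,
    zero_smul, add_zero]
  abel

variable [DecidableEq σ]

/-- A system operator acting on the Hilbert space of the system. -/
abbrev sysOp (M : Matrix σ σ ℂ) : EuclideanSpace ℂ σ →L[ℂ] EuclideanSpace ℂ σ :=
  Matrix.toEuclideanCLM (n := σ) (𝕜 := ℂ) M

theorem cfc_mulVec_eigenvectorBasis {A : Matrix σ σ ℂ} (hA : A.IsHermitian) (f : ℝ → ℝ) (j : σ) :
    sysOp (cfc f A) (hA.eigenvectorBasis j) = (f (hA.eigenvalues j) : ℂ) • hA.eigenvectorBasis j := by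
  apply (WithLp.ofLp_injective 2)
  rw [Matrix.ofLp_toEuclideanCLM, hA.cfc_eq, Matrix.IsHermitian.cfc, Unitary.conjStarAlgAut_apply,
    ← Matrix.mulVec_mulVec, ← Matrix.mulVec_mulVec,
    hA.star_eigenvectorUnitary_mulVec, Matrix.diagonal_mulVec_single, mul_one]
  have : Pi.single j ((RCLike.ofReal ∘ f ∘ hA.eigenvalues) j : ℂ) =
      (f (hA.eigenvalues j) : ℂ) • (Pi.single j 1 : σ → ℂ) := by
    rw [← Pi.single_smul, smul_eq_mul, mul_one]; rfl
  rw [this, Matrix.mulVec_smul, hA.eigenvectorUnitary_mulVec]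
  rfl

theorem sysOp_eigenvectorBasis {A : Matrix σ σ ℂ} (hA : A.IsHermitian) (j : σ) :
    sysOp A (hA.eigenvectorBasis j) = (hA.eigenvalues j : ℂ) • hA.eigenvectorBasis j := by
  apply (WithLp.ofLp_injective 2)
  rw [Matrix.ofLp_toEuclideanCLM, hA.mulVec_eigenvectorBasis]
  rfl

theorem sysOp_codeProj_apply {HS : Matrix σ σ ℂ} (hHS : HS.IsHermitian) (w : EuclideanSpace ℂ σ) :
    sysOp (codeProj HS) w = ∑ j, (if hHS.eigenvalues j = 0 then (1 : ℂ) else 0) •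
      ⟪hHS.eigenvectorBasis j, w⟫_ℂ • hHS.eigenvectorBasis j := by
  conv_lhs => rw [← hHS.eigenvectorBasis.sum_repr' w]
  rw [map_sum]
  refine Finset.sum_congr rfl fun j _ => ?_
  rw [map_smul, codeProj, spectralProj, cfc_mulVec_eigenvectorBasis hHS, smul_comm]
  congr 1
  split_ifs <;> simp

theorem mul_codeProj {HS : Matrix σ σ ℂ} (hHS : HS.IsHermitian) : HS * codeProj HS = 0 := by
  apply (Matrix.toEuclideanCLM (n := σ) (𝕜 := ℂ)).injective
  rw [map_mul, map_zero]
  ext1 w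
  change sysOp HS (sysOp (codeProj HS) w) = 0
  rw [sysOp_codeProj_apply hHS, map_sum]
  refine Finset.sum_eq_zero fun j _ => ?_
  rw [map_smul, map_smul, sysOp_eigenvectorBasis hHS]
  split_ifs with h
  · simp [h]
  · simp

theorem sysOp_codeProj_of_mem {HS : Matrix σ σ ℂ} (hHS : HS.IsHermitian)
    {v : EuclideanSpace ℂ σ} (hv : sysOp HS v = 0) : sysOp (codeProj HS) v = v := by
  conv_rhs => rw [← hHS.eigenvectorBasis.sum_repr' v]
  rw [sysOp_codeProj_apply hHS]
  refine Finset.sum_congr rfl fun j _ => ?_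
  have h1 : ⟪sysOp HS (hHS.eigenvectorBasis j), v⟫_ℂ = 0 := by
    rw [← ContinuousLinearMap.adjoint_inner_right, ← ContinuousLinearMap.star_eq_adjoint,
      ← map_star, Matrix.star_eq_conjTranspose, hHS.eq]
    change ⟪_, sysOp HS v⟫_ℂ = 0
    rw [hv, inner_zero_right]
  rw [sysOp_eigenvectorBasis, inner_smul_left, mul_eq_zero, Complex.conj_ofReal,
    Complex.ofReal_eq_zero] at h1
  rcases h1 with h | h
  · rw [if_pos h, one_smul]
  · rw [h, zero_smul, smul_zero]

theorem tensor_pureTensor (M : Matrix σ σ ℂ) (A : E →L[ℂ] E) (v : EuclideanSpace ℂ σ) (φ : E) :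
    tensor M A (pureTensor v φ) = pureTensor (sysOp M v) (A φ) := by
  ext a
  rw [tensor_apply, pureTensor_apply, Matrix.ofLp_toEuclideanCLM, Matrix.mulVec, dotProduct,
    Finset.sum_smul]
  refine Finset.sum_congr rfl fun b _ => ?_
  rw [pureTensor_apply, map_smul, smul_smul]

section totalHamiltonian

variable {UE : ℝ → (Hilb κ →L[ℂ] Hilb κ)}
  {U₀ : ℝ → (Joint σ (Hilb κ) →L[ℂ] Joint σ (Hilb κ))}

theorem IsPropagator.apply_pureTensor (hUE : IsPropagator HE UE)
    (hU₀ : IsPropagator (totalHamiltonian HS S HE B 0) U₀) {v : EuclideanSpace ℂ σ} {e : ℝ}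
    (hv : sysOp HS v = (e : ℂ) • v) (t : ℝ) (φ : Hilb κ) :
    U₀ t (pureTensor v φ) = Complex.exp (-Complex.I * e * t) • pureTensor v (UE t φ) := by
  refine hU₀.apply_intertwine hUE (pureTensor v) (fun φ => ?_) t φ
  have h3 : pureTensor v (φ : Hilb κ) ∈ (oneTensor σ HE).domain := fun a => by
    rw [pureTensor_apply]
    exact HE.domain.smul_mem _ φ.2
  refine ⟨h3, ?_⟩
  rw [totalHamiltonian_apply 0 _ h3 h3, Complex.ofReal_zero, zero_smul, add_zero,
    tensor_pureTensor, hv, pureTensor_smul]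
  congr 1
  ext1 a
  exact HE.map_smul (v a) φ

end totalHamiltonian

end joint

/-! ### First-order perturbation theory in the code space -/

section firstOrder

variable {E : Type*} [NormedAddCommGroup E] [InnerProductSpace ℂ E] [CompleteSpace E]

/-- `norm_dyson_remainder_le` on the whole Hilbert space. -/
theorem IsPropagator.norm_dyson_le {H H' : E →ₗ.[ℂ] E} {U U' : ℝ → (E →L[ℂ] E)} {V : E →L[ℂ] E}
    {lam : ℝ} (hU : IsPropagator H U) (hU' : IsPropagator H' U')
    (hdom : H'.domain = H.domain)
    (hadd : ∀ (ψ : E) (h : ψ ∈ H.domain) (h' : ψ ∈ H'.domain),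
      H' ⟨ψ, h'⟩ = H ⟨ψ, h⟩ + (lam : ℂ) • V ψ)
    {t : ℝ} (ht : 0 ≤ t) (ψ : E) :
    ‖U (-t) (U' t ψ) - ψ + (Complex.I * lam) • filtered U V 0 t ψ‖ ≤
      lam ^ 2 * t ^ 2 * ‖V‖ ^ 2 * ‖ψ‖ := by
  have hc : IsClosed {ψ : E | ‖U (-t) (U' t ψ) - ψ + (Complex.I * lam) • filtered U V 0 t ψ‖ ≤
      lam ^ 2 * t ^ 2 * ‖V‖ ^ 2 * ‖ψ‖} := by
    refine isClosed_le (Continuous.norm (Continuous.add (by fun_prop) ?_)) (by fun_prop)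
    exact (hU.continuous_filtered V 0 ht).const_smul _
  refine hc.closure_subset_iff.2 (fun ψ hψ => ?_) (hU.dense_domain ψ)
  have h1 := hU.norm_dyson_remainder_le hU' hdom hadd ht hψ
  have h2 : filtered U V 0 t ψ = ∫ s in (0 : ℝ)..t, U (-s) (V (U s ψ)) := by
    unfold filtered
    refine intervalIntegral.integral_congr fun s _ => ?_
    simp only [Complex.ofReal_zero, mul_zero, zero_mul, Complex.exp_zero, one_smul]
    rfl
  rw [Set.mem_ofPred_eq, h2]
  exact h1

variable {σ : Type*} [Fintype σ] [DecidableEq σ] {κ : Type*} {HS S : Matrix σ σ ℂ}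
  {HE : Hilb κ →ₗ.[ℂ] Hilb κ} {B : Hilb κ →L[ℂ] Hilb κ} {UE : ℝ → (Hilb κ →L[ℂ] Hilb κ)}
  {U : ℝ → ℝ → (Joint σ (Hilb κ) →L[ℂ] Joint σ (Hilb κ))}

/-- A code vector carries no phase, so expanding `S v` in energy eigenvectors leaves the phase `e^{i
E_j s}` of the final level alone: the transition to `E_j` probes `B` at frequency `E_j`. -/
theorem filtered_pureTensor (hHS : HS.IsHermitian) (hUE : IsPropagator HE UE)
    (hU : ∀ lam, IsPropagator (totalHamiltonian HS S HE B lam) (U lam))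
    {v : EuclideanSpace ℂ σ} (hv : sysOp HS v = 0) (t : ℝ) (φ : Hilb κ) :
    filtered (U 0) (tensor S B) 0 t (pureTensor v φ) =
      ∑ j, pureTensor (hHS.eigenvectorBasis j) (⟪hHS.eigenvectorBasis j, sysOp S v⟫_ℂ •
        filtered UE B (hHS.eigenvalues j) t φ) := by
  refine hUE.filtered_eq_sum (fun j => pureTensor (hHS.eigenvectorBasis j)) _ _ (fun s => ?_) t
  have hv' : sysOp HS v = ((0 : ℝ) : ℂ) • v := by rw [hv]; simp
  rw [hUE.apply_pureTensor (hU 0) hv', Complex.ofReal_zero, mul_zero, zero_mul, Complex.exp_zero,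
    one_smul, tensor_pureTensor]
  conv_lhs => rw [← hHS.eigenvectorBasis.sum_repr' (sysOp S v)]
  rw [pureTensor_sum, map_sum]
  refine Finset.sum_congr rfl fun j _ => ?_
  rw [pureTensor_smul, map_smul, hUE.apply_pureTensor (hU 0) (sysOp_eigenvectorBasis hHS j),
    map_smul, map_smul]
  congr 3
  push_cast
  ring

/-- Error detection: inside the code space the coupling acts as a scalar on the system. -/
theorem exists_scalar_of_detect (hHS : HS.IsHermitian) (hB : B ≠ 0)
    (hdetect : ∃ O : Hilb κ →L[ℂ] Hilb κ,
      tensor (codeProj HS) 1 * tensor S B * tensor (codeProj HS) 1 = tensor (codeProj HS) O) :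
    ∃ c : ℂ, ∀ v : EuclideanSpace ℂ σ, sysOp HS v = 0 →
      sysOp (codeProj HS) (sysOp S v) = c • v := by
  obtain ⟨O, hO⟩ := hdetect
  obtain ⟨φ, hφ⟩ : ∃ φ, B φ ≠ 0 := by
    by_contra! h
    exact hB (ContinuousLinearMap.ext h)
  have hn : ⟪B φ, B φ⟫_ℂ ≠ 0 := inner_self_ne_zero.2 hφ
  refine ⟨⟪B φ, O φ⟫_ℂ / ⟪B φ, B φ⟫_ℂ, fun v hv => ext_inner_left ℂ fun u => ?_⟩
  -- Testing on the environment with `B φ ≠ 0` gives `⟪u, Π_C S v⟫ ‖B φ‖² = ⟪u, v⟫ ⟪B φ, O φ⟫`, so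
  -- the scalar depends on neither `u` nor `v`.
  have h1 := congrArg (fun A => ⟪pureTensor u (B φ), A (pureTensor v φ)⟫_ℂ) hO
  simp only [mul_apply_eq_comp, tensor_pureTensor, one_apply_eq_self, inner_pureTensor,
    sysOp_codeProj_of_mem hHS hv] at h1
  rw [inner_smul_right, div_mul_eq_mul_div, eq_div_iff hn, h1]
  ring

/-- The expectation of `Π_C H_I² Π_C` in `v ⊗ φ` is `‖S v‖² ‖B φ‖²`; varying `φ` recovers `‖B‖`. -/
theorem norm_coupling_le (hHS : HS.IsHermitian) (hS : S.IsHermitian) (hB : IsSelfAdjoint B)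
    {v : EuclideanSpace ℂ σ} (hv : sysOp HS v = 0) :
    (‖sysOp S v‖ * ‖B‖) ^ 2 ≤ ‖tensor (codeProj HS) (1 : Hilb κ →L[ℂ] Hilb κ) * (tensor S B) ^ 2 *
      tensor (codeProj HS) 1‖ * ‖v‖ ^ 2 := by
  set A : Joint σ (Hilb κ) →L[ℂ] Joint σ (Hilb κ) :=
    tensor (codeProj HS) (1 : Hilb κ →L[ℂ] Hilb κ) * (tensor S B) ^ 2 * tensor (codeProj HS) 1
    with hA
  set N := ‖A‖
  have hN : 0 ≤ N := norm_nonneg _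
  have hSsymm : ∀ u w, ⟪sysOp S u, w⟫_ℂ = ⟪u, sysOp S w⟫_ℂ := fun u w => by
    rw [← ContinuousLinearMap.adjoint_inner_right, ← ContinuousLinearMap.star_eq_adjoint,
      ← map_star, Matrix.star_eq_conjTranspose, hS.eq]
  have hPsymm : ∀ u w, ⟪sysOp (codeProj HS) u, w⟫_ℂ = ⟪u, sysOp (codeProj HS) w⟫_ℂ := fun u w => by
    have h : star (codeProj HS) = codeProj HS :=
      (cfc_predicate (p := IsSelfAdjoint) _ HS).star_eq
    rw [← ContinuousLinearMap.adjoint_inner_right, ← ContinuousLinearMap.star_eq_adjoint,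
      ← map_star, h]
  have key : ∀ φ : Hilb κ, ‖sysOp S v‖ * ‖B φ‖ ≤ Real.sqrt N * ‖v‖ * ‖φ‖ := by
    intro φ
    have h1 : ⟪pureTensor v φ, A (pureTensor v φ)⟫_ℂ = ((‖sysOp S v‖ * ‖B φ‖ : ℝ) : ℂ) ^ 2 := by
      rw [hA, sq (tensor S B)]
      simp only [mul_apply_eq_comp, tensor_pureTensor, one_apply_eq_self, inner_pureTensor,
        sysOp_codeProj_of_mem hHS hv]
      rw [← hPsymm, sysOp_codeProj_of_mem hHS hv, ← hSsymm,
        ← ContinuousLinearMap.adjoint_inner_left B, hB.adjoint_eq, inner_self_eq_norm_sq_to_K,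
        inner_self_eq_norm_sq_to_K]
      push_cast
      ring_nf
      rfl
    have h2 : (‖sysOp S v‖ * ‖B φ‖) ^ 2 ≤ N * (‖v‖ * ‖φ‖) ^ 2 := by
      have h3 := congrArg norm h1
      rw [norm_pow, Complex.norm_real, Real.norm_eq_abs, sq_abs] at h3
      rw [← h3]
      refine (norm_inner_le_norm _ _).trans ?_
      have h4 := A.le_opNorm (pureTensor v φ)
      rw [norm_pureTensor] at h4 ⊢
      calc _ ≤ ‖v‖ * ‖φ‖ * (N * (‖v‖ * ‖φ‖)) := by gcongr
        _ = _ := by ring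
    refine (pow_le_pow_iff_left₀ (by positivity) (by positivity) two_ne_zero).1 (h2.trans ?_)
    rw [mul_assoc, mul_pow (Real.sqrt N), Real.sq_sqrt hN]
  have h5 : ‖((‖sysOp S v‖ : ℝ) : ℂ) • B‖ ≤ Real.sqrt N * ‖v‖ := by
    refine ContinuousLinearMap.opNorm_le_bound _ (by positivity) fun φ => ?_
    rw [smul_apply, norm_smul, Complex.norm_real, norm_norm]
    exact key φ
  rw [norm_smul, Complex.norm_real, norm_norm] at h5
  calc _ ≤ (Real.sqrt N * ‖v‖) ^ 2 := by gcongr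
    _ = _ := by rw [mul_pow, Real.sq_sqrt hN]

/-- First-order perturbation theory for an error detecting code: up to second order, the only
deviation from a product of the code state comes from excitations of the system. -/
theorem norm_evolution_sub_le (hHS : HS.IsHermitian) (hS : S.IsHermitian) (hB : IsSelfAdjoint B)
    {Egap : ℝ} (hgap : ∀ e ∈ spectrum ℝ HS, e = 0 ∨ Egap ≤ e)
    (hUE : IsPropagator HE UE) (hU : ∀ lam, IsPropagator (totalHamiltonian HS S HE B lam) (U lam))
    (hdetect : ∃ O : Hilb κ →L[ℂ] Hilb κ,
      tensor (codeProj HS) 1 * tensor S B * tensor (codeProj HS) 1 = tensor (codeProj HS) O)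
    {t : ℝ} (ht : 0 ≤ t) {K : ℝ} (hK : 0 ≤ K)
    (hfil : ∀ e, Egap ≤ e → ∀ φ, ‖filtered UE B e t φ‖ ^ 2 ≤ K * (‖B‖ * ‖φ‖) ^ 2) :
    ∃ c : ℂ, ∀ (lam : ℝ) (v : EuclideanSpace ℂ σ), sysOp HS v = 0 → ∀ φ : Hilb κ,
      ‖U lam t (pureTensor v φ) -
        pureTensor v (UE t (φ - (Complex.I * lam * c) • filtered UE B 0 t φ))‖ ≤
      (|lam| * Real.sqrt (‖tensor (codeProj HS) (1 : Hilb κ →L[ℂ] Hilb κ) * (tensor S B) ^ 2 *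
        tensor (codeProj HS) 1‖ * K) + lam ^ 2 * t ^ 2 * ‖tensor (σ := σ) S B‖ ^ 2) *
        (‖v‖ * ‖φ‖) := by
  set N := ‖tensor (codeProj HS) (1 : Hilb κ →L[ℂ] Hilb κ) * (tensor S B) ^ 2 *
      tensor (codeProj HS) 1‖ with hNdef
  have hN : 0 ≤ N := norm_nonneg _
  -- One scalar must serve all code vectors, so that the environment vector is independent of `v`.
  -- If `B = 0` error detection does not determine it, but the filtered vector vanishes and any
  -- scalar works.
  obtain ⟨c, hc⟩ : ∃ c : ℂ, ∀ v : EuclideanSpace ℂ σ, sysOp HS v = 0 → ∀ φ : Hilb κ,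
      pureTensor (sysOp (codeProj HS) (sysOp S v)) (filtered UE B 0 t φ) =
        c • pureTensor v (filtered UE B 0 t φ) := by
    by_cases hB0 : B = 0
    · refine ⟨0, fun v _ φ => ?_⟩
      have : filtered UE B 0 t φ = 0 := by
        have := hUE.norm_filtered_le B 0 ht φ
        rw [hB0, norm_zero, mul_zero, zero_mul] at this
        rw [hB0]
        exact norm_le_zero_iff.1 this
      rw [this, map_zero, zero_smul]
    · obtain ⟨c, hc⟩ := exists_scalar_of_detect hHS hB0 hdetect
      exact ⟨c, fun v hv φ => by rw [hc v hv, pureTensor_smul]⟩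
  refine ⟨c, fun lam v hv φ => ?_⟩
  have hdys := (hU 0).norm_dyson_le (hU lam) rfl (totalHamiltonian_add lam) ht (pureTensor v φ)
  rw [filtered_pureTensor hHS hUE hU hv, norm_pureTensor] at hdys
  set b := hHS.eigenvectorBasis with hb
  set w : σ → Hilb κ := fun j => if hHS.eigenvalues j = 0 then 0 else
    ⟪b j, sysOp S v⟫_ℂ • filtered UE B (hHS.eigenvalues j) t φ with hw
  have hsplit : ∑ j, pureTensor (b j) (⟪b j, sysOp S v⟫_ℂ •
      filtered UE B (hHS.eigenvalues j) t φ) =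
      c • pureTensor v (filtered UE B 0 t φ) + ∑ j, pureTensor (b j) (w j) := by
    rw [← hc v hv, sysOp_codeProj_apply hHS, pureTensor_sum, ← Finset.sum_add_distrib]
    refine Finset.sum_congr rfl fun j _ => ?_
    rw [pureTensor_smul, pureTensor_smul, hw, ← hb]
    by_cases h : hHS.eigenvalues j = 0
    · simp [h]
    · simp [h]
  have hrest : ‖∑ j, pureTensor (b j) (w j)‖ ≤ Real.sqrt (N * K) * (‖v‖ * ‖φ‖) := by
    refine (pow_le_pow_iff_left₀ (by positivity) (by positivity) two_ne_zero).1 ?_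
    rw [norm_sq_sum_pureTensor, mul_pow, Real.sq_sqrt (by positivity)]
    have h1 : ∀ j, ‖w j‖ ^ 2 ≤ ‖⟪b j, sysOp S v⟫_ℂ‖ ^ 2 * (K * (‖B‖ * ‖φ‖) ^ 2) := by
      intro j
      rw [hw]
      by_cases h : hHS.eigenvalues j = 0
      · simp only [h, if_true, norm_zero]
        rw [zero_pow two_ne_zero]
        positivity
      · simp only [h, if_false, norm_smul, mul_pow]
        rw [← mul_pow ‖B‖]
        gcongr
        exact hfil _ ((hgap _ (hHS.eigenvalues_mem_spectrum_real j)).resolve_left h) φ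
    -- Orthogonality of the excited terms lets Parseval's identity sum all levels to `‖S v‖²`, with
    -- no factor counting energies.
    calc ∑ j, ‖w j‖ ^ 2 ≤ ∑ j, ‖⟪b j, sysOp S v⟫_ℂ‖ ^ 2 * (K * (‖B‖ * ‖φ‖) ^ 2) :=
          Finset.sum_le_sum fun j _ => h1 j
      _ = (‖sysOp S v‖ * ‖B‖) ^ 2 * (K * ‖φ‖ ^ 2) := by
          rw [← Finset.sum_mul, b.sum_sq_norm_inner_right]
          ring
      _ ≤ (N * ‖v‖ ^ 2) * (K * ‖φ‖ ^ 2) :=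
          mul_le_mul_of_nonneg_right (norm_coupling_le hHS hS hB hv) (by positivity)
      _ = _ := by ring
  have hv' : sysOp HS v = ((0 : ℝ) : ℂ) • v := by rw [hv]; simp
  have hfree : ∀ χ : Hilb κ, pureTensor v (UE t χ) = U 0 t (pureTensor v χ) := fun χ => by
    rw [hUE.apply_pureTensor (hU 0) hv']
    simp
  rw [hfree, ← (hU 0).norm_apply (-t), map_sub, (hU 0).neg_apply_apply]
  have heq : U 0 (-t) (U lam t (pureTensor v φ)) -
      pureTensor v (φ - (Complex.I * lam * c) • filtered UE B 0 t φ) =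
      (U 0 (-t) (U lam t (pureTensor v φ)) - pureTensor v φ + (Complex.I * lam) •
        ∑ j, pureTensor (b j) (⟪b j, sysOp S v⟫_ℂ • filtered UE B (hHS.eigenvalues j) t φ)) -
      (Complex.I * lam) • ∑ j, pureTensor (b j) (w j) := by
    rw [hsplit, map_sub, map_smul]
    module
  rw [heq]
  refine (norm_sub_le _ _).trans ((add_le_add hdys le_rfl).trans ?_)
  rw [norm_smul, norm_mul, Complex.norm_I, one_mul, Complex.norm_real, Real.norm_eq_abs]
  have := mul_le_mul_of_nonneg_left hrest (abs_nonneg lam)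
  linarith

end firstOrder

/-! ### A variational lower bound for the fidelity -/

section fidelityBound

variable {σ : Type*} [Fintype σ] [DecidableEq σ]

theorem sysOp_mul_apply (M N : Matrix σ σ ℂ) (v : EuclideanSpace ℂ σ) :
    sysOp (M * N) v = sysOp M (sysOp N v) := by
  rw [sysOp, map_mul]; rfl

theorem sysOp_add_apply (M N : Matrix σ σ ℂ) (v : EuclideanSpace ℂ σ) :
    sysOp (M + N) v = sysOp M v + sysOp N v := by
  rw [sysOp, map_add]; rfl

theorem sysOp_smul_apply (c : ℂ) (M : Matrix σ σ ℂ) (v : EuclideanSpace ℂ σ) :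
    sysOp (c • M) v = c • sysOp M v := by
  rw [sysOp, map_smul]; rfl

theorem sysOp_one_apply (v : EuclideanSpace ℂ σ) : sysOp (1 : Matrix σ σ ℂ) v = v := by
  rw [sysOp, map_one]; rfl

theorem inner_sysOp_conjTranspose (M : Matrix σ σ ℂ) (u w : EuclideanSpace ℂ σ) :
    ⟪sysOp Mᴴ u, w⟫_ℂ = ⟪u, sysOp M w⟫_ℂ := by
  rw [← Matrix.star_eq_conjTranspose, sysOp, map_star, ContinuousLinearMap.star_eq_adjoint,
    ContinuousLinearMap.adjoint_inner_left]

theorem trace_eq_sum_inner (M : Matrix σ σ ℂ) (b : OrthonormalBasis σ ℂ (EuclideanSpace ℂ σ)) :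
    M.trace = ∑ j, ⟪b j, sysOp M (b j)⟫_ℂ := by
  have h1 := LinearMap.trace_eq_sum_inner (sysOp M : EuclideanSpace ℂ σ →ₗ[ℂ] EuclideanSpace ℂ σ) b
  have h2 := LinearMap.trace_eq_sum_inner (sysOp M : EuclideanSpace ℂ σ →ₗ[ℂ] EuclideanSpace ℂ σ)
    (EuclideanSpace.basisFun σ ℂ)
  have h3 : M.trace = ∑ j, ⟪EuclideanSpace.basisFun σ ℂ j,
      sysOp M (EuclideanSpace.basisFun σ ℂ j)⟫_ℂ := by
    refine Finset.sum_congr rfl fun j _ => ?_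
    rw [EuclideanSpace.basisFun_apply, EuclideanSpace.inner_single_left,
      Matrix.ofLp_toEuclideanCLM]
    simp
  rw [h3]
  exact h2.symm.trans h1

theorem trace_cfc {G : Matrix σ σ ℂ} (hG : G.IsHermitian) (f : ℝ → ℝ) :
    (cfc f G).trace.re = ∑ j, f (hG.eigenvalues j) := by
  rw [trace_eq_sum_inner _ hG.eigenvectorBasis, Complex.re_sum]
  refine Finset.sum_congr rfl fun j _ => ?_
  rw [cfc_mulVec_eigenvectorBasis hG, inner_smul_right, inner_self_eq_norm_sq_to_K,
    hG.eigenvectorBasis.orthonormal.1 j]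
  simp

theorem cfc_sqrt_isHermitian (A : Matrix σ σ ℂ) : (cfc Real.sqrt A).IsHermitian :=
  (cfc_predicate (p := IsSelfAdjoint) Real.sqrt A)

theorem cfc_sqrt_mul_self {A : Matrix σ σ ℂ} (hA : A.PosSemidef) :
    cfc Real.sqrt A * cfc Real.sqrt A = A := by
  rw [← cfc_mul Real.sqrt Real.sqrt A (by fun_prop) (by fun_prop)]
  conv_rhs => rw [← cfc_id ℝ A hA.1]
  refine cfc_congr fun x hx => ?_
  obtain ⟨i, rfl⟩ := hA.1.spectrum_real_eq_range_eigenvalues ▸ hx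
  exact Real.mul_self_sqrt (hA.eigenvalues_nonneg i)

theorem cfc_sqrt_posSemidef (A : Matrix σ σ ℂ) : (cfc Real.sqrt A).PosSemidef := by
  have h : cfc Real.sqrt A =
      (cfc (fun x => Real.sqrt (Real.sqrt x)) A)ᴴ * cfc (fun x => Real.sqrt (Real.sqrt x)) A := by
    have h1 : (cfc (fun x => Real.sqrt (Real.sqrt x)) A)ᴴ =
        cfc (fun x => Real.sqrt (Real.sqrt x)) A :=
      (cfc_predicate (p := IsSelfAdjoint) (fun x => Real.sqrt (Real.sqrt x)) A)
    rw [h1, ← cfc_mul _ _ A (by fun_prop) (by fun_prop)]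
    exact cfc_congr fun x _ => (Real.mul_self_sqrt (Real.sqrt_nonneg x)).symm
  rw [h]
  exact Matrix.posSemidef_conjTranspose_mul_self _

theorem posSemidef_of_inner_nonneg {A : Matrix σ σ ℂ}
    (h : ∀ v : EuclideanSpace ℂ σ, 0 ≤ ⟪v, sysOp A v⟫_ℂ) : A.PosSemidef := by
  rw [← Matrix.isPositive_toEuclideanLin_iff, LinearMap.isPositive_iff_complex]
  intro v
  have h1 := h v
  have h2 : ⟪Matrix.toEuclideanLin A v, v⟫_ℂ = ⟪v, sysOp A v⟫_ℂ := by
    rw [← inner_conj_symm]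
    exact Complex.conj_eq_iff_im.2 (Complex.nonneg_iff.1 h1).2.symm
  rw [h2]
  obtain ⟨hre, him⟩ := Complex.nonneg_iff.1 h1
  exact ⟨Complex.ext rfl him, hre⟩

theorem norm_sysOp_le_of_conjTranspose {C : Matrix σ σ ℂ} (h : ∀ v, ‖sysOp Cᴴ v‖ ≤ ‖v‖)
    (v : EuclideanSpace ℂ σ) : ‖sysOp C v‖ ≤ ‖v‖ := by
  have h1 : ‖sysOp Cᴴ‖ ≤ 1 := ContinuousLinearMap.opNorm_le_bound _ zero_le_one fun v => by
    rw [one_mul]; exact h v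
  rw [← Matrix.star_eq_conjTranspose, sysOp, map_star, ContinuousLinearMap.star_eq_adjoint,
    LinearIsometryEquiv.norm_map] at h1
  exact ((sysOp C).le_of_opNorm_le h1 v).trans (one_mul _).le

theorem norm_trace_mul_le {C T : Matrix σ σ ℂ} (hC : ∀ v, ‖sysOp C v‖ ≤ ‖v‖)
    (b : OrthonormalBasis σ ℂ (EuclideanSpace ℂ σ)) :
    ‖(C * T).trace‖ ≤ ∑ j, ‖sysOp T (b j)‖ := by
  rw [trace_eq_sum_inner _ b]
  refine norm_sum_le_of_le _ fun j _ => (norm_inner_le_norm _ _).trans ?_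
  rw [b.orthonormal.1 j, one_mul, sysOp_mul_apply]
  exact hC _

/-- A lower bound for the fidelity: if `M M† ≤ A` then `|Tr(M √ρ)| ≤ F(A, ρ)`. -/
theorem norm_trace_le_fidelity {A ρ M : Matrix σ σ ℂ} (hA : A.PosSemidef) (hρ : ρ.PosSemidef)
    (hM : ∀ v, ‖sysOp Mᴴ v‖ ^ 2 ≤ (⟪v, sysOp A v⟫_ℂ).re) :
    ‖(M * cfc Real.sqrt ρ).trace‖ ≤ fidelity A ρ := by
  set s := cfc Real.sqrt A with hs
  set q := cfc Real.sqrt ρ with hq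
  have hsH : sᴴ = s := cfc_sqrt_isHermitian A
  have hqH : qᴴ = q := cfc_sqrt_isHermitian ρ
  set T := q * s with hT
  have hG : Tᴴ * T = s * ρ * s := by
    rw [hT, Matrix.conjTranspose_mul, hsH, hqH, ← cfc_sqrt_mul_self hρ]
    simp only [Matrix.mul_assoc, hq]
  have hGh : (s * ρ * s).IsHermitian := hG ▸ Matrix.isHermitian_conjTranspose_mul_self T
  -- The fidelity is the trace norm of `T = √ρ √A`, read off in the eigenbasis of `T† T`.
  have hF : fidelity A ρ = ∑ j, ‖sysOp T (hGh.eigenvectorBasis j)‖ := by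
    rw [fidelity, trace_cfc hGh]
    refine Finset.sum_congr rfl fun j _ => ?_
    have h1 : ‖sysOp T (hGh.eigenvectorBasis j)‖ ^ 2 = hGh.eigenvalues j := by
      have h2 := inner_sysOp_conjTranspose T (sysOp T (hGh.eigenvectorBasis j))
        (hGh.eigenvectorBasis j)
      rw [← sysOp_mul_apply, hG, sysOp_eigenvectorBasis hGh, inner_smul_left,
        Complex.conj_ofReal, inner_self_eq_norm_sq_to_K, inner_self_eq_norm_sq_to_K,
        hGh.eigenvectorBasis.orthonormal.1 j, RCLike.ofReal_one, one_pow, mul_one] at h2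
      exact (Complex.ofReal_injective (by push_cast; exact h2)).symm
    rw [← h1, Real.sqrt_sq (norm_nonneg _)]
  refine le_of_forall_pos_le_add fun ε hε => ?_
  set k := ∑ j, ‖sysOp q (hGh.eigenvectorBasis j)‖ with hk
  have hk0 : 0 ≤ k := Finset.sum_nonneg fun _ _ => norm_nonneg _
  set δ : ℝ := ε / (k + 1) with hδ
  have hδ0 : 0 < δ := by positivity
  -- Ideally `M = √A C` with `C` a contraction. As `√A` may be singular, it is shifted by `δ`, whose
  -- contribution to the trace is at most `ε`.
  have hpd : (s + (δ : ℂ) • (1 : Matrix σ σ ℂ)).PosDef :=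
    Matrix.PosDef.posSemidef_add (cfc_sqrt_posSemidef A)
      (Matrix.PosDef.one.smul (by exact_mod_cast hδ0))
  set D := s + (δ : ℂ) • (1 : Matrix σ σ ℂ) with hD
  have hDu : IsUnit D.det := (Matrix.isUnit_iff_isUnit_det D).1 hpd.isUnit
  have hDH : Dᴴ = D := hpd.1
  have hDiH : (D⁻¹)ᴴ = D⁻¹ := by rw [Matrix.conjTranspose_nonsing_inv, hDH]
  set C := D⁻¹ * M with hC
  have hDC : M = s * C + (δ : ℂ) • C := by
    have : M = D * C := by rw [hC, Matrix.mul_nonsing_inv_cancel_left _ _ hDu]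
    rw [this, hD, Matrix.add_mul, Matrix.smul_mul, Matrix.one_mul]
  -- With `v = (s + δ) u` one has `‖C† v‖ = ‖M† u‖ ≤ ‖s u‖ ≤ ‖v‖`, the last step by positivity of
  -- `s`.
  have hCle : ∀ v, ‖sysOp C v‖ ≤ ‖v‖ := by
    refine norm_sysOp_le_of_conjTranspose fun v => ?_
    set u := sysOp D⁻¹ v with hu
    have hv : v = sysOp s u + (δ : ℂ) • u := by
      rw [← sysOp_one_apply v, ← Matrix.mul_nonsing_inv D hDu, sysOp_mul_apply, hD,
        sysOp_add_apply, sysOp_smul_apply, sysOp_one_apply]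
    have h1 : ‖sysOp Cᴴ v‖ ^ 2 ≤ ‖sysOp s u‖ ^ 2 := by
      rw [hC, Matrix.conjTranspose_mul, hDiH, sysOp_mul_apply]
      refine (hM u).trans (le_of_eq ?_)
      rw [← cfc_sqrt_mul_self hA, ← hs, sysOp_mul_apply, ← inner_sysOp_conjTranspose, hsH,
        inner_self_eq_norm_sq_to_K]
      norm_cast
    have h2 : ‖sysOp s u‖ ^ 2 ≤ ‖v‖ ^ 2 := by
      rw [hv, norm_add_sq (𝕜 := ℂ)]
      have h3 : 0 ≤ RCLike.re ⟪sysOp s u, (δ : ℂ) • u⟫_ℂ := by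
        have h4 : 0 ≤ (⟪sysOp s u, u⟫_ℂ).re :=
          ((LinearMap.isPositive_iff_complex _).1 (Matrix.isPositive_toEuclideanLin_iff.2
            (cfc_sqrt_posSemidef A)) u).2
        rw [inner_smul_right]
        change 0 ≤ ((δ : ℂ) * ⟪sysOp s u, u⟫_ℂ).re
        rw [Complex.re_ofReal_mul]
        positivity
      have h4 := sq_nonneg ‖(δ : ℂ) • u‖
      linarith
    exact (pow_le_pow_iff_left₀ (norm_nonneg _) (norm_nonneg _) two_ne_zero).1 (h1.trans h2)
  have htr : (M * q).trace = (C * T).trace + (δ : ℂ) * (C * q).trace := by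
    rw [hDC, Matrix.add_mul, Matrix.trace_add, Matrix.smul_mul, Matrix.trace_smul, hT,
      Matrix.mul_assoc, Matrix.trace_mul_comm, Matrix.mul_assoc, smul_eq_mul]
  rw [htr, hF]
  refine (norm_add_le _ _).trans (add_le_add (norm_trace_mul_le hCle _) ?_)
  rw [norm_mul, Complex.norm_real, Real.norm_eq_abs, abs_of_pos hδ0]
  calc δ * ‖(C * q).trace‖ ≤ δ * k :=
        mul_le_mul_of_nonneg_left (norm_trace_mul_le hCle _) hδ0.le
    _ ≤ δ * (k + 1) := by gcongr; linarith
    _ = ε := by rw [hδ]; field_simp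

end fidelityBound

/-! ### The Lamb shift unitary -/

section lambUnitary

theorem exists_norm_exp_sub_one_le (𝔸 : Type*) [NormedRing 𝔸] [NormedAlgebra ℂ 𝔸]
    [CompleteSpace 𝔸] :
    ∃ δ > 0, ∀ x : 𝔸, ‖x‖ ≤ δ → ‖NormedSpace.exp x - 1‖ ≤ 2 * ‖x‖ := by
  have h := (hasFDerivAt_exp_zero (𝕂 := ℂ) (𝔸 := 𝔸)).isLittleO.def zero_lt_one
  rw [Metric.eventually_nhds_iff] at h
  obtain ⟨ε, hε, h⟩ := h
  refine ⟨ε / 2, half_pos hε, fun x hx => ?_⟩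
  have h1 := h (show dist x 0 < ε by rw [dist_zero_right]; linarith)
  rw [NormedSpace.exp_zero, sub_zero, one_mul, one_apply_eq_self] at h1
  calc ‖NormedSpace.exp x - 1‖ = ‖(NormedSpace.exp x - 1 - x) + x‖ := by rw [sub_add_cancel]
    _ ≤ ‖x‖ + ‖x‖ := (norm_add_le _ _).trans (by gcongr)
    _ = 2 * ‖x‖ := (two_mul _).symm

variable {σ : Type*} [Fintype σ] [DecidableEq σ] {κ : Type*}

theorem codeProj_isHermitian (HS : Matrix σ σ ℂ) : (codeProj HS).IsHermitian :=
  (cfc_predicate (p := IsSelfAdjoint) _ HS)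

/-- Whatever `Γ` is, conjugation turns the coefficient at `(μ₁, μ₂)` into the one at `(μ₂, μ₁)`. -/
theorem lambShift_isHermitian (HS S : Matrix σ σ ℂ) (UE : ℝ → (Hilb κ →L[ℂ] Hilb κ))
    (B ρE : Hilb κ →L[ℂ] Hilb κ) (t : ℝ) : (lambShift HS S UE B ρE t).IsHermitian := by
  unfold Matrix.IsHermitian lambShift
  simp only [Matrix.conjTranspose_sum, Matrix.conjTranspose_smul, Matrix.conjTranspose_mul,
    Matrix.conjTranspose_conjTranspose]
  rw [Finset.sum_comm]
  refine Finset.sum_congr rfl fun μ₁ _ => Finset.sum_congr rfl fun μ₂ _ => ?_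
  congr 1
  simp only [star_div₀, star_sub, star_mul', Complex.star_def, Complex.conj_conj, Complex.conj_I,
    map_ofNat]
  rw [mul_neg, div_neg, ← neg_div, neg_sub]

theorem conjTranspose_exp_mul_exp {X : Matrix σ σ ℂ} (hX : Xᴴ = -X) :
    (NormedSpace.exp X)ᴴ * NormedSpace.exp X = 1 := by
  rw [← Matrix.exp_conjTranspose, hX, ← Matrix.exp_add_of_commute _ _ (Commute.refl X).neg_left,
    neg_add_cancel, NormedSpace.exp_zero]

theorem conjTranspose_lambUnitary_mul_self (HS S : Matrix σ σ ℂ)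
    (UE : ℝ → (Hilb κ →L[ℂ] Hilb κ)) (B ρE : Hilb κ →L[ℂ] Hilb κ) (lam t : ℝ) :
    (lambUnitary HS S UE B ρE lam t)ᴴ * lambUnitary HS S UE B ρE lam t = 1 := by
  refine conjTranspose_exp_mul_exp ?_
  rw [Matrix.conjTranspose_smul, Matrix.conjTranspose_mul, Matrix.conjTranspose_mul,
    (codeProj_isHermitian HS).eq, (lambShift_isHermitian HS S UE B ρE t).eq, Matrix.mul_assoc,
    ← neg_smul]
  congr 1
  simp [Complex.conj_ofReal]

theorem norm_sysOp_of_conjTranspose_mul_self {L : Matrix σ σ ℂ} (hL : Lᴴ * L = 1)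
    (v : EuclideanSpace ℂ σ) : ‖sysOp L v‖ = ‖v‖ := by
  have h := inner_sysOp_conjTranspose L (sysOp L v) v
  rw [← sysOp_mul_apply, hL, sysOp_one_apply, inner_self_eq_norm_sq_to_K,
    inner_self_eq_norm_sq_to_K] at h
  have h1 : ‖v‖ ^ 2 = ‖sysOp L v‖ ^ 2 := Complex.ofReal_injective (by push_cast; exact h)
  exact ((pow_left_inj₀ (norm_nonneg _) (norm_nonneg _) two_ne_zero).1 h1).symm

-- The exponent is `λ²` times a fixed matrix and `exp` has derivative the identity at `0`. A shift
-- of vectors by `O(λ²)` alters the infidelity bound only at order `λ³`.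
open scoped Matrix.Norms.L2Operator in
theorem exists_norm_lambUnitary_sub_le (HS S : Matrix σ σ ℂ) (UE : ℝ → (Hilb κ →L[ℂ] Hilb κ))
    (B ρE : Hilb κ →L[ℂ] Hilb κ) (t : ℝ) :
    ∃ C ≥ 0, ∃ lam₀ > 0, ∀ lam : ℝ, |lam| ≤ lam₀ → ∀ v : EuclideanSpace ℂ σ,
      ‖sysOp (lambUnitary HS S UE B ρE lam t) v - v‖ ≤ C * lam ^ 2 * ‖v‖ := by
  obtain ⟨δ, hδ, h⟩ := exists_norm_exp_sub_one_le (Matrix σ σ ℂ)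
  set G := codeProj HS * lambShift HS S UE B ρE t * codeProj HS with hG
  refine ⟨2 * ‖G‖, by positivity, min 1 (δ / (‖G‖ + 1)), by positivity, fun lam hlam v => ?_⟩
  have h1 : |lam| ≤ 1 := hlam.trans (min_le_left _ _)
  have h2 : |lam| ≤ δ / (‖G‖ + 1) := hlam.trans (min_le_right _ _)
  have hn : ‖(-Complex.I * (lam : ℂ) ^ 2) • G‖ = lam ^ 2 * ‖G‖ := by
    rw [norm_smul, norm_mul, norm_neg, Complex.norm_I, one_mul, norm_pow, Complex.norm_real,
      Real.norm_eq_abs, sq_abs]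
  have h3 : lam ^ 2 * ‖G‖ ≤ δ := by
    rw [le_div_iff₀ (by positivity)] at h2
    calc lam ^ 2 * ‖G‖ = |lam| * (|lam| * ‖G‖) := by rw [← sq_abs]; ring
      _ ≤ 1 * (|lam| * (‖G‖ + 1)) := by gcongr; linarith
      _ ≤ δ := by linarith
  have h4 : ‖lambUnitary HS S UE B ρE lam t - 1‖ ≤ 2 * (lam ^ 2 * ‖G‖) := by
    rw [← hn]
    exact h _ (hn.le.trans h3)
  have h5 : sysOp (lambUnitary HS S UE B ρE lam t) v - v =
      sysOp (lambUnitary HS S UE B ρE lam t - 1) v := by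
    rw [sysOp, sysOp, map_sub, map_one, sub_apply, one_apply_eq_self]
  rw [h5, mul_assoc 2, mul_comm ‖G‖ (lam ^ 2)]
  exact ContinuousLinearMap.le_of_opNorm_le _ h4 v

end lambUnitary

/-! ### Partial traces of positive operators -/

section partialTrace

variable {σ : Type*} [Fintype σ]

section general

variable {E : Type*} [NormedAddCommGroup E] [InnerProductSpace ℂ E]

theorem tensor_mul (M N : Matrix σ σ ℂ) (A B : E →L[ℂ] E) :
    tensor (M * N) (A * B) = tensor M A * tensor N B := by
  ext Ψ a
  rw [mul_apply_eq_comp, tensor_apply, tensor_apply]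
  simp only [tensor_apply, map_sum, map_smul, Finset.smul_sum, smul_smul, Matrix.mul_apply,
    Finset.sum_smul, mul_apply_eq_comp]
  exact Finset.sum_comm

variable [CompleteSpace E]

theorem adjoint_tensor (M : Matrix σ σ ℂ) (A : E →L[ℂ] E) :
    ContinuousLinearMap.adjoint (tensor M A) = tensor Mᴴ (ContinuousLinearMap.adjoint A) := by
  refine ((ContinuousLinearMap.eq_adjoint_iff _ _).2 fun Ψ Φ => ?_).symm
  rw [PiLp.inner_apply, PiLp.inner_apply]
  simp only [tensor_apply, sum_inner, inner_sum, inner_smul_left, inner_smul_right,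
    ContinuousLinearMap.adjoint_inner_left]
  rw [Finset.sum_comm]
  simp [Matrix.conjTranspose_apply]

end general

variable [DecidableEq σ] {κ : Type*}

theorem pureTensor_single {σ E : Type*} [DecidableEq σ] [NormedAddCommGroup E]
    [InnerProductSpace ℂ E] (b : σ) (φ : E) : pureTensor (EuclideanSpace.single b (1 : ℂ)) φ = incl b φ := by
  ext a
  rw [pureTensor_apply]
  change _ = (Pi.single b φ : σ → E) a
  rw [PiLp.single_apply, Pi.single_apply]
  split_ifs with h
  · rw [one_smul]
  · rw [zero_smul]

theorem sum_smul_single (v : EuclideanSpace ℂ σ) :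
    ∑ b, v b • EuclideanSpace.single b (1 : ℂ) = v := by
  conv_rhs => rw [← (EuclideanSpace.basisFun σ ℂ).sum_repr v]
  simp

theorem inner_sysOp (M : Matrix σ σ ℂ) (v w : EuclideanSpace ℂ σ) :
    ⟪v, sysOp M w⟫_ℂ = ∑ a, ∑ b, star (v a) * w b * M a b := by
  rw [PiLp.inner_apply]
  refine Finset.sum_congr rfl fun a _ => ?_
  rw [Matrix.ofLp_toEuclideanCLM, RCLike.inner_apply, Matrix.mulVec, dotProduct, Finset.sum_mul]
  refine Finset.sum_congr rfl fun b _ => ?_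
  rw [starRingEnd_apply]
  ring

theorem inner_pureTensor_apply (T : Joint σ (Hilb κ) →L[ℂ] Joint σ (Hilb κ))
    (v w : EuclideanSpace ℂ σ) (φ : Hilb κ) :
    ⟪pureTensor v φ, T (pureTensor w φ)⟫_ℂ =
      ∑ a, ∑ b, star (v a) * w b * ⟪φ, block T a b φ⟫_ℂ := by
  conv_lhs => rw [← sum_smul_single w]
  rw [pureTensor_sum, map_sum, inner_sum, Finset.sum_comm]
  refine Finset.sum_congr rfl fun b _ => ?_
  rw [pureTensor_smul, map_smul, inner_smul_right, PiLp.inner_apply, Finset.mul_sum]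
  refine Finset.sum_congr rfl fun a _ => ?_
  rw [pureTensor_apply, inner_smul_left, pureTensor_single, starRingEnd_apply]
  change w b * (_ * ⟪φ, block T a b φ⟫_ℂ) = _
  ring

/-- The basis vector `|b⟩ ⊗ |y⟩`. -/
def jointKet (c : σ × κ) : Joint σ (Hilb κ) := pureTensor (EuclideanSpace.single c.1 1) (ket c.2)

theorem hasSum_norm_inner_jointKet (Φ : Joint σ (Hilb κ)) :
    HasSum (fun c : σ × κ => ‖⟪jointKet c, Φ⟫_ℂ‖ ^ 2) (‖Φ‖ ^ 2) := by
  have h1 : ∀ c : σ × κ, ⟪jointKet c, Φ⟫_ℂ = Φ c.1 c.2 := fun c => by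
    rw [jointKet, PiLp.inner_apply]
    simp only [pureTensor_apply, inner_smul_left, inner_ket_left]
    simp [PiLp.single_apply, ite_mul]
  simp only [h1]
  have hs : Summable fun c : σ × κ => ‖Φ c.1 c.2‖ ^ 2 :=
    (summable_prod_of_nonneg fun c => by positivity).2
      ⟨fun b => summable_sq (Φ b), Summable.of_finite⟩
  have h2 : ‖Φ‖ ^ 2 = ∑' c : σ × κ, ‖Φ c.1 c.2‖ ^ 2 := by
    rw [hs.tsum_prod, tsum_fintype, PiLp.norm_sq_eq_of_L2]
    exact Finset.sum_congr rfl fun b _ => norm_sq_eq_tsum (Φ b)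
  rw [h2]
  exact hs.hasSum

/-- Cyclicity of the trace for the positive operator `K K†`, `K` Hilbert–Schmidt. -/
theorem hasSum_norm_adjoint_pureTensor {K : Joint σ (Hilb κ) →L[ℂ] Joint σ (Hilb κ)}
    (hK : Summable fun c : σ × κ => ‖K (jointKet c)‖ ^ 2) (v : EuclideanSpace ℂ σ) :
    Summable (fun c : σ × κ =>
      ‖ContinuousLinearMap.adjoint (pureTensor v) (K (jointKet c))‖ ^ 2) ∧
    HasSum (fun x => ‖ContinuousLinearMap.adjoint K (pureTensor v (ket x))‖ ^ 2)
      (∑' c : σ × κ, ‖ContinuousLinearMap.adjoint (pureTensor v) (K (jointKet c))‖ ^ 2) := by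
  set ξ : σ × κ → Hilb κ := fun c => ContinuousLinearMap.adjoint (pureTensor v) (K (jointKet c))
    with hξ
  -- Both sums add the same squared matrix entries, by rows or by columns; nonnegativity allows the
  -- exchange.
  have h1 : ∀ x c, ‖⟪jointKet c, ContinuousLinearMap.adjoint K (pureTensor v (ket x))⟫_ℂ‖ ^ 2 =
      ‖ξ c x‖ ^ 2 := fun x c => by
    rw [ContinuousLinearMap.adjoint_inner_right, ← ContinuousLinearMap.adjoint_inner_left,
      norm_inner_symm, inner_ket_left]
  have hs0 : Summable fun c => ‖ξ c‖ ^ 2 := by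
    refine Summable.of_nonneg_of_le (fun c => by positivity) (fun c => ?_)
      (hK.mul_left (‖ContinuousLinearMap.adjoint (pureTensor (E := Hilb κ) v)‖ ^ 2))
    rw [← mul_pow]
    gcongr
    exact ContinuousLinearMap.le_opNorm _ _
  refine ⟨hs0, ?_⟩
  have hs : Summable fun p : (σ × κ) × κ => ‖ξ p.1 p.2‖ ^ 2 := by
    refine (summable_prod_of_nonneg fun c => by positivity).2 ⟨fun c => summable_sq (ξ c), ?_⟩
    simp only [← norm_sq_eq_tsum]
    exact hs0
  have hs' : Summable fun p : κ × (σ × κ) => ‖ξ p.2 p.1‖ ^ 2 :=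
    (Equiv.prodComm κ (σ × κ)).summable_iff.2 hs
  have h2 : ∀ x, ‖ContinuousLinearMap.adjoint K (pureTensor v (ket x))‖ ^ 2 =
      ∑' c, ‖ξ c x‖ ^ 2 := fun x => by
    rw [← (hasSum_norm_inner_jointKet _).tsum_eq]
    simp only [h1]
  have h3 : ∑' c, ‖ξ c‖ ^ 2 = ∑' x, ∑' c, ‖ξ c x‖ ^ 2 := by
    rw [tsum_congr fun c => norm_sq_eq_tsum (ξ c)]
    exact Summable.tsum_comm (f := fun x c => ‖ξ c x‖ ^ 2) hs'
  rw [h3]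
  simp only [h2]
  exact hs'.prod.hasSum

/-- Writes the reduced state through the vectors `K (jointKet c)`, the components of a purification.
This gives its positivity and allows truncation to finitely many environment vectors. -/
theorem inner_sysOp_partialTrace {K : Joint σ (Hilb κ) →L[ℂ] Joint σ (Hilb κ)}
    (hK : Summable fun c : σ × κ => ‖K (jointKet c)‖ ^ 2) (v : EuclideanSpace ℂ σ) :
    ⟪v, sysOp (partialTrace (K * ContinuousLinearMap.adjoint K)) v⟫_ℂ =
      ((∑' c : σ × κ, ‖ContinuousLinearMap.adjoint (pureTensor v) (K (jointKet c))‖ ^ 2 : ℝ) :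
        ℂ) := by
  set T := K * ContinuousLinearMap.adjoint K with hT
  have h1 : ∀ v w x, ⟪pureTensor v (ket x), T (pureTensor w (ket x))⟫_ℂ =
      ⟪ContinuousLinearMap.adjoint K (pureTensor v (ket x)),
        ContinuousLinearMap.adjoint K (pureTensor w (ket x))⟫_ℂ := fun v w x => by
    rw [hT, mul_apply_eq_comp, ContinuousLinearMap.adjoint_inner_left]
  -- A divergent block trace would take the default value `0`, so summability must come first;
  -- Cauchy–Schwarz bounds the off-diagonal blocks by the diagonal ones.
  have hblock : ∀ a b, Summable fun x => ⟪ket x, block T a b (ket x)⟫_ℂ := by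
    intro a b
    have h2 : ∀ x, ⟪ket x, block T a b (ket x)⟫_ℂ =
        ⟪pureTensor (EuclideanSpace.single a 1) (ket x),
          T (pureTensor (EuclideanSpace.single b 1) (ket x))⟫_ℂ := fun x => by
      rw [inner_pureTensor_apply]
      simp [PiLp.single_apply]
    simp only [h2, h1]
    refine Summable.of_norm_bounded
      ((hasSum_norm_adjoint_pureTensor hK (EuclideanSpace.single a 1)).2.summable.add
        (hasSum_norm_adjoint_pureTensor hK (EuclideanSpace.single b 1)).2.summable) fun x => ?_
    refine (norm_inner_le_norm _ _).trans ?_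
    nlinarith [two_mul_le_add_sq
      ‖ContinuousLinearMap.adjoint K (pureTensor (EuclideanSpace.single a 1) (ket x))‖
      ‖ContinuousLinearMap.adjoint K (pureTensor (EuclideanSpace.single b 1) (ket x))‖,
      sq_nonneg ‖ContinuousLinearMap.adjoint K (pureTensor (EuclideanSpace.single a 1) (ket x))‖,
      sq_nonneg ‖ContinuousLinearMap.adjoint K (pureTensor (EuclideanSpace.single b 1) (ket x))‖]
  have h3 : HasSum (fun x => ⟪pureTensor v (ket x), T (pureTensor v (ket x))⟫_ℂ)
      ⟪v, sysOp (partialTrace T) v⟫_ℂ := by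
    simp only [inner_pureTensor_apply, inner_sysOp]
    exact hasSum_sum fun a _ => hasSum_sum fun b _ => (hblock a b).hasSum.mul_left _
  refine h3.unique ?_
  simp only [h1, inner_self_eq_norm_sq_to_K]
  have h4 := (Complex.hasSum_ofReal).2 (hasSum_norm_adjoint_pureTensor hK v).2
  refine (congrArg (fun f => HasSum f _) (funext fun c => ?_)).mpr h4
  push_cast
  rfl

end partialTrace

/-! ### From closeness on a purification to fidelity -/

section fidelity

variable {σ : Type*} [Fintype σ] [DecidableEq σ] {κ : Type*}

theorem sq_norm_trace_le_fidelity {A ρ M : Matrix σ σ ℂ} (hA : A.PosSemidef)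
    (hρ : ρ.PosSemidef) {m : ℝ} (hm : 0 < m)
    (hM : ∀ v, ‖sysOp Mᴴ v‖ ^ 2 ≤ m * (⟪v, sysOp A v⟫_ℂ).re) :
    ‖(M * cfc Real.sqrt ρ).trace‖ ^ 2 ≤ m * fidelity A ρ ^ 2 := by
  set q := Real.sqrt m with hq
  have hq0 : 0 < q := Real.sqrt_pos.2 hm
  have hqm : q ^ 2 = m := Real.sq_sqrt hm.le
  have hn : ‖((q⁻¹ : ℝ) : ℂ)‖ = q⁻¹ := by
    rw [Complex.norm_real, Real.norm_eq_abs, abs_of_pos (inv_pos.2 hq0)]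
  have h := norm_trace_le_fidelity (M := ((q⁻¹ : ℝ) : ℂ) • M) hA hρ fun v => by
    rw [Matrix.conjTranspose_smul, sysOp_smul_apply, norm_smul, norm_star, hn, mul_pow, inv_pow,
      hqm, inv_mul_le_iff₀ hm]
    exact hM v
  rw [Matrix.smul_mul, Matrix.trace_smul, norm_smul, hn, inv_mul_le_iff₀ hq0] at h
  calc _ ≤ (q * fidelity A ρ) ^ 2 := by gcongr
    _ = _ := by rw [mul_pow, hqm]

theorem norm_sq_sum_inner_le {E α : Type*} [NormedAddCommGroup E] [InnerProductSpace ℂ E]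
    (s : Finset α) (χ ξ : α → E) :
    ‖∑ y ∈ s, ⟪χ y, ξ y⟫_ℂ‖ ^ 2 ≤ (∑ y ∈ s, ‖χ y‖ ^ 2) * ∑ y ∈ s, ‖ξ y‖ ^ 2 := by
  refine le_trans ?_ (Finset.sum_mul_sq_le_sq_mul_sq s (fun y => ‖χ y‖) (fun y => ‖ξ y‖))
  gcongr
  exact norm_sum_le_of_le _ fun y _ => norm_inner_le_norm _ _

/-- The fidelity is bounded below by the entanglement fidelity with any finite family of
reference vectors `χ`. -/
theorem sq_norm_sum_inner_le_fidelity {A ρ L : Matrix σ σ ℂ} (hA : A.PosSemidef)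
    (hρ : ρ.PosSemidef) (s : Finset κ) (χ : κ → Hilb κ) (Ψ : σ × κ → Joint σ (Hilb κ))
    (hA' : ∀ v, ∑ b, ∑ y ∈ s,
      ‖ContinuousLinearMap.adjoint (pureTensor (sysOp L v)) (Ψ (b, y))‖ ^ 2 ≤
        (⟪v, sysOp A v⟫_ℂ).re)
    (hχ : 0 < ∑ y ∈ s, ‖χ y‖ ^ 2) :
    ‖∑ y ∈ s, ⟪χ y, ∑ b, ContinuousLinearMap.adjoint (pureTensor
      (sysOp L (sysOp (cfc Real.sqrt ρ) (EuclideanSpace.single b 1)))) (Ψ (b, y))⟫_ℂ‖ ^ 2 ≤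
      (∑ y ∈ s, ‖χ y‖ ^ 2) * fidelity A ρ ^ 2 := by
  -- `Tr(M √ρ)` is the overlap of the vectors `Ψ` with the reference family, and Cauchy–Schwarz
  -- gives `M M† ≤ (∑ ‖χ y‖²) A`.
  set M : Matrix σ σ ℂ := Matrix.of fun a b => ∑ y ∈ s,
    ⟪pureTensor (sysOp L (EuclideanSpace.single a 1)) (χ y), Ψ (b, y)⟫_ℂ with hM
  have hsum : ∀ (v : EuclideanSpace ℂ σ) b, ∑ a, star (v a) * M a b =
      ∑ y ∈ s, ⟪χ y, ContinuousLinearMap.adjoint (pureTensor (sysOp L v)) (Ψ (b, y))⟫_ℂ := by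
    intro v b
    simp only [hM, Matrix.of_apply, ContinuousLinearMap.adjoint_inner_right, Finset.mul_sum]
    rw [Finset.sum_comm]
    refine Finset.sum_congr rfl fun y _ => ?_
    conv_rhs => rw [← sum_smul_single v]
    rw [map_sum, pureTensor_sum, sum_inner]
    refine Finset.sum_congr rfl fun a _ => ?_
    rw [map_smul, pureTensor_smul, inner_smul_left, starRingEnd_apply]
  have htr : (M * cfc Real.sqrt ρ).trace = ∑ y ∈ s, ⟪χ y, ∑ b, ContinuousLinearMap.adjoint
      (pureTensor (sysOp L (sysOp (cfc Real.sqrt ρ) (EuclideanSpace.single b 1))))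
        (Ψ (b, y))⟫_ℂ := by
    simp only [inner_sum]
    rw [Finset.sum_comm, Matrix.trace_mul_comm]
    refine Finset.sum_congr rfl fun b _ => ?_
    rw [← hsum, Matrix.diag_apply, Matrix.mul_apply]
    refine Finset.sum_congr rfl fun a _ => ?_
    rw [Matrix.ofLp_toEuclideanCLM]
    congr 1
    rw [← (cfc_sqrt_isHermitian ρ).apply b a]
    simp
  rw [← htr]
  refine sq_norm_trace_le_fidelity hA hρ hχ fun v => ?_
  have h1 : ‖sysOp Mᴴ v‖ ^ 2 = ∑ b, ‖∑ y ∈ s, ⟪χ y, ContinuousLinearMap.adjoint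
      (pureTensor (sysOp L v)) (Ψ (b, y))⟫_ℂ‖ ^ 2 := by
    rw [PiLp.norm_sq_eq_of_L2]
    refine Finset.sum_congr rfl fun b _ => ?_
    rw [← hsum, ← norm_star (∑ a, star (v a) * M a b), star_sum, Matrix.ofLp_toEuclideanCLM,
      Matrix.mulVec, dotProduct]
    simp only [star_mul, star_star, Matrix.conjTranspose_apply]
  rw [h1]
  refine le_trans ?_ (mul_le_mul_of_nonneg_left (hA' v) hχ.le)
  rw [Finset.mul_sum]
  exact Finset.sum_le_sum fun b _ => norm_sq_sum_inner_le s _ _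

/-- The maps `T b` form one isometry `χ ↦ (T b χ)`. The left side is the squared distance of `Ψ`
from its range, hence at most the squared distance to any point of it. -/
theorem norm_sq_sub_le_of_norm_sub_le {E F α : Type*} [Fintype α] [NormedAddCommGroup E]
    [InnerProductSpace ℂ E] [NormedAddCommGroup F] [InnerProductSpace ℂ F] [CompleteSpace E]
    [CompleteSpace F] (T : α → E →L[ℂ] F) (Ψ : α → F) (hT : ∀ χ, ∑ b, ‖T b χ‖ ^ 2 = ‖χ‖ ^ 2)
    (χ : E) :
    ∑ b, ‖Ψ b‖ ^ 2 - ‖∑ b, ContinuousLinearMap.adjoint (T b) (Ψ b)‖ ^ 2 ≤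
      ∑ b, ‖Ψ b - T b χ‖ ^ 2 := by
  set Y := ∑ b, ContinuousLinearMap.adjoint (T b) (Ψ b) with hY
  have h1 : ∑ b, ‖Ψ b - T b χ‖ ^ 2 = ∑ b, ‖Ψ b‖ ^ 2 - 2 * (⟪Y, χ⟫_ℂ).re + ‖χ‖ ^ 2 := by
    rw [← hT χ, hY, sum_inner, Complex.re_sum, Finset.mul_sum, ← Finset.sum_sub_distrib,
      ← Finset.sum_add_distrib]
    refine Finset.sum_congr rfl fun b _ => ?_
    rw [norm_sub_sq (𝕜 := ℂ), ContinuousLinearMap.adjoint_inner_left]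
    rfl
  have h2 := norm_sub_sq (𝕜 := ℂ) Y χ
  have h3 := sq_nonneg ‖Y - χ‖
  rw [h2] at h3
  change 0 ≤ ‖Y‖ ^ 2 - 2 * (⟪Y, χ⟫_ℂ).re + ‖χ‖ ^ 2 at h3
  rw [h1]
  linarith

theorem sum_norm_sq_cfc_sqrt_single {ρ : Matrix σ σ ℂ} (hρ : ρ.PosSemidef) :
    (((∑ b, ‖sysOp (cfc Real.sqrt ρ) (EuclideanSpace.single b 1)‖ ^ 2 : ℝ)) : ℂ) = ρ.trace := by
  rw [trace_eq_sum_inner ρ (EuclideanSpace.basisFun σ ℂ), Complex.ofReal_sum]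
  refine Finset.sum_congr rfl fun b _ => ?_
  rw [EuclideanSpace.basisFun_apply]
  conv_rhs => rw [← cfc_sqrt_mul_self hρ, sysOp_mul_apply, ← inner_sysOp_conjTranspose,
    (cfc_sqrt_isHermitian ρ).eq, inner_self_eq_norm_sq_to_K]
  push_cast
  rfl

theorem exists_sqrt_of_isPositive {E : Type*} [NormedAddCommGroup E] [InnerProductSpace ℂ E]
    [CompleteSpace E] {T : E →L[ℂ] E} (hT : T.IsPositive) :
    ∃ s : E →L[ℂ] E, IsSelfAdjoint s ∧ s * s = T :=
  ⟨CFC.sqrt T, (CFC.sqrt_nonneg T).isSelfAdjoint,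
    CFC.sqrt_mul_sqrt_self T ((ContinuousLinearMap.nonneg_iff_isPositive T).2 hT)⟩

theorem exists_sqrt_densityOperator {ρE : Hilb κ →L[ℂ] Hilb κ} (hρE : IsDensityOperator ρE) :
    ∃ s : Hilb κ →L[ℂ] Hilb κ, IsSelfAdjoint s ∧ s * s = ρE ∧
      HasSum (fun y => ‖s (ket y)‖ ^ 2) 1 := by
  obtain ⟨s, hs, hss⟩ := exists_sqrt_of_isPositive hρE.1
  refine ⟨s, hs, hss, ?_⟩
  rw [← Complex.hasSum_ofReal]
  refine (congrArg (fun f => HasSum f _) (funext fun y => ?_)).mpr hρE.2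
  conv_rhs => rw [← hss, mul_apply_eq_comp, ← ContinuousLinearMap.adjoint_inner_left,
    hs.adjoint_eq, inner_self_eq_norm_sq_to_K]
  push_cast
  rfl

/-- If on the purification of `ρ_S` the isometry `V` is close to `L ⊗ (anything)`, then the
reduced dynamics preserves `ρ_S` up to the unitary `L`. -/
theorem one_sub_fidelity_sq_le {L ρS : Matrix σ σ ℂ} (hL : Lᴴ * L = 1) (hρS : ρS.PosSemidef)
    (htr : ρS.trace = 1) {ρE : Hilb κ →L[ℂ] Hilb κ} (hρE : IsDensityOperator ρE)
    {V : Joint σ (Hilb κ) →L[ℂ] Joint σ (Hilb κ)} (hV : ∀ Ψ, ‖V Ψ‖ = ‖Ψ‖) {δ : ℝ}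
    (h : ∀ φ : Hilb κ, ∃ χ : Hilb κ, ∀ b : σ,
      ‖V (pureTensor (sysOp (cfc Real.sqrt ρS) (EuclideanSpace.single b 1)) φ) -
        pureTensor (sysOp L (sysOp (cfc Real.sqrt ρS) (EuclideanSpace.single b 1))) χ‖ ≤
      δ * (‖sysOp (cfc Real.sqrt ρS) (EuclideanSpace.single b 1)‖ * ‖φ‖)) :
    1 - fidelity (Lᴴ * reducedState V ρS ρE * L) ρS ^ 2 ≤ δ ^ 2 := by
  obtain ⟨s, hs, hss, hsum⟩ := exists_sqrt_densityOperator hρE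
  set τ : σ → EuclideanSpace ℂ σ := fun b =>
    sysOp (cfc Real.sqrt ρS) (EuclideanSpace.single b 1) with hτ
  have hτ1 : ∑ b, ‖τ b‖ ^ 2 = 1 := by
    have := sum_norm_sq_cfc_sqrt_single hρS
    rw [htr] at this
    exact_mod_cast this
  -- A Hilbert–Schmidt square root of the evolved joint state; its columns are the evolved
  -- purification.
  set K := V * tensor (cfc Real.sqrt ρS) s with hK
  have hKK : V * tensor ρS ρE * ContinuousLinearMap.adjoint V =
      K * ContinuousLinearMap.adjoint K := by
    have h1 : ContinuousLinearMap.adjoint K =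
        tensor (cfc Real.sqrt ρS) s * ContinuousLinearMap.adjoint V := by
      rw [hK, ← ContinuousLinearMap.star_eq_adjoint, star_mul,
        ContinuousLinearMap.star_eq_adjoint, ContinuousLinearMap.star_eq_adjoint, adjoint_tensor,
        (cfc_sqrt_isHermitian ρS).eq, hs.adjoint_eq]
    rw [h1, hK, ← mul_assoc, mul_assoc V (tensor _ s), ← tensor_mul, cfc_sqrt_mul_self hρS, hss]
  have hKket : ∀ c : σ × κ, K (jointKet c) = V (pureTensor (τ c.1) (s (ket c.2))) := fun c => by
    rw [hK, mul_apply_eq_comp, jointKet, tensor_pureTensor]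
  have hKs : Summable fun c : σ × κ => ‖K (jointKet c)‖ ^ 2 := by
    have h1 : ∀ c : σ × κ, ‖K (jointKet c)‖ ^ 2 = ‖τ c.1‖ ^ 2 * ‖s (ket c.2)‖ ^ 2 := fun c => by
      rw [hKket, hV, norm_pureTensor, mul_pow]
    refine (summable_prod_of_nonneg fun c => sq_nonneg _).2 ⟨fun b => ?_, Summable.of_finite⟩
    simp only [h1]
    exact hsum.summable.mul_left _
  set A := Lᴴ * reducedState V ρS ρE * L with hAdef
  have hAv : ∀ v, ⟪v, sysOp A v⟫_ℂ = ((∑' c : σ × κ, ‖ContinuousLinearMap.adjoint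
      (pureTensor (sysOp L v)) (K (jointKet c))‖ ^ 2 : ℝ) : ℂ) := fun v => by
    rw [hAdef, sysOp_mul_apply, sysOp_mul_apply, ← inner_sysOp_conjTranspose,
      Matrix.conjTranspose_conjTranspose, reducedState, hKK, inner_sysOp_partialTrace hKs]
  have hA : A.PosSemidef := posSemidef_of_inner_nonneg fun v => by
    rw [hAv]
    exact_mod_cast tsum_nonneg fun c => by positivity
  -- The best reference vectors: with `χ = Y` the overlap equals `∑ ‖Y y‖²`, and one such factor
  -- cancels in the fidelity bound.
  set Y : κ → Hilb κ := fun y => ∑ b, ContinuousLinearMap.adjoint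
    (pureTensor (sysOp L (τ b))) (K (jointKet (b, y))) with hY
  have hYle : ∀ y, (1 - δ ^ 2) * ‖s (ket y)‖ ^ 2 ≤ ‖Y y‖ ^ 2 := by
    intro y
    obtain ⟨χ, hχ⟩ := h (s (ket y))
    have h1 := norm_sq_sub_le_of_norm_sub_le (fun b => pureTensor (sysOp L (τ b)))
      (fun b => K (jointKet (b, y))) (fun χ => by
        simp only [norm_pureTensor, norm_sysOp_of_conjTranspose_mul_self hL, mul_pow]
        rw [← Finset.sum_mul, hτ1, one_mul]) χ
    have h2 : ∑ b, ‖K (jointKet (b, y))‖ ^ 2 = ‖s (ket y)‖ ^ 2 := by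
      simp only [hKket, hV, norm_pureTensor, mul_pow]
      rw [← Finset.sum_mul, hτ1, one_mul]
    have h3 : ∑ b, ‖K (jointKet (b, y)) - pureTensor (sysOp L (τ b)) χ‖ ^ 2 ≤
        δ ^ 2 * ‖s (ket y)‖ ^ 2 := by
      calc _ ≤ ∑ b, (δ * (‖τ b‖ * ‖s (ket y)‖)) ^ 2 := by
            refine Finset.sum_le_sum fun b _ => ?_
            rw [hKket]
            gcongr
            exact hχ b
        _ = _ := by
            simp only [mul_pow]
            rw [← Finset.mul_sum, ← Finset.sum_mul, hτ1, one_mul]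
    rw [h2] at h1
    linarith
  -- Finitely many environment basis vectors at a time; the limit uses `∑ ‖s (ket y)‖² = Tr ρE = 1`.
  have hfin : ∀ G : Finset κ, (1 - δ ^ 2) * ∑ y ∈ G, ‖s (ket y)‖ ^ 2 ≤ fidelity A ρS ^ 2 := by
    intro G
    rw [Finset.mul_sum]
    refine (Finset.sum_le_sum fun y _ => hYle y).trans ?_
    set m := ∑ y ∈ G, ‖Y y‖ ^ 2 with hm
    rcases (Finset.sum_nonneg fun y (_ : y ∈ G) => sq_nonneg ‖Y y‖).eq_or_lt with h0 | h0
    · rw [hm, ← h0]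
      positivity
    · have h4 := sq_norm_sum_inner_le_fidelity (L := L) hA hρS G Y (fun c => K (jointKet c))
        (fun v => by
          rw [hAv, Complex.ofReal_re, ← Finset.sum_product']
          exact (hasSum_norm_adjoint_pureTensor hKs (sysOp L v)).1.sum_le_tsum _
            fun c _ => by positivity) h0
      have h5 : ∑ y ∈ G, ⟪Y y, ∑ b, ContinuousLinearMap.adjoint (pureTensor
          (sysOp L (sysOp (cfc Real.sqrt ρS) (EuclideanSpace.single b 1))))
            (K (jointKet (b, y)))⟫_ℂ = (m : ℂ) := by
        rw [hm, Complex.ofReal_sum]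
        refine Finset.sum_congr rfl fun y _ => ?_
        change ⟪Y y, Y y⟫_ℂ = _
        rw [inner_self_eq_norm_sq_to_K]
        push_cast
        rfl
      rw [h5, Complex.norm_real, Real.norm_eq_abs, sq_abs, ← hm, sq] at h4
      exact le_of_mul_le_mul_left h4 h0
  have hlim := le_of_tendsto' (hsum.mul_left (1 - δ ^ 2)) fun G => by
    rw [← Finset.mul_sum]
    exact hfin G
  linarith

end fidelity

/-! ### Square roots of code states -/

section codeState

variable {σ : Type*} [Fintype σ] [DecidableEq σ]

/-- `(HS √ρ)(HS √ρ)† = HS ρ HS† = 0`, so the purification of a code state is built from code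
vectors. -/
theorem IsCodeState.sysOp_cfc_sqrt {HS ρ : Matrix σ σ ℂ} (hHS : HS.IsHermitian)
    (hρ : IsCodeState HS ρ) (v : EuclideanSpace ℂ σ) :
    sysOp HS (sysOp (cfc Real.sqrt ρ) v) = 0 := by
  have h1 : HS * ρ = 0 := by
    rw [← hρ.2.2, ← mul_assoc, ← mul_assoc, mul_codeProj hHS, zero_mul, zero_mul]
  have h2 : HS * cfc Real.sqrt ρ = 0 := by
    rw [← Matrix.self_mul_conjTranspose_eq_zero, Matrix.conjTranspose_mul,
      (cfc_sqrt_isHermitian ρ).eq, mul_assoc, ← mul_assoc (cfc Real.sqrt ρ),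
      cfc_sqrt_mul_self hρ.1, ← mul_assoc, h1, zero_mul]
  rw [← sysOp_mul_apply, h2, sysOp, map_zero, zero_apply]

end codeState

theorem suppressionFactor_nonneg (l : ℕ∞) {Jmax Egap : ℝ} (hJ : 0 ≤ Jmax) (hE : 0 ≤ Egap)
    (r k R : ℕ) : 0 ≤ suppressionFactor l Jmax r k R Egap := by
  refine mul_nonneg (tsum_nonneg fun j => ?_) (by positivity)
  split_ifs <;> positivity

/-! ### Infidelity to leading order in the coupling -/

section recovery

variable {σ : Type*} [Fintype σ] [DecidableEq σ] {κ : Type*} {HS S : Matrix σ σ ℂ}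
  {HE : Hilb κ →ₗ.[ℂ] Hilb κ} {B : Hilb κ →L[ℂ] Hilb κ} {UE : ℝ → (Hilb κ →L[ℂ] Hilb κ)}
  {U : ℝ → ℝ → (Joint σ (Hilb κ) →L[ℂ] Joint σ (Hilb κ))}

/-- Replacing `v` by `L v` costs `ε` times the norm of the environment vector, which is bounded
uniformly for `|λ| ≤ 1`. -/
theorem norm_evolution_sub_lambUnitary_le {L : Matrix σ σ ℂ} (hUE : IsPropagator HE UE)
    {t : ℝ} (ht : 0 ≤ t) {lam : ℝ} (hlam : |lam| ≤ 1) {V : Joint σ (Hilb κ) →L[ℂ] Joint σ (Hilb κ)}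
    {v : EuclideanSpace ℂ σ} {φ : Hilb κ} {c : ℂ} {a ε : ℝ} (hε : 0 ≤ ε)
    (h1 : ‖V (pureTensor v φ) -
        pureTensor v (UE t (φ - (Complex.I * lam * c) • filtered UE B 0 t φ))‖ ≤
      a * (‖v‖ * ‖φ‖))
    (h2 : ‖sysOp L v - v‖ ≤ ε * ‖v‖) :
    ‖V (pureTensor v φ) - pureTensor (sysOp L v)
        (UE t (φ - (Complex.I * lam * c) • filtered UE B 0 t φ))‖ ≤
      (a + ε * (1 + ‖c‖ * (t * ‖B‖))) * (‖v‖ * ‖φ‖) := by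
  have h3 : ‖UE t (φ - (Complex.I * lam * c) • filtered UE B 0 t φ)‖ ≤
      (1 + ‖c‖ * (t * ‖B‖)) * ‖φ‖ := by
    rw [hUE.norm_apply]
    refine (norm_sub_le _ _).trans ?_
    rw [norm_smul, norm_mul, norm_mul, Complex.norm_I, one_mul, Complex.norm_real,
      Real.norm_eq_abs]
    calc ‖φ‖ + |lam| * ‖c‖ * ‖filtered UE B 0 t φ‖ ≤
        ‖φ‖ + 1 * ‖c‖ * (t * ‖B‖ * ‖φ‖) := by
          gcongr
          exact hUE.norm_filtered_le B 0 ht φ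
      _ = _ := by ring
  set χ := UE t (φ - (Complex.I * lam * c) • filtered UE B 0 t φ) with hχ
  have h4 : V (pureTensor v φ) - pureTensor (sysOp L v) χ =
      (V (pureTensor v φ) - pureTensor v χ) - pureTensor (sysOp L v - v) χ := by
    rw [pureTensor_sub]
    abel
  rw [h4]
  refine (norm_sub_le _ _).trans ?_
  rw [norm_pureTensor]
  calc _ ≤ a * (‖v‖ * ‖φ‖) + ε * ‖v‖ * ((1 + ‖c‖ * (t * ‖B‖)) * ‖φ‖) := by gcongr
    _ = _ := by ring

/-- If the excited components of the coupling are suppressed by the factor `K`, then the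
infidelity of the code is at most `λ² K ‖Π_C H_I² Π_C‖` to leading order. -/
theorem exists_one_sub_fidelity_sq_le (hHS : HS.IsHermitian) (hS : S.IsHermitian)
    (hB : IsSelfAdjoint B) {Egap : ℝ} (hgap : ∀ e ∈ spectrum ℝ HS, e = 0 ∨ Egap ≤ e)
    (hUE : IsPropagator HE UE) (hU : ∀ lam, IsPropagator (totalHamiltonian HS S HE B lam) (U lam))
    (hdetect : ∃ O : Hilb κ →L[ℂ] Hilb κ,
      tensor (codeProj HS) 1 * tensor S B * tensor (codeProj HS) 1 = tensor (codeProj HS) O)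
    {ρE : Hilb κ →L[ℂ] Hilb κ} (hρE : IsDensityOperator ρE)
    {t : ℝ} (ht : 0 ≤ t) {K : ℝ} (hK : 0 ≤ K)
    (hfil : ∀ e, Egap ≤ e → ∀ φ, ‖filtered UE B e t φ‖ ^ 2 ≤ K * (‖B‖ * ‖φ‖) ^ 2) :
    ∃ C : ℝ, ∃ lam₀ > 0, ∀ lam : ℝ, |lam| ≤ lam₀ → ∀ ρS : Matrix σ σ ℂ, IsCodeState HS ρS →
      1 - fidelity
          ((lambUnitary HS S UE B ρE lam t)ᴴ * reducedState (U lam t) ρS ρE *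
            lambUnitary HS S UE B ρE lam t) ρS ^ 2 ≤
        lam ^ 2 * (‖tensor (codeProj HS) (1 : Hilb κ →L[ℂ] Hilb κ) * (tensor S B) ^ 2 *
          tensor (codeProj HS) 1‖ * K) + C * |lam| ^ 3 := by
  obtain ⟨c, hc⟩ := norm_evolution_sub_le hHS hS hB hgap hUE hU hdetect ht hK hfil
  set N := ‖tensor (codeProj HS) (1 : Hilb κ →L[ℂ] Hilb κ) * (tensor S B) ^ 2 *
    tensor (codeProj HS) 1‖ with hN
  have hN0 : 0 ≤ N := norm_nonneg _
  generalize ‖tensor (σ := σ) S B‖ = m at hc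
  obtain ⟨C', hC', lam₀, hlam₀, hL⟩ := exists_norm_lambUnitary_sub_le HS S UE B ρE t
  -- The order `λ²` error of vectors: the Dyson remainder plus the displacement by the Lamb unitary.
  -- It is independent of the code state, whence uniformity.
  set C₁ := t ^ 2 * m ^ 2 + C' * (1 + ‖c‖ * (t * ‖B‖)) with hC₁
  have hC₁0 : 0 ≤ C₁ := by positivity
  refine ⟨2 * Real.sqrt (N * K) * C₁ + C₁ ^ 2, min 1 lam₀, by positivity,
    fun lam hlam ρS hρS => ?_⟩
  have hlam1 : |lam| ≤ 1 := hlam.trans (min_le_left _ _)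
  refine (one_sub_fidelity_sq_le (δ := |lam| * Real.sqrt (N * K) + C₁ * lam ^ 2)
    (conjTranspose_lambUnitary_mul_self HS S UE B ρE lam t) hρS.1 hρS.2.1 hρE
    (fun Ψ => (hU lam).norm_apply t Ψ) fun φ =>
      ⟨UE t (φ - (Complex.I * lam * c) • filtered UE B 0 t φ), fun b => ?_⟩).trans ?_
  · refine (norm_evolution_sub_lambUnitary_le hUE ht hlam1 (by positivity)
      (hc lam _ (hρS.sysOp_cfc_sqrt hHS _) φ)
      (hL lam (hlam.trans (min_le_right _ _)) _)).trans (le_of_eq ?_)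
    rw [hC₁]
    ring
  · have hsq : Real.sqrt (N * K) ^ 2 = N * K := Real.sq_sqrt (by positivity)
    have h5 : |lam| ^ 4 ≤ |lam| ^ 3 := pow_le_pow_of_le_one (abs_nonneg _) hlam1 (by norm_num)
    have h6 : lam ^ 2 = |lam| ^ 2 := (sq_abs lam).symm
    calc (|lam| * Real.sqrt (N * K) + C₁ * lam ^ 2) ^ 2 =
        |lam| ^ 2 * Real.sqrt (N * K) ^ 2 + 2 * Real.sqrt (N * K) * C₁ * |lam| ^ 3 +
          C₁ ^ 2 * |lam| ^ 4 := by rw [h6]; ring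
      _ ≤ |lam| ^ 2 * (N * K) + 2 * Real.sqrt (N * K) * C₁ * |lam| ^ 3 +
          C₁ ^ 2 * |lam| ^ 3 := by rw [hsq]; gcongr
      _ = _ := by rw [h6]; ring

end recovery

end

end ErrorSuppression

open ErrorSuppression

theorem theorem2
    -- the system: energies are `0` and energies at least `Egap > 0`
    {σ : Type*} [Fintype σ] [DecidableEq σ]
    (HS S : Matrix σ σ ℂ) (hHS : HS.IsHermitian) (hS : S.IsHermitian)
    (Egap : ℝ) (hEgap : 0 < Egap)
    (hground : (0 : ℝ) ∈ spectrum ℝ HS)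
    (hgap : ∀ e ∈ spectrum ℝ HS, e = 0 ∨ Egap ≤ e)
    -- the environment, with Hamiltonian `HE = ∑ i, h i + HU`
    {Λ : Type*} [Fintype Λ] (ι : Λ → Type*)
    {I : Type*} [Fintype I] (h : I → (Env ι →L[ℂ] Env ι))
    (hh : ∀ i, IsSelfAdjoint (h i))
    (HU HE : Env ι →ₗ.[ℂ] Env ι)
    (hHE : HE = (∑ i, h i).toLinearMap +ᵥ HU)
    (B : Env ι →L[ℂ] Env ι) (hB : IsSelfAdjoint B)
    -- locality and boundedness around the support of `B`
    (Jmax : ℝ) (hJpos : 0 < Jmax) (hJ : ∀ i, ‖h i‖ ≤ Jmax)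
    (k r : ℕ) (hkpos : 0 < k) (hrpos : 0 < r)
    (hk : ∀ i, (supp (h i)).ncard ≤ k)
    (hr : ∀ x : Λ, {i | x ∈ supp (h i)}.ncard ≤ r)
    (R : ℕ) (hR : R = numNoncommuting h B)
    (hdisj : Disjoint (supp B) (suppUnbounded HU))
    (l : ℕ∞) (hl : l = pathLength h (supp B) (suppUnbounded HU))
    -- the evolution of the environment, and its equilibrium state
    (UE : ℝ → (Env ι →L[ℂ] Env ι)) (hUE : IsPropagator HE UE)
    (ρE : Env ι →L[ℂ] Env ι) (hρE : IsDensityOperator ρE) (heq : CommutesWith ρE HE)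
    -- the joint evolution
    (U : ℝ → ℝ → (Joint σ (Env ι) →L[ℂ] Joint σ (Env ι)))
    (hU : ∀ lam, IsPropagator (totalHamiltonian HS S HE B lam) (U lam))
    -- the error detection condition
    (hdetect : ∃ O : Env ι →L[ℂ] Env ι,
      tensor (codeProj HS) 1 * tensor S B * tensor (codeProj HS) 1 = tensor (codeProj HS) O)
    (t : ℝ) (ht : 0 ≤ t) :
    ∃ C : ℝ, ∃ lam₀ > 0, ∀ lam : ℝ, |lam| ≤ lam₀ → ∀ ρS : Matrix σ σ ℂ, IsCodeState HS ρS →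
      1 - fidelity
          ((lambUnitary HS S UE B ρE lam t)ᴴ * reducedState (U lam t) ρS ρE *
            lambUnitary HS S UE B ρE lam t) ρS ^ 2 ≤
        lam ^ 2 *
            (16 * ‖tensor (codeProj HS) (1 : Env ι →L[ℂ] Env ι) * (tensor S B) ^ 2 *
              tensor (codeProj HS) 1‖ / Egap ^ 2) +
          lam ^ 2 *
            (t ^ 2 * ‖tensor (codeProj HS) (1 : Env ι →L[ℂ] Env ι) * (tensor S B) ^ 2 *
              tensor (codeProj HS) 1‖ / suppressionFactor l Jmax r k R Egap) +
          C * |lam| ^ 3 := by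
  subst hl hR
  have hQ := suppressionFactor_nonneg (pathLength h (supp B) (suppUnbounded HU)) hJpos.le hEgap.le
    r k (numNoncommuting h B)
  -- Here `K = 16 / Egap² + t² / Q`, supplied by the locality estimate; its two summands give the
  -- two leading terms.
  obtain ⟨C, lam₀, hlam₀, hC⟩ := exists_one_sub_fidelity_sq_le hHS hS hB hgap hUE hU hdetect hρE
    ht (by positivity)
    fun e he φ => norm_sq_filtered_le hEgap hh hHE hJpos hJ hkpos hrpos hk hr hUE he ht φ
  refine ⟨C, lam₀, hlam₀, fun lam hlam ρS hρS => (hC lam hlam ρS hρS).trans (le_of_eq ?_)⟩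
  ring
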